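/- **Setting.** Let $\Gamma=\mathbb Z^d$, $\Lambda_k=\{-k,\dots,k\}^d$, let $d(\cdot,\cdot)$ be the $\ell^1$-distance, and let $d^{\Lambda_k}$ be metrics on $\Lambda_k$ with $d^{\Lambda_k}\le d$ and $d^{\Lambda_k}(x,y)=d(x,y)$ whenever $d(x,y)\le k$. For finite $X\subset\Gamma$ let $\mathcal A_X$ be the algebra generated by the identity and the fermionic creation and annihilation operators $a^*_{x,i},a_{x,i}$, $x\in X$, $1\le i\le r$ (acting on Fock space, so that $\mathcal A_X\subset\mathcal A_{X'}$ for $X\subset X'$), let $a_x^*a_x=\sum_i a_{x,i}^*a_{x,i}$, $N_X=\sum_{x\in X}a_x^*a_x$, and let $\mathcal A_X^N$ be the set of elements of $\mathcal A_X$ commuting with $N_X$. *Decay functions.* $\mathcal S$ is the set of functions $\zeta:[0,\infty)\to(0,\infty)$ that are bounded, non-increasing, satisfy $\zeta(s+t)\ge\zeta(s)\zeta(t)$, and satisfy $\sup_{s\ge0} s^n\zeta(s)<\infty$ for all $n\in\mathbb N_0$. Put $F_\zeta(s)=\zeta(s)/(1+s)^{d+1}$. *Interactions.* Let $I\subset\mathbb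 R$ be an interval. An interaction is a family of self-adjoint $\Phi^{\Lambda_k}(t,X)\in\mathcal A_X^N$ ($k\in\mathbb N$, $t\in I$, $X\subset\Lambda_k$); an infinite volume interaction is a family of self-adjoint $\Psi(t,X)\in\mathcal A_X^N$ ($t\in I$, $X\subset\Gamma$ finite), which defines an interaction by restriction to the boxes. For each $t$, $$\|\Phi(t)\|_{\zeta,n}=\sup_k\sup_{x,y\in\Lambda_k}\ \sum_{X\subset\Lambda_k:\,x,y\in X} d^{\Lambda_k}\text{-diam}(X)^n\,\frac{\|\Phi^{\Lambda_k}(t,X)\|}{F_\zeta(d^{\Lambda_k}(x,y))},$$ $$\|\varphi\|_{\zeta,n,\Lambda_M}=\sup_{x,y\in\Lambda_M}\ \sum_{X\subset\Lambda_M:\,x,y\in X}\operatorname{diam}(X)^n\,\frac{\|\varphi(X)\|}{F_\zeta(d(x,y))}$$ (the latter with respect to $d$). $\Phi\in\mathcal B_{I,\zeta,n}$ means that all $t\mapsto\Phi^{\Lambda_k}(t,X)$ are $C^\infty$ on $I$ and that there are $\zeta^{(i)}\in\mathcal S$, $i\in\mathbb N_0$, with $\zeta^{(0)}=\zeta$ and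 $\sup_{t\in I}\|\Phi^{(i)}(t)\|_{\zeta^{(i)},n}<\infty$ for all $i$, where $\Phi^{(i)}$ is the term-wise $i$-th time derivative. $\mathcal B^\circ_{I,\zeta,n}$ is this space for $d^{\Lambda_k}=d$. Such a $\Phi$ has a thermodynamic limit in $\mathcal B_{I,\zeta,n}$ if there is an infinite volume interaction $\Psi\in\mathcal B^\circ_{I,\zeta,n}$ with $$\lim_{k\to\infty}\ \sup_{t\in I}\Big\|\tfrac{\mathrm d^i}{\mathrm dt^i}(\Psi-\Phi^{\Lambda_k})(t)\Big\|_{\zeta^{(i)},n,\Lambda_M}=0\qquad\text{for all } i\in\mathbb N_0,\ M\in\mathbb N .$$ *Operator families.* A family $A=(A^{\Lambda_k}(t))$ lies in $\mathcal L_{I,\zeta,\infty}$ (resp. $\mathcal L_{I,\mathcal S,\infty}$) if there is an interaction $\Phi_A$ with $A^{\Lambda_k}(t)=\sum_{X\subset\Lambda_k}\Phi_A^{\Lambda_k}(t,X)$ such that for every $n\in\mathbb N_0$, $\Phi_A\in\mathcal B_{I,\zeta,n}$ (resp. $\Phi_A\in\mathcal B_{I,\zeta_n,n}$ for some $\zeta_n\in\mathcal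 S$). It has a thermodynamic limit in that space if $\Phi_A$ can be chosen such that, in addition, for every $n$ it has a thermodynamic limit in $\mathcal B_{I,\zeta,n}$ (resp. in $\mathcal B_{I,\zeta_n,n}$ for some $\zeta_n\in\mathcal S$). A skew-adjoint family such as $[H,B]$ is said to have one of these properties if it has it after multiplication by $\mathrm i$. *Lipschitz potentials.* $v\in\mathcal V_I$ is a family of functions $v^{\Lambda_k}(t,\cdot):\Lambda_k\to\mathbb R$, smooth in $t\in I$, such that for every $i\in\mathbb N_0$ there is a constant $C$ such that, for all $t\in I$ and all $k$, the $i$-th time derivative of $v^{\Lambda_k}(t,\cdot)$ is Lipschitz on $(\Lambda_k,d^{\Lambda_k})$ with constant $C$. Its operator family is $V_v^{\Lambda_k}(t)=\sum_{x\in\Lambda_k}v^{\Lambda_k}(t,x)\,a_x^*a_x$. *Inverse Liouvillian.* Let $g>\tilde g\ge0$ and let $W\in L^1(\mathbb R)$ be real-valued and odd with $\sup_s|s|^n|W(s)|<\infty$ for all $n\in\mathbb N_0$, whose Fourier transform $\widehat W(\omega)=(2\pi)^{-1/2}\int W(s)e^{-\mathrm i\omega s}\,\mathrm ds$ is $C^\infty$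 with $\widehat W(\omega)=\frac{-\mathrm i}{\sqrt{2\pi}\,\omega}$ for $|\omega|\ge g$ and $\widehat W(\omega)=0$ for $|\omega|\le\tilde g$. Put $$\mathcal I_H(B)^{\Lambda_k}(t)=\int_{\mathbb R}W(s)\,e^{\mathrm isH^{\Lambda_k}(t)}\,B^{\Lambda_k}(t)\,e^{-\mathrm isH^{\Lambda_k}(t)}\,\mathrm ds .$$ **Lemma D.4 (Thermodynamic limit of the inverse Liouvillian).** Let $a>0$ and let $H\in\mathcal L_{I,\exp(-a\,\cdot),\infty}$ have a thermodynamic limit (in that space). Let $B$ be either an operator family in $\mathcal L_{I,\mathcal S,\infty}$ or $B=V_v$ for a Lipschitz potential $v\in\mathcal V_I$. Assume that $[H,B]$ lies in $\mathcal L_{I,\mathcal S,\infty}$ and has a thermodynamic limit. Then $\mathcal I_H(B)$ lies in $\mathcal L_{I,\mathcal S,\infty}$ and has a thermodynamic limit. -/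

import Mathlib

open Filter Topology MeasureTheory
open scoped ENNReal ContDiff

noncomputable section

namespace LatticeFermions

/-! ### The lattice and its boxes -/

/-- The lattice `ℤ^d`. -/
abbrev Site (d : ℕ) : Type := Fin d → ℤ

/-- The centred box `{-k, …, k}^d`. -/
def box (d k : ℕ) : Finset (Site d) :=
  Fintype.piFinset fun _ => Finset.Icc (-(k : ℤ)) (k : ℤ)

/-- The `ℓ¹`-distance on `ℤ^d`. -/
def l1dist {d : ℕ} (x y : Site d) : ℝ := ∑ j, |(x j : ℝ) - (y j : ℝ)|

/-- A sequence of metrics, one on each box, subject to the bulk-compatibility condition.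
Only the values `dist k x y` with `x`, `y` in the `k`-th box matter. -/
structure BoxMetrics (d : ℕ) where
  dist : ℕ → Site d → Site d → ℝ
  eq_zero_iff : ∀ k, ∀ x ∈ box d k, ∀ y ∈ box d k, dist k x y = 0 ↔ x = y
  symm : ∀ k, ∀ x ∈ box d k, ∀ y ∈ box d k, dist k x y = dist k y x
  triangle : ∀ k, ∀ x ∈ box d k, ∀ y ∈ box d k, ∀ z ∈ box d k,
    dist k x z ≤ dist k x y + dist k y z
  le_l1dist : ∀ k, ∀ x ∈ box d k, ∀ y ∈ box d k, dist k x y ≤ l1dist x y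
  eq_l1dist : ∀ k, ∀ x ∈ box d k, ∀ y ∈ box d k, l1dist x y ≤ k → dist k x y = l1dist x y

/-- Open boundary conditions: the `ℓ¹`-distance on every box. -/
def openMetrics (d : ℕ) : BoxMetrics d where
  dist _ x y := l1dist x y
  eq_zero_iff k x _ y _ := by
    constructor
    · intro h
      have h0 := (Finset.sum_eq_zero_iff_of_nonneg (fun j _ => abs_nonneg _)).1 h
      funext j
      have hj := abs_eq_zero.1 (h0 j (Finset.mem_univ j))
      exact_mod_cast sub_eq_zero.1 hj
    · rintro rfl
      simp [l1dist]
  symm k x _ y _ := by simp only [l1dist, abs_sub_comm]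
  triangle k x _ y _ z _ := by
    simp only [l1dist, ← Finset.sum_add_distrib]
    exact Finset.sum_le_sum fun j _ => abs_sub_le _ _ _
  le_l1dist _ _ _ _ _ := le_rfl
  eq_l1dist _ _ _ _ _ _ := rfl

/-- The diameter of a finite set of sites with respect to a distance function `δ`. -/
def diam {d : ℕ} (δ : Site d → Site d → ℝ) (X : Finset (Site d)) : ℝ≥0∞ :=
  ⨆ x ∈ X, ⨆ y ∈ X, ENNReal.ofReal (δ x y)

/-! ### Fermionic Fock space and the local algebras -/

/-- One-particle modes: a site together with one of `r` internal degrees of freedom. -/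
abbrev Mode (d r : ℕ) : Type := Site d × Fin r

/-- Fermionic Fock space over `ℓ²(ℤ^d, ℂ^r)` in the occupation number representation: the basis
vector labelled by the finite set `S` of modes is the wedge product of the modes in `S`, in
increasing order of `Encodable.encode`. -/
abbrev Fock (d r : ℕ) : Type := lp (fun _ : Finset (Mode d r) => ℂ) 2

/-- The bounded operators on Fock space. -/
abbrev Op (d r : ℕ) : Type := Fock d r →L[ℂ] Fock d r

/-- The sign picked up when the mode `q` is moved to its place among the modes in `S`. -/
def fermiSign {d r : ℕ} (S : Finset (Mode d r)) (q : Mode d r) : ℂ :=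
  (-1) ^ (S.filter fun p => Encodable.encode p < Encodable.encode q).card

lemma norm_fermiSign {d r : ℕ} (S : Finset (Mode d r)) (q : Mode d r) :
    ‖fermiSign S q‖ = 1 := by
  simp [fermiSign]

/-- The coefficients of `a_q f`. -/
def annihilateCoeff {d r : ℕ} (q : Mode d r) (f : Finset (Mode d r) → ℂ)
    (T : Finset (Mode d r)) : ℂ :=
  if q ∈ T then 0 else fermiSign T q * f (insert q T)

lemma annihilateCoeff_bound {d r : ℕ} (q : Mode d r) (f : Fock d r)
    (s : Finset (Finset (Mode d r))) :
    ∑ T ∈ s, ‖annihilateCoeff q f T‖ ^ (2 : ℝ≥0∞).toReal ≤ ‖f‖ ^ (2 : ℝ≥0∞).toReal := by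
  classical
  have h2 : 0 < (2 : ℝ≥0∞).toReal := by norm_num
  have h1 : ∑ T ∈ s, ‖annihilateCoeff q f T‖ ^ (2 : ℝ≥0∞).toReal
      = ∑ T ∈ s.filter (fun T => q ∉ T), ‖f (insert q T)‖ ^ (2 : ℝ≥0∞).toReal := by
    rw [Finset.sum_filter]
    refine Finset.sum_congr rfl fun T _ => ?_
    by_cases hq : q ∈ T
    · simp [annihilateCoeff, hq]
    · simp [annihilateCoeff, hq, norm_fermiSign]
  have hinj : Set.InjOn (fun T : Finset (Mode d r) => insert q T)
      (s.filter (fun T => q ∉ T) : Finset (Finset (Mode d r))) := by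
    intro T hT T' hT' h
    have e1 := (Finset.mem_filter.1 (Finset.mem_coe.1 hT)).2
    have e2 := (Finset.mem_filter.1 (Finset.mem_coe.1 hT')).2
    have h' : (insert q T).erase q = (insert q T').erase q := congrArg (fun U => U.erase q) h
    rwa [Finset.erase_insert e1, Finset.erase_insert e2] at h'
  rw [h1, ← Finset.sum_image (f := fun T => ‖f T‖ ^ (2 : ℝ≥0∞).toReal) hinj]
  exact lp.sum_rpow_le_norm_rpow h2 f _

/-- The annihilation operator `a_q`. -/
def annihilate {d r : ℕ} (q : Mode d r) : Op d r :=
  LinearMap.mkContinuous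
    { toFun := fun f => ⟨annihilateCoeff q f, memℓp_gen' (annihilateCoeff_bound q f)⟩
      map_add' := by
        intro f g
        ext T
        change annihilateCoeff q (f + g : Fock d r) T
          = annihilateCoeff q f T + annihilateCoeff q g T
        by_cases hq : q ∈ T <;> simp [annihilateCoeff, hq, mul_add]
      map_smul' := by
        intro c f
        ext T
        change annihilateCoeff q (c • f : Fock d r) T = c • annihilateCoeff q f T
        by_cases hq : q ∈ T <;> simp [annihilateCoeff, hq, mul_left_comm] }
    1
    (by
      intro f
      rw [one_mul]
      exact lp.norm_le_of_forall_sum_le (by norm_num) (norm_nonneg f)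
        (annihilateCoeff_bound q f))

/-- The creation operator `a_q^*`. -/
def create {d r : ℕ} (q : Mode d r) : Op d r := star (annihilate q)

/-- The local algebra of a finite set `X` of sites, generated by the identity and the creation and
annihilation operators of the modes in `X`. -/
def localAlgebra {d r : ℕ} (X : Finset (Site d)) : StarSubalgebra ℂ (Op d r) :=
  StarAlgebra.adjoin ℂ {A | ∃ q : Mode d r, q.1 ∈ X ∧ A = annihilate q}

/-- The number operator `a_x^* a_x` of the site `x`. -/
def siteNumber {d r : ℕ} (x : Site d) : Op d r :=
  ∑ i : Fin r, create (x, i) * annihilate (x, i)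

/-- The number operator of a finite set of sites. -/
def numberOp {d r : ℕ} (X : Finset (Site d)) : Op d r := ∑ x ∈ X, siteNumber x

/-- The self-adjoint elements of the algebra of `X` that commute with the number operator
of `X`. -/
def IsLocalTerm {d r : ℕ} (X : Finset (Site d)) (A : Op d r) : Prop :=
  A ∈ localAlgebra (r := r) X ∧ Commute A (numberOp X) ∧ IsSelfAdjoint A

/-! ### Decay functions -/

/-- Positive, bounded, non-increasing, logarithmically superadditive functions on `[0, ∞)` that
decay faster than every inverse polynomial (only the values on `[0, ∞)` matter). -/
structure ClassS (ζ : ℝ → ℝ) : Prop where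
  pos : ∀ s, 0 ≤ s → 0 < ζ s
  bounded : ∃ C, ∀ s, 0 ≤ s → ζ s ≤ C
  antitone : AntitoneOn ζ (Set.Ici 0)
  superadd : ∀ s t, 0 ≤ s → 0 ≤ t → ζ s * ζ t ≤ ζ (s + t)
  decay : ∀ n : ℕ, ∃ C, ∀ s, 0 ≤ s → s ^ n * ζ s ≤ C

/-- `F_ζ(s) = ζ(s) / (1 + s)^(d + 1)`. -/
def decayF (d : ℕ) (ζ : ℝ → ℝ) (s : ℝ) : ℝ := ζ s / (1 + s) ^ (d + 1)

/-! ### Interactions and their norms -/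

/-- A time-dependent interaction `Φ k t X`: box number, time, finite set of sites. -/
abbrev Interaction (d r : ℕ) : Type := ℕ → ℝ → Finset (Site d) → Op d r

/-- A time-dependent operator family `A k t`: box number, time. -/
abbrev OpFamily (d r : ℕ) : Type := ℕ → ℝ → Op d r

/-- The weighted sum of the local terms within a finite set `Λ`, measured with the distance
function `δ`. -/
def volNorm {d r : ℕ} (δ : Site d → Site d → ℝ) (ζ : ℝ → ℝ) (n : ℕ) (Λ : Finset (Site d))
    (φ : Finset (Site d) → Op d r) : ℝ≥0∞ :=
  ⨆ x ∈ Λ, ⨆ y ∈ Λ, ∑ X ∈ Λ.powerset with x ∈ X ∧ y ∈ X,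
    diam δ X ^ n * ‖φ X‖ₑ / ENNReal.ofReal (decayF d ζ (δ x y))

/-- The norm `‖Φ‖_{ζ,n}` of a (time-independent) interaction. -/
def interactionNorm {d r : ℕ} (D : BoxMetrics d) (ζ : ℝ → ℝ) (n : ℕ)
    (φ : ℕ → Finset (Site d) → Op d r) : ℝ≥0∞ :=
  ⨆ k, volNorm (D.dist k) ζ n (box d k) (φ k)

/-- The bulk norm `‖φ‖_{ζ,n,Λ_M}`, which refers to the `ℓ¹`-distance. -/
def bulkNorm {d r : ℕ} (ζ : ℝ → ℝ) (n M : ℕ) (φ : Finset (Site d) → Op d r) : ℝ≥0∞ :=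
  volNorm l1dist ζ n (box d M) φ

/-- The term-wise `i`-th time derivative on the interval `I`. -/
def timeDeriv {d r : ℕ} (I : Set ℝ) (i : ℕ) (φ : ℝ → Finset (Site d) → Op d r)
    (t : ℝ) (X : Finset (Site d)) : Op d r :=
  iteratedDerivWithin i (fun s => φ s X) I t

/-- `Φ` is an interaction on the time interval `I` with term-wise smooth time dependence,
extended by zero to sets that do not lie in the respective box. -/
structure IsSmoothInteraction {d r : ℕ} (I : Set ℝ) (Φ : Interaction d r) : Prop where
  isLocalTerm : ∀ k, ∀ t ∈ I, ∀ X ⊆ box d k, IsLocalTerm X (Φ k t X)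
  eq_zero : ∀ k, ∀ t ∈ I, ∀ X, ¬ X ⊆ box d k → Φ k t X = 0
  smooth : ∀ k, ∀ X ⊆ box d k, ContDiffOn ℝ ∞ (fun t => Φ k t X) I

/-- `ζs` is an admissible sequence of decay functions for the time derivatives of `Φ`, starting
with `ζ`: all of them belong to the class `S`, and the `i`-th time derivative of `Φ` is bounded
in the norm with decay function `ζs i`, uniformly in time. -/
structure Admissible {d r : ℕ} (D : BoxMetrics d) (I : Set ℝ) (ζ : ℝ → ℝ) (n : ℕ)
    (Φ : Interaction d r) (ζs : ℕ → ℝ → ℝ) : Prop where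
  zero : ζs 0 = ζ
  classS : ∀ i, ClassS (ζs i)
  bounded : ∀ i, ⨆ t ∈ I, interactionNorm D (ζs i) n (fun k => timeDeriv I i (Φ k) t) < ⊤

/-- The space `B_{I,ζ,n}` of smooth and bounded time-dependent interactions. -/
def MemB {d r : ℕ} (D : BoxMetrics d) (I : Set ℝ) (ζ : ℝ → ℝ) (n : ℕ)
    (Φ : Interaction d r) : Prop :=
  IsSmoothInteraction I Φ ∧ ∃ ζs, Admissible D I ζ n Φ ζs

/-- The interaction defined by an infinite volume interaction by restriction to the boxes. -/
def restrictToBoxes {d r : ℕ} (Ψ : ℝ → Finset (Site d) → Op d r) : Interaction d r :=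
  fun k t X => if X ⊆ box d k then Ψ t X else 0

/-- `Φ ∈ B_{I,ζ,n}` has a thermodynamic limit: there is an infinite volume interaction `Ψ` in
`B_{I,ζ,n}` for open boundary conditions to which `Φ` converges in the bulk, together with all
time derivatives and uniformly in time. -/
def HasLimitB {d r : ℕ} (D : BoxMetrics d) (I : Set ℝ) (ζ : ℝ → ℝ) (n : ℕ)
    (Φ : Interaction d r) : Prop :=
  IsSmoothInteraction I Φ ∧ ∃ ζs, Admissible D I ζ n Φ ζs ∧
    ∃ Ψ : ℝ → Finset (Site d) → Op d r,
      MemB (openMetrics d) I ζ n (restrictToBoxes Ψ) ∧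
      ∀ i M : ℕ, Tendsto
        (fun k => ⨆ t ∈ I, bulkNorm (ζs i) n M (timeDeriv I i (fun s X => Ψ s X - Φ k s X) t))
        atTop (𝓝 0)

/-! ### Operator families -/

/-- `Φ` is an interaction for the operator family `A`: `A k t` is the sum of the local terms. -/
def Represents {d r : ℕ} (I : Set ℝ) (Φ : Interaction d r) (A : OpFamily d r) : Prop :=
  ∀ k, ∀ t ∈ I, A k t = ∑ X ∈ (box d k).powerset, Φ k t X

/-- The operator families in `L_{I,ζ,∞}` that have a thermodynamic limit. -/
def HasLimitLζ {d r : ℕ} (D : BoxMetrics d) (I : Set ℝ) (ζ : ℝ → ℝ)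
    (A : OpFamily d r) : Prop :=
  ∃ Φ : Interaction d r, Represents I Φ A ∧ ∀ n : ℕ, HasLimitB D I ζ n Φ

/-- The space `L_{I,S,∞}` of operator families. -/
def MemLS {d r : ℕ} (D : BoxMetrics d) (I : Set ℝ) (A : OpFamily d r) : Prop :=
  ∃ Φ : Interaction d r, Represents I Φ A ∧ ∀ n : ℕ, ∃ ζ, ClassS ζ ∧ MemB D I ζ n Φ

/-- The operator families in `L_{I,S,∞}` that have a thermodynamic limit. -/
def HasLimitLS {d r : ℕ} (D : BoxMetrics d) (I : Set ℝ) (A : OpFamily d r) : Prop :=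
  ∃ Φ : Interaction d r, Represents I Φ A ∧ ∀ n : ℕ, ∃ ζ, ClassS ζ ∧ HasLimitB D I ζ n Φ

/-- `i [A, B]`. The interactions are self-adjoint by definition while the commutator of
self-adjoint operators is skew-adjoint, hence the factor `i`. -/
def iCommutator {d r : ℕ} (A B : OpFamily d r) : OpFamily d r :=
  fun k t => Complex.I • (A k t * B k t - B k t * A k t)

/-! ### Lipschitz potentials -/

/-- The space `V_I` of smooth and bounded time-dependent Lipschitz potentials `v k t x`. -/
structure MemV {d : ℕ} (D : BoxMetrics d) (I : Set ℝ) (v : ℕ → ℝ → Site d → ℝ) : Prop where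
  smooth : ∀ k, ∀ x ∈ box d k, ContDiffOn ℝ ∞ (fun t => v k t x) I
  lipschitz : ∀ i : ℕ, ∃ C : ℝ, ∀ t ∈ I, ∀ k, ∀ x ∈ box d k, ∀ y ∈ box d k,
    |iteratedDerivWithin i (fun s => v k s x) I t - iteratedDerivWithin i (fun s => v k s y) I t|
      ≤ C * D.dist k x y

/-- The operator family `V_v = ∑ₓ v(x) a_x^* a_x` of a potential. -/
def potentialOp {d r : ℕ} (v : ℕ → ℝ → Site d → ℝ) : OpFamily d r :=
  fun k t => ∑ x ∈ box d k, (v k t x : ℂ) • siteNumber x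

/-! ### The inverse Liouvillian -/

/-- The Fourier transform `(2π)^(-1/2) ∫ W(s) e^{-iws} ds`. -/
def fourierW (W : ℝ → ℝ) (w : ℝ) : ℂ :=
  ((Real.sqrt (2 * Real.pi))⁻¹ : ℝ) *
    ∫ s : ℝ, Complex.exp (-(Complex.I * w * s)) * (W s : ℂ)

/-- The kernels `W` admitted in the inverse Liouvillian, for gap parameters `g' < g`. -/
structure IsKernel (g g' : ℝ) (W : ℝ → ℝ) : Prop where
  integrable : Integrable W
  odd : ∀ s, W (-s) = -W s
  decay : ∀ n : ℕ, ∃ C : ℝ, ∀ s, |s| ^ n * |W s| ≤ C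
  fourier_smooth : ContDiff ℝ ∞ (fourierW W)
  fourier_eq : ∀ w : ℝ, g ≤ |w| → fourierW W w = -Complex.I / (Real.sqrt (2 * Real.pi) * w : ℝ)
  fourier_eq_zero : ∀ w : ℝ, |w| ≤ g' → fourierW W w = 0

/-- The Heisenberg evolution `e^{isH} A e^{-isH}`. -/
def heisenberg {d r : ℕ} (H : Op d r) (s : ℝ) (A : Op d r) : Op d r :=
  NormedSpace.exp ((Complex.I * s) • H) * A * NormedSpace.exp (-((Complex.I * s) • H))

/-- The inverse Liouvillian `I_H(B)(t) = ∫ W(s) e^{isH(t)} B(t) e^{-isH(t)} ds`, in each box. -/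
def invLiouvillian {d r : ℕ} (W : ℝ → ℝ) (H B : OpFamily d r) : OpFamily d r :=
  fun k t => ∫ s : ℝ, (W s : ℂ) • heisenberg (H k t) s (B k t)

end LatticeFermions

end

open Filter Topology MeasureTheory
open scoped ENNReal ContDiff

namespace LatticeFermions

/-! ### Canonical anticommutation relations -/

section CAR

variable {d r : ℕ}

/-! Since `W` is odd, its integral vanishes, so `B` may be subtracted from its evolution under the
integral. The difference is the time integral of the evolved commutator `i[H, B]`. Hence the inverse
Liouvillian is a weighted time average of the evolution of this commutator
(`integral_evolve_eq_kernelInt`). In this form operator families and Lipschitz potentials are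
treated alike.

Locality. The commutator is split into contributions of single sites `y`, each local term being
shared equally by the sites of its support. Both the Hamiltonian and the contribution of `y` are
restricted to growing balls about `y` (`localPiece`). Telescoping over the radius writes the
operator as a sum of increments, each in the gauge-invariant algebra of a ball. That algebra is
finite-dimensional, hence stable under exponentials and integrals. A Lieb-Robinson bound
(`lieb_robinson`, `evolve_sub_evolve_le_of_weight`), the moments of the commutator and the moments
of `W` show that the increments decay faster than every power of the radius
(`exists_localPiece_decay`). Summing over centres and radii bounds all moments of the resulting
interaction (`QuasiLocalPair.hasMoments_transform`). By `exists_classS`, bounded moments give finite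
norms for suitable decay functions of class S, so the estimates can be carried out with moments.

Thermodynamic limit. The metric of the `k`-th box agrees with the `ℓ¹`-distance only up to distance
`k`; it may bring remote points of the box close to a bulk point. Therefore two exhaustions are
used. The `ℓ¹`-balls give increments of the same form in every large box. The metric balls enter
only as corrections relative to them, and a correction supported in a fixed box vanishes for large
`k`. So a fixed local term is eventually a fixed finite sum of local pieces
(`transform_eq_bulkTransform`) whose data converge (`uniformlyNull_localPiece`), and the moment
bounds survive the limit (`hasMoments_limitTransform`).

Time derivatives. The Lieb-Robinson estimates are made for the undifferentiated quantities only.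
Their derivatives are merely shown to be polynomially bounded (`SmoothFamily`); interpolation
between a function and its second derivative (`norm_deriv_le_interpolation`) then carries rapid
decay and uniform convergence over to derivatives of every order (`SmoothFamily.rapidDecay`,
`SmoothFamily.tendsto_zero`). -/

lemma annihilate_apply (q : Mode d r) (f : Fock d r) (T : Finset (Mode d r)) :
    annihilate q f T = if q ∈ T then 0 else fermiSign T q * f (insert q T) := rfl

/-- The sign counts the modes strictly before `q`, so the presence of `q` itself is invisible. -/
lemma fermiSign_insert_self (T : Finset (Mode d r)) (q : Mode d r) :
    fermiSign (insert q T) q = fermiSign T q := by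
  simp [fermiSign, Finset.filter_insert]

lemma fermiSign_erase_self (T : Finset (Mode d r)) (q : Mode d r) :
    fermiSign (T.erase q) q = fermiSign T q := by
  rw [← fermiSign_insert_self (T.erase q) q, ← fermiSign_insert_self T q]
  congr 1
  ext x
  by_cases h : x = q <;> simp [h]

lemma fermiSign_insert {T : Finset (Mode d r)} {p : Mode d r} (hp : p ∉ T) (q : Mode d r) :
    fermiSign (insert p T) q
      = (if Encodable.encode p < Encodable.encode q then -1 else 1) * fermiSign T q := by
  unfold fermiSign
  rw [Finset.filter_insert]
  split_ifs with h
  · rw [Finset.card_insert_of_notMem (by simp [hp]), pow_succ]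
    ring
  · rw [one_mul]

lemma fermiSign_mul_self (T : Finset (Mode d r)) (q : Mode d r) :
    fermiSign T q * fermiSign T q = 1 := by
  unfold fermiSign
  rw [← mul_pow]
  simp

lemma conj_fermiSign (T : Finset (Mode d r)) (q : Mode d r) :
    (starRingEnd ℂ) (fermiSign T q) = fermiSign T q := by
  simp [fermiSign]

lemma orderSign_swap {p q : Mode d r} (h : p ≠ q) :
    (if Encodable.encode p < Encodable.encode q then (-1 : ℂ) else 1)
      = -(if Encodable.encode q < Encodable.encode p then (-1 : ℂ) else 1) := by
  have h' : Encodable.encode p ≠ Encodable.encode q := fun e => h (Encodable.encode_injective e)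
  rcases lt_or_gt_of_ne h' with h1 | h1
  · simp [h1, h1.le]
  · simp [h1, h1.le]

/-- The creation operator is an adjoint, known only through inner products; the action on basis
vectors is what makes `create_apply` computable. -/
lemma annihilate_single (q : Mode d r) (T : Finset (Mode d r)) :
    annihilate q (lp.single 2 T (1 : ℂ) : Fock d r)
      = if q ∈ T then fermiSign T q • (lp.single 2 (T.erase q) (1 : ℂ) : Fock d r) else 0 := by
  ext U
  rw [annihilate_apply]
  by_cases hT : q ∈ T
  · rw [if_pos hT]
    simp only [lp.coeFn_smul, Pi.smul_apply, lp.single_apply, smul_eq_mul]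
    by_cases hU : q ∈ U
    · rw [if_pos hU, Pi.single_eq_of_ne, mul_zero]
      rintro rfl
      simp at hU
    · rw [if_neg hU]
      by_cases hUT : U = T.erase q
      · subst hUT
        simp [hT, fermiSign_erase_self]
      · rw [Pi.single_eq_of_ne hUT, Pi.single_eq_of_ne]
        · simp
        · rintro rfl
          exact hUT (by rw [Finset.erase_insert hU])
  · rw [if_neg hT]
    split_ifs with hU
    · simp
    · rw [lp.single_apply, Pi.single_eq_of_ne]
      · simp
      · rintro rfl
        simp at hT

lemma create_apply (q : Mode d r) (f : Fock d r) (T : Finset (Mode d r)) :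
    create q f T = if q ∈ T then fermiSign T q * f (T.erase q) else 0 := by
  have h1 : inner ℂ (lp.single 2 T (1 : ℂ) : Fock d r) (create q f)
      = inner ℂ (annihilate q (lp.single 2 T (1 : ℂ) : Fock d r)) f := by
    rw [create, ContinuousLinearMap.star_eq_adjoint, ContinuousLinearMap.adjoint_inner_right]
  rw [lp.inner_single_left, annihilate_single] at h1
  simp only [RCLike.inner_apply, map_one, mul_one] at h1
  rw [h1]
  split_ifs with h
  · rw [inner_smul_left, lp.inner_single_left, conj_fermiSign]
    simp
  · simp

lemma annihilate_mul_annihilate {p q : Mode d r} (h : p ≠ q) :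
    annihilate p * annihilate q = -(annihilate q * annihilate p) := by
  ext f T
  change annihilate p (annihilate q f) T = -(annihilate q (annihilate p f) T)
  simp only [annihilate_apply, Finset.mem_insert]
  by_cases hp : p ∈ T <;> by_cases hq : q ∈ T <;> simp [hp, hq, h, h.symm]
  rw [fermiSign_insert hp, fermiSign_insert hq, orderSign_swap h, Finset.insert_comm]
  ring

lemma annihilate_mul_self (q : Mode d r) : annihilate q * annihilate q = 0 := by
  ext f T
  change annihilate q (annihilate q f) T = 0
  simp [annihilate_apply]

lemma annihilate_mul_create {p q : Mode d r} (h : p ≠ q) :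
    annihilate p * create q = -(create q * annihilate p) := by
  ext f T
  change annihilate p (create q f) T = -(create q (annihilate p f) T)
  simp only [annihilate_apply, create_apply, Finset.mem_insert, Finset.mem_erase]
  by_cases hp : p ∈ T <;> by_cases hq : q ∈ T <;> simp [hp, hq, h, h.symm]
  -- In the only surviving case `q ∈ T` and `p ∉ T`. The two orders of the operators then differ by
  -- exactly one comparison between `p` and `q`.
  have hT : T = insert q (T.erase q) := (Finset.insert_erase hq).symm
  have e1 : fermiSign T p = (if Encodable.encode q < Encodable.encode p then -1 else 1)
      * fermiSign (T.erase q) p := by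
    conv_lhs => rw [hT]
    exact fermiSign_insert (by simp) p
  have e2 : (insert p T).erase q = insert p (T.erase q) :=
    Finset.erase_insert_of_ne h
  rw [e1, fermiSign_insert hp, orderSign_swap h, e2]
  split_ifs <;> ring

lemma annihilate_create_add (q : Mode d r) :
    annihilate q * create q + create q * annihilate q = 1 := by
  ext f T
  change annihilate q (create q f) T + create q (annihilate q f) T = f T
  simp only [annihilate_apply, create_apply]
  by_cases hq : q ∈ T
  · simp [hq, ← mul_assoc, fermiSign_erase_self, fermiSign_mul_self]
  · simp [hq, ← mul_assoc, fermiSign_insert_self, fermiSign_mul_self]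

lemma create_mul_create {p q : Mode d r} (h : p ≠ q) :
    create p * create q = -(create q * create p) := by
  have := congrArg star (annihilate_mul_annihilate h.symm)
  simpa [create] using this

lemma create_mul_self (q : Mode d r) : create q * create q = 0 := by
  have := congrArg star (annihilate_mul_self q)
  simpa [create] using this

lemma create_mul_annihilate {p q : Mode d r} (h : p ≠ q) :
    create p * annihilate q = -(annihilate q * create p) := by
  rw [annihilate_mul_create h.symm, neg_neg]

end CAR

/-! ### Parity and locality -/

section Parity

variable {d r : ℕ}

lemma isSelfAdjoint_siteNumber (x : Site d) : IsSelfAdjoint (siteNumber (r := r) x) := by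
  unfold siteNumber IsSelfAdjoint
  rw [star_sum]
  simp [create]

lemma isSelfAdjoint_numberOp (X : Finset (Site d)) : IsSelfAdjoint (numberOp (r := r) X) := by
  unfold numberOp IsSelfAdjoint
  rw [star_sum]
  exact Finset.sum_congr rfl fun x _ => isSelfAdjoint_siteNumber x

lemma modeNumber_annihilate_ne {p q : Mode d r} (h : p ≠ q) :
    create p * annihilate p * annihilate q = annihilate q * (create p * annihilate p) := by
  rw [mul_assoc, annihilate_mul_annihilate h, mul_neg, ← mul_assoc, create_mul_annihilate h,
    neg_mul, neg_neg, mul_assoc]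

lemma modeNumber_annihilate_self (q : Mode d r) :
    create q * annihilate q * annihilate q = annihilate q * (create q * annihilate q) - annihilate q := by
  have h : annihilate q * (create q * annihilate q) = annihilate q := by
    rw [← mul_assoc, eq_sub_of_add_eq (annihilate_create_add q), sub_mul, mul_assoc,
      annihilate_mul_self]
    simp
  rw [mul_assoc, annihilate_mul_self, h]
  simp

lemma siteNumber_annihilate (x : Site d) (q : Mode d r) :
    siteNumber x * annihilate q
      = annihilate q * siteNumber x - (if q.1 = x then annihilate q else 0) := by
  unfold siteNumber
  rw [Finset.sum_mul, Finset.mul_sum]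
  by_cases h : q.1 = x
  · subst h
    rw [if_pos rfl, ← Finset.add_sum_erase _ _ (Finset.mem_univ q.2),
      ← Finset.add_sum_erase _ _ (Finset.mem_univ q.2), Prod.mk.eta, modeNumber_annihilate_self]
    rw [Finset.sum_congr rfl fun i hi => modeNumber_annihilate_ne
      (p := (q.1, i)) (q := q) (fun e => (Finset.mem_erase.1 hi).1 (by rw [← e]))]
    abel
  · rw [if_neg h, sub_zero]
    exact Finset.sum_congr rfl fun i _ => modeNumber_annihilate_ne fun e => h (by rw [← e])

lemma numberOp_annihilate (X : Finset (Site d)) (q : Mode d r) :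
    numberOp X * annihilate q
      = annihilate q * numberOp X - (if q.1 ∈ X then annihilate q else 0) := by
  unfold numberOp
  rw [Finset.sum_mul, Finset.mul_sum]
  simp_rw [siteNumber_annihilate]
  rw [Finset.sum_sub_distrib]
  simp

lemma numberOp_create (X : Finset (Site d)) (q : Mode d r) :
    numberOp X * create q = create q * numberOp X + (if q.1 ∈ X then create q else 0) := by
  have h := congrArg star (numberOp_annihilate X q)
  rw [star_sub, star_mul, star_mul, (isSelfAdjoint_numberOp X).star_eq] at h
  change create q * _ = _ * create q - _ at h
  rw [h]
  split_ifs <;> simp [create]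

/-- The parity `exp(iπN_X)`. -/
noncomputable def parity (X : Finset (Site d)) : Op d r :=
  NormedSpace.exp ((Complex.I * Real.pi : ℂ) • numberOp X)

noncomputable def parityInv (X : Finset (Site d)) : Op d r :=
  NormedSpace.exp (-((Complex.I * Real.pi : ℂ) • numberOp X))

/-- Required by the addition formula for the exponential. -/
noncomputable instance : NormedAlgebra ℚ (Op d r) := NormedAlgebra.restrictScalars ℚ ℂ _

lemma parity_mul_parityInv (X : Finset (Site d)) : parity (r := r) X * parityInv X = 1 := by
  unfold parity parityInv
  rw [← NormedSpace.exp_add_of_commute (Commute.refl _).neg_right, add_neg_cancel,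
    NormedSpace.exp_zero]

lemma parityInv_mul_parity (X : Finset (Site d)) : parityInv (r := r) X * parity X = 1 := by
  unfold parity parityInv
  rw [← NormedSpace.exp_add_of_commute (Commute.refl
    ((Complex.I * Real.pi : ℂ) • numberOp (r := r) X)).neg_left, neg_add_cancel,
    NormedSpace.exp_zero]

lemma exp_smul_one (c : ℂ) : NormedSpace.exp (c • (1 : Op d r)) = Complex.exp c • 1 := by
  rw [Complex.exp_eq_exp_ℂ, ← Algebra.algebraMap_eq_smul_one, ← Algebra.algebraMap_eq_smul_one,
    NormedSpace.algebraMap_exp_comm]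

/-- An operator that changes the particle number by `c` intertwines `N + c` with `N`, hence also
their exponentials; for odd `c` the resulting phase `exp(iπc)` is `-1`. -/
lemma parity_mul_of_shift (X : Finset (Site d)) (b : Op d r) (c : ℤ) (hc : Odd c)
    (h : numberOp X * b = b * numberOp X + (c : ℂ) • b) :
    parity X * b = -(b * parity X) := by
  have h1 : SemiconjBy b ((Complex.I * Real.pi : ℂ) • (numberOp X + (c : ℂ) • (1 : Op d r)))
      ((Complex.I * Real.pi : ℂ) • numberOp X) := by
    unfold SemiconjBy
    rw [mul_smul_comm, smul_mul_assoc, h, mul_add, mul_smul_comm, mul_one]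
  have h2 := h1.exp_right
  unfold SemiconjBy at h2
  rw [parity, ← h2, smul_add, NormedSpace.exp_add_of_commute, smul_smul, exp_smul_one]
  · have : Complex.exp (Complex.I * Real.pi * c) = -1 := by
      obtain ⟨m, rfl⟩ := hc
      have : Complex.I * Real.pi * ((2 * m + 1 : ℤ) : ℂ)
          = Real.pi * Complex.I + m * (2 * Real.pi * Complex.I) := by push_cast; ring
      rw [this, Complex.exp_periodic.int_mul m, Complex.exp_pi_mul_I]
    rw [this]
    simp
  · exact (((Commute.one_right _).smul_right _).smul_right _).smul_left _

lemma parity_annihilate {X : Finset (Site d)} {q : Mode d r} (h : q.1 ∈ X) :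
    parity X * annihilate q = -(annihilate q * parity X) :=
  parity_mul_of_shift X _ (-1) (by decide) (by
    rw [numberOp_annihilate, if_pos h]; simp [sub_eq_add_neg])

lemma parity_create {X : Finset (Site d)} {q : Mode d r} (h : q.1 ∈ X) :
    parity X * create q = -(create q * parity X) :=
  parity_mul_of_shift X _ 1 (by decide) (by rw [numberOp_create, if_pos h]; simp)

lemma annihilate_mem_localAlgebra {X : Finset (Site d)} {q : Mode d r} (h : q.1 ∈ X) :
    annihilate q ∈ localAlgebra (r := r) X :=
  StarAlgebra.subset_adjoin ℂ _ ⟨q, h, rfl⟩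

lemma create_mem_localAlgebra {X : Finset (Site d)} {q : Mode d r} (h : q.1 ∈ X) :
    create q ∈ localAlgebra (r := r) X :=
  star_mem (annihilate_mem_localAlgebra h)

-- Closure under adjoints is absorbed into the generators: the star algebra is the plain algebra
-- generated by annihilation and creation operators, so no case for adjoints is needed.
@[elab_as_elim]
lemma mem_localAlgebra_induction {X : Finset (Site d)}
    {p : (A : Op d r) → A ∈ localAlgebra (r := r) X → Prop}
    (ann : ∀ (q : Mode d r) (h : q.1 ∈ X), p (annihilate q) (annihilate_mem_localAlgebra h))
    (cre : ∀ (q : Mode d r) (h : q.1 ∈ X), p (create q) (create_mem_localAlgebra h))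
    (scalar : ∀ c : ℂ, p (algebraMap ℂ _ c) (algebraMap_mem _ c))
    (add : ∀ A B hA hB, p A hA → p B hB → p (A + B) (add_mem hA hB))
    (mul : ∀ A B hA hB, p A hA → p B hB → p (A * B) (mul_mem hA hB))
    {A : Op d r} (hA : A ∈ localAlgebra (r := r) X) : p A hA := by
  have hA' := hA
  rw [localAlgebra, ← StarSubalgebra.mem_toSubalgebra, StarAlgebra.adjoin_toSubalgebra] at hA'
  have key : ∃ h : A ∈ localAlgebra (r := r) X, p A h := by
    induction hA' using Algebra.adjoin_induction with
    | mem x hx =>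
      rcases hx with ⟨q, hq, rfl⟩ | ⟨q, hq, h⟩
      · exact ⟨_, ann q hq⟩
      · have e : x = create q := by rw [← star_star x, h]; rfl
        subst e
        exact ⟨_, cre q hq⟩
    | algebraMap c => exact ⟨_, scalar c⟩
    | add x y hx' hy' hx hy =>
      obtain ⟨m1, hx⟩ := hx (by rwa [localAlgebra, ← StarSubalgebra.mem_toSubalgebra, StarAlgebra.adjoin_toSubalgebra])
      obtain ⟨m2, hy⟩ := hy (by rwa [localAlgebra, ← StarSubalgebra.mem_toSubalgebra, StarAlgebra.adjoin_toSubalgebra])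
      exact ⟨_, add x y m1 m2 hx hy⟩
    | mul x y hx' hy' hx hy =>
      obtain ⟨m1, hx⟩ := hx (by rwa [localAlgebra, ← StarSubalgebra.mem_toSubalgebra, StarAlgebra.adjoin_toSubalgebra])
      obtain ⟨m2, hy⟩ := hy (by rwa [localAlgebra, ← StarSubalgebra.mem_toSubalgebra, StarAlgebra.adjoin_toSubalgebra])
      exact ⟨_, mul x y m1 m2 hx hy⟩
  exact key.2

/-- Moving an odd element of the complement past an element of the local algebra conjugates the
latter with the parity. -/
lemma mul_eq_parity_conj {X : Finset (Site d)} {b : Op d r}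
    (h1 : ∀ q : Mode d r, q.1 ∈ X → b * annihilate q = -(annihilate q * b))
    (h2 : ∀ q : Mode d r, q.1 ∈ X → b * create q = -(create q * b))
    {A : Op d r} (hA : A ∈ localAlgebra (r := r) X) :
    b * A = parity X * A * parityInv X * b := by
  induction hA using mem_localAlgebra_induction with
  | ann q hq =>
    rw [parity_annihilate hq, neg_mul, mul_assoc (annihilate q), parity_mul_parityInv, mul_one,
      h1 q hq, neg_mul]
  | cre q hq =>
    rw [parity_create hq, neg_mul, mul_assoc (create q), parity_mul_parityInv, mul_one,
      h2 q hq, neg_mul]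
  | scalar c =>
    rw [(Algebra.commutes c (parity X)).symm, mul_assoc _ (parity X), parity_mul_parityInv, mul_one,
      Algebra.commutes]
  | add A B _ _ hA hB => simp only [mul_add, add_mul, hA, hB]
  | mul A B _ _ hA hB =>
    calc b * (A * B) = parity X * A * parityInv X * (b * B) := by rw [← mul_assoc, hA, mul_assoc]
      _ = parity X * A * (parityInv X * parity X) * B * parityInv X * b := by
        rw [hB]; simp only [mul_assoc]
      _ = parity X * (A * B) * parityInv X * b := by
        rw [parityInv_mul_parity, mul_one]; simp only [mul_assoc]

/-- An element commuting with the number operator is fixed under conjugation with the parity, so the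
conjugation in `mul_eq_parity_conj` disappears. -/
lemma commute_of_odd {X : Finset (Site d)} {b : Op d r}
    (h1 : ∀ q : Mode d r, q.1 ∈ X → b * annihilate q = -(annihilate q * b))
    (h2 : ∀ q : Mode d r, q.1 ∈ X → b * create q = -(create q * b))
    {A : Op d r} (hA : A ∈ localAlgebra (r := r) X) (hN : Commute A (numberOp X)) :
    Commute b A := by
  have h := mul_eq_parity_conj h1 h2 hA
  have hc : Commute (parity X) A := (hN.smul_right _).exp_right.symm
  rw [hc.eq, mul_assoc A, parity_mul_parityInv, mul_one] at h
  exact h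

/-- Gauge invariance is needed on one side only: such an element commutes with every single
generator over `Y`, hence with the algebra they generate. -/
lemma commute_of_disjoint {X Y : Finset (Site d)} (hXY : Disjoint X Y) {A B : Op d r}
    (hA : A ∈ localAlgebra (r := r) X) (hN : Commute A (numberOp X))
    (hB : B ∈ localAlgebra (r := r) Y) : Commute A B := by
  have ne : ∀ p q : Mode d r, p.1 ∈ X → q.1 ∈ Y → q ≠ p := fun p q hp hq e =>
    (Finset.disjoint_left.1 hXY hp) (e ▸ hq)
  induction hB using mem_localAlgebra_induction with
  | ann q hq =>
    exact (commute_of_odd (fun p hp => annihilate_mul_annihilate (ne p q hp hq))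
      (fun p hp => annihilate_mul_create (ne p q hp hq)) hA hN).symm
  | cre q hq =>
    exact (commute_of_odd (fun p hp => create_mul_annihilate (ne p q hp hq))
      (fun p hp => create_mul_create (ne p q hp hq)) hA hN).symm
  | scalar c => exact (Algebra.commutes c A).symm
  | add A B _ _ hA hB => exact hA.add_right hB
  | mul A B _ _ hA hB => exact hA.mul_right hB

lemma localAlgebra_mono {X Y : Finset (Site d)} (h : X ⊆ Y) :
    localAlgebra (r := r) X ≤ localAlgebra Y :=
  StarAlgebra.adjoin_mono fun _ ⟨q, hq, e⟩ => ⟨q, h hq, e⟩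

lemma siteNumber_mem (x : Site d) : siteNumber (r := r) x ∈ localAlgebra (r := r) {x} :=
  sum_mem fun i _ => mul_mem (create_mem_localAlgebra (by simp))
    (annihilate_mem_localAlgebra (by simp))

lemma numberOp_mem (X : Finset (Site d)) : numberOp (r := r) X ∈ localAlgebra (r := r) X :=
  sum_mem fun x hx => localAlgebra_mono (by simpa using hx) (siteNumber_mem x)

lemma commute_numberOp_mono {X Y : Finset (Site d)} (h : X ⊆ Y) {A : Op d r}
    (hA : A ∈ localAlgebra (r := r) X) (hN : Commute A (numberOp X)) :
    Commute A (numberOp Y) := by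
  have e : numberOp (r := r) Y = numberOp X + numberOp (Y \ X) := by
    unfold numberOp
    rw [add_comm, Finset.sum_sdiff h]
  rw [e]
  exact hN.add_right (commute_of_disjoint Finset.disjoint_sdiff hA hN (numberOp_mem _))

/-! ### The local algebras are finite-dimensional -/

/-- The span of `1, a, a^*, a^* a` for one mode. -/
noncomputable def modeSpan (q : Mode d r) : Submodule ℂ (Op d r) :=
  Submodule.span ℂ {1, annihilate q, create q, create q * annihilate q}

/-- The spanning elements of two distinct modes commute up to sign, and spans do not see signs. -/
lemma modeSpan_mul_comm {p q : Mode d r} (h : p ≠ q) :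
    modeSpan p * modeSpan q ≤ modeSpan q * modeSpan p := by
  have key : ∀ x ∈ ({1, annihilate p, create p, create p * annihilate p} : Set (Op d r)),
      ∀ y ∈ ({1, annihilate q, create q, create q * annihilate q} : Set (Op d r)),
      x * y = y * x ∨ x * y = -(y * x) := by
    have aa := annihilate_mul_annihilate h
    have ac := annihilate_mul_create h
    have ca := create_mul_annihilate h
    have cc := create_mul_create h
    have comb : ∀ x u v : Op d r, (x * u = u * x ∨ x * u = -(u * x)) →
        (x * v = v * x ∨ x * v = -(v * x)) →
        (x * (u * v) = u * v * x ∨ x * (u * v) = -(u * v * x)) := by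
      intro x u v h1 h2
      rw [← mul_assoc]
      rcases h1 with h1 | h1 <;> rcases h2 with h2 | h2 <;> rw [h1]
      · left; rw [mul_assoc, h2, mul_assoc]
      · right; rw [mul_assoc, h2, mul_neg, mul_assoc]
      · right; rw [neg_mul, mul_assoc, h2, mul_assoc]
      · left; rw [neg_mul, mul_assoc, h2, mul_neg, neg_neg, mul_assoc]
    have comb' : ∀ x u v : Op d r, (u * x = x * u ∨ u * x = -(x * u)) →
        (v * x = x * v ∨ v * x = -(x * v)) →
        (u * v * x = x * (u * v) ∨ u * v * x = -(x * (u * v))) := by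
      intro x u v h1 h2
      rw [mul_assoc]
      rcases h1 with h1 | h1 <;> rcases h2 with h2 | h2 <;> rw [h2]
      · left; rw [← mul_assoc, h1, mul_assoc]
      · right; rw [mul_neg, ← mul_assoc, h1, mul_assoc]
      · right; rw [← mul_assoc, h1, neg_mul, mul_assoc]
      · left; rw [mul_neg, ← mul_assoc, h1, neg_mul, neg_neg, mul_assoc]
    have ha : ∀ y ∈ ({1, annihilate q, create q, create q * annihilate q} : Set (Op d r)),
        annihilate p * y = y * annihilate p ∨ annihilate p * y = -(y * annihilate p) := by
      rintro y (rfl | rfl | rfl | rfl)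
      · left; simp
      · exact Or.inr aa
      · exact Or.inr ac
      · exact comb _ _ _ (Or.inr ac) (Or.inr aa)
    have hc : ∀ y ∈ ({1, annihilate q, create q, create q * annihilate q} : Set (Op d r)),
        create p * y = y * create p ∨ create p * y = -(y * create p) := by
      rintro y (rfl | rfl | rfl | rfl)
      · left; simp
      · exact Or.inr ca
      · exact Or.inr cc
      · exact comb _ _ _ (Or.inr cc) (Or.inr ca)
    rintro x (rfl | rfl | rfl | rfl) y hy
    · left; simp
    · exact ha y hy
    · exact hc y hy
    · exact comb' y _ _ (hc y hy) (ha y hy)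
  unfold modeSpan
  rw [Submodule.span_mul_span, Submodule.span_le]
  rintro _ ⟨x, hx, y, hy, rfl⟩
  have hm : y * x ∈ Submodule.span ℂ {1, annihilate q, create q, create q * annihilate q}
      * Submodule.span ℂ {1, annihilate p, create p, create p * annihilate p} :=
    Submodule.mul_mem_mul (Submodule.subset_span hy) (Submodule.subset_span hx)
  rcases key x hx y hy with e | e
  · change x * y ∈ _
    rw [e]; exact hm
  · change x * y ∈ _
    rw [e]; exact neg_mem hm

lemma modeSpan_mul_self (q : Mode d r) : modeSpan q * modeSpan q ≤ modeSpan q := by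
  have e1 := annihilate_mul_self q
  have e2 := create_mul_self q
  have e3 : annihilate q * create q = 1 - create q * annihilate q :=
    eq_sub_of_add_eq (annihilate_create_add q)
  have e4 : annihilate q * (create q * annihilate q) = annihilate q := by
    rw [← mul_assoc, e3, sub_mul, mul_assoc, e1]; simp
  have e5 : create q * annihilate q * create q = create q := by
    rw [mul_assoc, e3, mul_sub, ← mul_assoc, e2]; simp
  have m1 : (1 : Op d r) ∈ modeSpan q := Submodule.subset_span (by simp)
  have m2 : annihilate q ∈ modeSpan q := Submodule.subset_span (by simp)
  have m3 : create q ∈ modeSpan q := Submodule.subset_span (by simp)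
  have m4 : create q * annihilate q ∈ modeSpan q := Submodule.subset_span (by simp)
  conv_lhs => rw [modeSpan]
  rw [Submodule.span_mul_span, Submodule.span_le]
  rintro _ ⟨x, hx, y, hy, rfl⟩
  change x * y ∈ modeSpan q
  rcases hx with (rfl | rfl | rfl | rfl) <;> rcases hy with (rfl | rfl | rfl | rfl)
  · simpa using m1
  · simpa using m2
  · simpa using m3
  · simpa using m4
  · simpa using m2
  · rw [e1]; exact zero_mem _
  · rw [e3]; exact sub_mem m1 m4
  · rw [e4]; exact m2
  · simpa using m3
  · exact m4
  · rw [e2]; exact zero_mem _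
  · rw [← mul_assoc, e2, zero_mul]; exact zero_mem _
  · simpa using m4
  · rw [mul_assoc, e1, mul_zero]; exact zero_mem _
  · rw [e5]; exact m3
  · rw [← mul_assoc, e5]; exact m4

/-- The factor of `q` is moved past the earlier modes until it meets its own span, where it is
absorbed. Thus the ordered product is stable under left multiplication by the generators. -/
lemma modeSpan_mul_prod_le (q : Mode d r) (l : List (Mode d r)) (h : q ∈ l) :
    modeSpan q * (l.map modeSpan).prod ≤ (l.map modeSpan).prod := by
  induction l with
  | nil => simp at h
  | cons p l ih =>
    have assoc : ∀ U : Submodule ℂ (Op d r), ∀ V W, U * (V * W) = U * V * W :=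
      fun U V W => (mul_assoc U V W).symm
    change modeSpan q * (modeSpan p * (l.map modeSpan).prod) ≤ modeSpan p * (l.map modeSpan).prod
    by_cases e : q = p
    · subst e
      exact (assoc _ _ _).le.trans (Submodule.mul_le.2 fun _ ha _ hb => Submodule.mul_mem_mul (modeSpan_mul_self q ha) hb)
    · have h' : q ∈ l := by
        rcases List.mem_cons.1 h with h | h
        · exact absurd h e
        · exact h
      calc modeSpan q * (modeSpan p * (l.map modeSpan).prod)
          = modeSpan q * modeSpan p * (l.map modeSpan).prod := assoc _ _ _
        _ ≤ modeSpan p * modeSpan q * (l.map modeSpan).prod :=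
            Submodule.mul_le.2 fun _ ha _ hb => Submodule.mul_mem_mul (modeSpan_mul_comm e ha) hb
        _ = modeSpan p * (modeSpan q * (l.map modeSpan).prod) := (assoc _ _ _).symm
        _ ≤ _ := Submodule.mul_le.2 fun _ ha _ hb => Submodule.mul_mem_mul ha (ih h' hb)

lemma fg_modeSpan_prod (l : List (Mode d r)) : (l.map modeSpan).prod.FG := by
  induction l with
  | nil =>
    rw [List.map_nil, List.prod_nil, Submodule.one_eq_span]
    exact Submodule.fg_span_singleton _
  | cons p l ih =>
    rw [List.map_cons, List.prod_cons]
    refine Submodule.FG.mul ?_ ih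
    exact Submodule.fg_span (by simp)

lemma one_mem_modeSpan_prod (l : List (Mode d r)) : (1 : Op d r) ∈ (l.map modeSpan).prod := by
  induction l with
  | nil => rw [List.map_nil, List.prod_nil]; exact Submodule.one_le.1 le_rfl
  | cons p l ih =>
    rw [List.map_cons, List.prod_cons, ← one_mul (1 : Op d r)]
    exact Submodule.mul_mem_mul (Submodule.subset_span (by simp)) ih

/-- The span of the monomials ordered by mode contains `1` and is stable under left multiplication
by the algebra, so it contains the algebra. -/
lemma finiteDimensional_localAlgebra (X : Finset (Site d)) :
    FiniteDimensional ℂ (Subalgebra.toSubmodule (localAlgebra (r := r) X).toSubalgebra) := by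
  set l : List (Mode d r) := (X ×ˢ (Finset.univ : Finset (Fin r))).toList
  set V := (l.map modeSpan).prod
  have hV : ∀ A ∈ localAlgebra (r := r) X, ∀ v ∈ V, A * v ∈ V := by
    intro A hA
    induction hA using mem_localAlgebra_induction with
    | ann q hq =>
      exact fun v hv => modeSpan_mul_prod_le q l (by simp [l, hq])
        (Submodule.mul_mem_mul (Submodule.subset_span (by simp)) hv)
    | cre q hq =>
      exact fun v hv => modeSpan_mul_prod_le q l (by simp [l, hq])
        (Submodule.mul_mem_mul (Submodule.subset_span (by simp)) hv)
    | scalar c =>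
      intro v hv
      rw [Algebra.algebraMap_eq_smul_one, smul_mul_assoc, one_mul]
      exact V.smul_mem c hv
    | add A B _ _ hA hB => exact fun v hv => by rw [add_mul]; exact add_mem (hA v hv) (hB v hv)
    | mul A B _ _ hA hB => exact fun v hv => by rw [mul_assoc]; exact hA _ (hB v hv)
  have hle : Subalgebra.toSubmodule (localAlgebra (r := r) X).toSubalgebra ≤ V := by
    intro A hA
    simpa using hV A hA 1 (one_mem_modeSpan_prod l)
  have : FiniteDimensional ℂ V := Module.Finite.iff_fg.2 (fg_modeSpan_prod l)
  exact Submodule.finiteDimensional_of_le hle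

/-! ### The gauge-invariant local algebras -/

/-- The elements of the local algebra of `X` that commute with the number operator of `X`. -/
noncomputable def gaugeInvariant (X : Finset (Site d)) : StarSubalgebra ℂ (Op d r) :=
  localAlgebra X ⊓ StarSubalgebra.centralizer ℂ {numberOp X}

lemma mem_gaugeInvariant {X : Finset (Site d)} {A : Op d r} :
    A ∈ gaugeInvariant (r := r) X ↔ A ∈ localAlgebra (r := r) X ∧ Commute A (numberOp X) := by
  rw [gaugeInvariant, StarSubalgebra.mem_inf, StarSubalgebra.mem_centralizer_iff]
  refine and_congr_right fun _ => ?_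
  simp only [Set.mem_singleton_iff, forall_eq, (isSelfAdjoint_numberOp X).star_eq, and_self]
  exact ⟨fun h => h.symm, fun h => h.symm⟩

lemma isLocalTerm_iff {X : Finset (Site d)} {A : Op d r} :
    IsLocalTerm X A ↔ A ∈ gaugeInvariant (r := r) X ∧ IsSelfAdjoint A := by
  rw [IsLocalTerm, mem_gaugeInvariant, and_assoc]

lemma gaugeInvariant_mono {X Y : Finset (Site d)} (h : X ⊆ Y) {A : Op d r}
    (hA : A ∈ gaugeInvariant (r := r) X) : A ∈ gaugeInvariant (r := r) Y := by
  rw [mem_gaugeInvariant] at hA ⊢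
  exact ⟨localAlgebra_mono h hA.1, commute_numberOp_mono h hA.1 hA.2⟩

lemma commute_of_mem_gaugeInvariant {X Y : Finset (Site d)} (h : Disjoint X Y) {A B : Op d r}
    (hA : A ∈ gaugeInvariant (r := r) X) (hB : B ∈ gaugeInvariant (r := r) Y) : Commute A B := by
  rw [mem_gaugeInvariant] at hA hB
  exact commute_of_disjoint h hA.1 hA.2 hB.1

/-- Closedness keeps exponentials and integrals of local elements inside the same local algebra. -/
lemma isClosed_gaugeInvariant (X : Finset (Site d)) :
    IsClosed (gaugeInvariant (r := r) X : Set (Op d r)) := by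
  have h1 : FiniteDimensional ℂ (Subalgebra.toSubmodule (gaugeInvariant (r := r) X).toSubalgebra) := by
    have := finiteDimensional_localAlgebra (r := r) X
    exact Submodule.finiteDimensional_of_le
      (S₂ := Subalgebra.toSubmodule (localAlgebra (r := r) X).toSubalgebra)
      fun A hA => (mem_gaugeInvariant.1 hA).1
  exact Submodule.closed_of_finiteDimensional
    (Subalgebra.toSubmodule (gaugeInvariant (r := r) X).toSubalgebra)

lemma exists_scalar_of_mem_gaugeInvariant_empty {A : Op d r}
    (hA : A ∈ gaugeInvariant (r := r) ∅) : ∃ c : ℂ, A = algebraMap ℂ _ c := by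
  have h := (mem_gaugeInvariant.1 hA).1
  clear hA
  induction h using mem_localAlgebra_induction with
  | ann q hq => simp at hq
  | cre q hq => simp at hq
  | scalar c => exact ⟨c, rfl⟩
  | add A B _ _ hA hB =>
    obtain ⟨a, rfl⟩ := hA
    obtain ⟨b, rfl⟩ := hB
    exact ⟨a + b, (map_add _ _ _).symm⟩
  | mul A B _ _ hA hB =>
    obtain ⟨a, rfl⟩ := hA
    obtain ⟨b, rfl⟩ := hB
    exact ⟨a * b, (map_mul _ _ _).symm⟩

end Parity

/-! ### Dynamics in a C*-algebra -/

section Dynamics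

variable {𝔸 : Type*} [CStarAlgebra 𝔸]

/-- The unitary group `e^{isH}`. -/
noncomputable def propagator (H : 𝔸) (s : ℝ) : 𝔸 := NormedSpace.exp ((Complex.I * s) • H)

/-- The evolution `e^{isH} A e^{-isH}`. -/
noncomputable def evolve (H : 𝔸) (s : ℝ) (A : 𝔸) : 𝔸 := propagator H s * A * propagator H (-s)

lemma exp_add_of_commute' {x y : 𝔸} (h : Commute x y) :
    NormedSpace.exp (x + y) = NormedSpace.exp x * NormedSpace.exp y := by
  let _ : NormedAlgebra ℚ 𝔸 := NormedAlgebra.restrictScalars ℚ ℂ 𝔸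
  exact NormedSpace.exp_add_of_commute h

lemma continuous_exp' : Continuous (NormedSpace.exp : 𝔸 → 𝔸) := by
  let _ : NormedAlgebra ℚ 𝔸 := NormedAlgebra.restrictScalars ℚ ℂ 𝔸
  exact NormedSpace.exp_continuous

@[simp] lemma propagator_zero (H : 𝔸) : propagator H 0 = 1 := by simp [propagator]

lemma propagator_add (H : 𝔸) (s t : ℝ) :
    propagator H (s + t) = propagator H s * propagator H t := by
  unfold propagator
  rw [← exp_add_of_commute' (((Commute.refl H).smul_left _).smul_right _), ← add_smul]
  push_cast
  rw [mul_add]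

lemma propagator_mul_neg (H : 𝔸) (s : ℝ) : propagator H s * propagator H (-s) = 1 := by
  rw [← propagator_add, add_neg_cancel, propagator_zero]

lemma propagator_neg_mul (H : 𝔸) (s : ℝ) : propagator H (-s) * propagator H s = 1 := by
  rw [← propagator_add, neg_add_cancel, propagator_zero]

lemma star_propagator {H : 𝔸} (hH : IsSelfAdjoint H) (s : ℝ) :
    star (propagator H s) = propagator H (-s) := by
  unfold propagator
  rw [NormedSpace.star_exp, star_smul, hH.star_eq]
  simp

lemma propagator_mem_unitary {H : 𝔸} (hH : IsSelfAdjoint H) (s : ℝ) :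
    propagator H s ∈ unitary 𝔸 := by
  rw [Unitary.mem_iff, star_propagator hH, propagator_neg_mul, propagator_mul_neg]
  exact ⟨rfl, rfl⟩

lemma norm_propagator_le {H : 𝔸} (hH : IsSelfAdjoint H) (s : ℝ) : ‖propagator H s‖ ≤ 1 := by
  rcases subsingleton_or_nontrivial 𝔸 with h | h
  · rw [Subsingleton.elim (propagator H s) 0]; simp
  · exact (CStarRing.norm_of_mem_unitary (propagator_mem_unitary hH s)).le

lemma commute_propagator_self (H : 𝔸) (s : ℝ) : Commute H (propagator H s) :=
  ((Commute.refl H).smul_right _).exp_right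

lemma commute_propagator {A H : 𝔸} (h : Commute A H) (s : ℝ) : Commute A (propagator H s) :=
  (h.smul_right _).exp_right

lemma hasDerivAt_propagator (H : 𝔸) (s : ℝ) :
    HasDerivAt (propagator H) (propagator H s * (Complex.I • H)) s := by
  have h := hasDerivAt_exp_smul_const (𝕂 := ℝ) (Complex.I • H) s
  have e : propagator H = fun u : ℝ => NormedSpace.exp (u • (Complex.I • H)) := by
    funext u
    rw [propagator, mul_comm, mul_smul, Complex.coe_smul]
  rw [e]
  exact h

lemma hasDerivAt_propagator' (H : 𝔸) (s : ℝ) :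
    HasDerivAt (propagator H) ((Complex.I • H) * propagator H s) s := by
  rw [((commute_propagator_self H s).smul_left _).eq]
  exact hasDerivAt_propagator H s

lemma hasDerivAt_propagator_neg (H : 𝔸) (s : ℝ) :
    HasDerivAt (fun u => propagator H (-u)) (-((Complex.I • H) * propagator H (-s))) s := by
  have h := (hasDerivAt_propagator' H (-s)).scomp s (hasDerivAt_neg s)
  rw [neg_one_smul] at h
  exact h

lemma continuous_propagator (H : 𝔸) : Continuous (propagator H) :=
  continuous_iff_continuousAt.2 fun s => (hasDerivAt_propagator H s).continuousAt

@[simp] lemma evolve_zero (H A : 𝔸) : evolve H 0 A = A := by simp [evolve]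

lemma continuous_evolve (H A : 𝔸) : Continuous (fun s => evolve H s A) :=
  ((continuous_propagator H).mul continuous_const).mul
    ((continuous_propagator H).comp continuous_neg)

lemma norm_evolve {H : 𝔸} (hH : IsSelfAdjoint H) (s : ℝ) (A : 𝔸) : ‖evolve H s A‖ = ‖A‖ := by
  rw [evolve, CStarRing.norm_mul_mem_unitary _ (propagator_mem_unitary hH _),
    CStarRing.norm_mem_unitary_mul _ (propagator_mem_unitary hH _)]

lemma evolve_sub (H : 𝔸) (s : ℝ) (A B : 𝔸) : evolve H s (A - B) = evolve H s A - evolve H s B := by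
  simp [evolve, mul_sub, sub_mul]

lemma evolve_sum {ι : Type*} (P : Finset ι) (H : 𝔸) (s : ℝ) (A : ι → 𝔸) :
    evolve H s (∑ i ∈ P, A i) = ∑ i ∈ P, evolve H s (A i) := by
  simp [evolve, Finset.mul_sum, Finset.sum_mul]

lemma evolve_mul (H : 𝔸) (s : ℝ) (A B : 𝔸) : evolve H s (A * B) = evolve H s A * evolve H s B := by
  unfold evolve
  calc propagator H s * (A * B) * propagator H (-s)
      = propagator H s * A * 1 * B * propagator H (-s) := by simp only [mul_assoc, one_mul]
    _ = _ := by rw [← propagator_neg_mul H s]; simp only [mul_assoc]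

lemma evolve_neg_evolve (H : 𝔸) (s : ℝ) (A : 𝔸) : evolve H (-s) (evolve H s A) = A := by
  unfold evolve
  rw [neg_neg]
  calc propagator H (-s) * (propagator H s * A * propagator H (-s)) * propagator H s
      = (propagator H (-s) * propagator H s) * A * (propagator H (-s) * propagator H s) := by
        simp only [mul_assoc]
    _ = A := by rw [propagator_neg_mul, one_mul, mul_one]

lemma isSelfAdjoint_evolve {H A : 𝔸} (hH : IsSelfAdjoint H) (hA : IsSelfAdjoint A) (s : ℝ) :
    IsSelfAdjoint (evolve H s A) := by
  unfold evolve IsSelfAdjoint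
  rw [star_mul, star_mul, star_propagator hH, star_propagator hH, neg_neg, hA.star_eq, mul_assoc]

lemma hasDerivAt_evolve (H A : 𝔸) (s : ℝ) :
    HasDerivAt (fun u => evolve H u A) (evolve H s (Complex.I • (H * A - A * H))) s := by
  have h := ((hasDerivAt_propagator H s).mul_const A).mul (hasDerivAt_propagator_neg H s)
  convert! h using 1
  unfold evolve
  simp only [smul_sub, mul_sub, sub_mul, mul_neg, smul_mul_assoc, mul_smul_comm, mul_assoc]
  rw [sub_eq_add_neg]

lemma norm_sub_le_integral_of_hasDerivAt {E : Type*} [NormedAddCommGroup E] [NormedSpace ℝ E]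
    [CompleteSpace E] {G G' : ℝ → E} (hG : ∀ s, HasDerivAt G (G' s) s) (hc : Continuous G')
    {s : ℝ} (hs : 0 ≤ s) : ‖G s - G 0‖ ≤ ∫ u in (0 : ℝ)..s, ‖G' u‖ := by
  rw [← intervalIntegral.integral_eq_sub_of_hasDerivAt (fun x _ => hG x)
    (hc.intervalIntegrable _ _)]
  exact intervalIntegral.norm_integral_le_integral_norm hs

/-- Duhamel's formula: evolve forwards with `K'` and backwards with `K`. The derivative in time
contains only the commutator with `K' - K`, and the unitary conjugation drops out of the norm. -/
lemma evolve_sub_evolve_le_integral {K K' : 𝔸} (hK : IsSelfAdjoint K) (O : 𝔸) {s : ℝ}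
    (hs : 0 ≤ s) :
    ‖evolve K s O - evolve K' s O‖
      ≤ ∫ u in (0 : ℝ)..s, ‖(K' - K) * evolve K' u O - evolve K' u O * (K' - K)‖ := by
  set G : ℝ → 𝔸 := fun u => evolve K (-u) (evolve K' u O)
  have hd : ∀ u, HasDerivAt G (evolve K (-u)
      (Complex.I • ((K' - K) * evolve K' u O - evolve K' u O * (K' - K)))) u := by
    intro u
    have h1 := hasDerivAt_evolve K' O u
    have h2 : HasDerivAt (fun u => propagator K (-u) * evolve K' u O * propagator K u) _ u :=
      ((hasDerivAt_propagator_neg K u).mul h1).mul (hasDerivAt_propagator' K u)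
    have e : G = fun u => propagator K (-u) * evolve K' u O * propagator K u := by
      funext u; simp [G, evolve]
    rw [e]
    convert! h2 using 1
    -- A Hamiltonian commutes with its own propagator, so it can be pulled out of the evolution it
    -- generates.
    have e2 : evolve K' u (Complex.I • (K' * O - O * K'))
        = Complex.I • (K' * evolve K' u O - evolve K' u O * K') := by
      have c1 := (commute_propagator_self K' u).eq
      have c2 := (commute_propagator_self K' (-u)).eq
      unfold evolve
      rw [mul_smul_comm, smul_mul_assoc]
      congr 1
      rw [mul_sub, sub_mul]
      congr 1
      · rw [← mul_assoc, ← c1]; simp only [mul_assoc]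
      · simp only [mul_assoc]; rw [c2]
    have c3 := ((commute_propagator_self K (-u)).smul_left Complex.I).eq
    rw [e2, c3]
    unfold evolve
    rw [neg_neg]
    simp only [Pi.mul_apply, smul_sub, mul_sub, sub_mul, smul_mul_assoc, mul_smul_comm,
      mul_assoc, add_mul, neg_mul]
    abel
  have hcont : Continuous fun u => evolve K (-u)
      (Complex.I • ((K' - K) * evolve K' u O - evolve K' u O * (K' - K))) := by
    have c := continuous_evolve K' O
    have c1 := continuous_propagator K
    unfold evolve
    unfold evolve at c
    fun_prop
  have h := norm_sub_le_integral_of_hasDerivAt hd hcont hs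
  have e : ‖G s - G 0‖ = ‖evolve K s O - evolve K' s O‖ := by
    rw [← norm_evolve hK s (G s - G 0), evolve_sub]
    have : evolve K s (G s) = evolve K' s O := by
      have := evolve_neg_evolve K (-s) (evolve K' s O)
      rwa [neg_neg] at this
    rw [this, norm_sub_rev]
    simp [G]
  rw [← e]
  refine h.trans (le_of_eq ?_)
  congr 1
  funext u
  rw [norm_evolve hK, norm_smul, Complex.norm_I, one_mul]

lemma evolve_neg_ham (K : 𝔸) (s : ℝ) (O : 𝔸) : evolve (-K) s O = evolve K (-s) O := by
  simp [evolve, propagator]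

lemma norm_commutator_le (A B : 𝔸) : ‖A * B - B * A‖ ≤ 2 * ‖A‖ * ‖B‖ := by
  calc ‖A * B - B * A‖ ≤ ‖A * B‖ + ‖B * A‖ := norm_sub_le _ _
    _ ≤ ‖A‖ * ‖B‖ + ‖B‖ * ‖A‖ := add_le_add (norm_mul_le _ _) (norm_mul_le _ _)
    _ = _ := by ring

lemma evolve_sub_evolve_le {K K' : 𝔸} (hK : IsSelfAdjoint K) (hK' : IsSelfAdjoint K') (O : 𝔸)
    (s : ℝ) : ‖evolve K s O - evolve K' s O‖ ≤ 2 * |s| * ‖K - K'‖ * ‖O‖ := by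
  have key : ∀ L L' : 𝔸, IsSelfAdjoint L → IsSelfAdjoint L' → ∀ s : ℝ, 0 ≤ s →
      ‖evolve L s O - evolve L' s O‖ ≤ 2 * s * ‖L - L'‖ * ‖O‖ := by
    intro L L' hL hL' s hs
    refine (evolve_sub_evolve_le_integral hL O hs).trans ?_
    have : ∫ u in (0 : ℝ)..s, ‖(L' - L) * evolve L' u O - evolve L' u O * (L' - L)‖
        ≤ ∫ u in (0 : ℝ)..s, 2 * ‖L - L'‖ * ‖O‖ := by
      refine intervalIntegral.integral_mono_on hs ?_ (by simp) fun u _ => ?_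
      · have c := continuous_evolve L' O
        exact Continuous.intervalIntegrable (by fun_prop) _ _
      · refine (norm_commutator_le _ _).trans ?_
        rw [norm_evolve hL', norm_sub_rev]
    refine this.trans (le_of_eq ?_)
    simp
    ring
  rcases le_total 0 s with hs | hs
  · rw [abs_of_nonneg hs]; exact key K K' hK hK' s hs
  -- Negative times are positive times for the opposite Hamiltonian.
  · have := key (-K) (-K') hK.neg hK'.neg (-s) (by linarith)
    rw [evolve_neg_ham, evolve_neg_ham, neg_neg] at this
    rw [abs_of_nonpos hs]
    refine this.trans (le_of_eq ?_)
    rw [← neg_add', norm_neg, sub_eq_add_neg]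

end Dynamics

/-! ### A Lieb-Robinson bound -/

section LiebRobinson

variable {𝔸 : Type*} [CStarAlgebra 𝔸] {ι : Type*} [DecidableEq ι]

/-- Only the part `K₁` that need not commute with `h` can spread it. In the interaction picture of
`K₂ = K - K₁` the evolved `h` is `U h V` with `V` inverse to `U`, so the commutator with `B` is
unitarily equivalent to that of `h` with `V B U`. The derivative of `V B U` is, up to conjugation,
the commutator of the evolved `K₁` with `B`. -/
lemma commutator_evolve_le_integral {K K₁ : 𝔸} (hK : IsSelfAdjoint K) (hK₁ : IsSelfAdjoint K₁)
    {h : 𝔸} (hc : Commute h (K - K₁)) (B : 𝔸) {s : ℝ} (hs : 0 ≤ s) :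
    ‖evolve K s h * B - B * evolve K s h‖ ≤ ‖h * B - B * h‖
      + ∫ u in (0 : ℝ)..s, 2 * ‖h‖ * ‖evolve K u K₁ * B - B * evolve K u K₁‖ := by
  set K₂ := K - K₁ with hK₂
  have sK₂ : IsSelfAdjoint K₂ := hK.sub hK₁
  -- the cocycle `e^{isK} e^{-isK₂}` and its inverse
  set U : ℝ → 𝔸 := fun u => propagator K u * propagator K₂ (-u)
  set V : ℝ → 𝔸 := fun u => propagator K₂ u * propagator K (-u)
  have hUV : ∀ u, U u * V u = 1 := fun u => by
    calc U u * V u = propagator K u * (propagator K₂ (-u) * propagator K₂ u) * propagator K (-u) := by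
          simp only [U, V, mul_assoc]
      _ = 1 := by rw [propagator_neg_mul, mul_one, propagator_mul_neg]
  have hVU : ∀ u, V u * U u = 1 := fun u => by
    calc V u * U u = propagator K₂ u * (propagator K (-u) * propagator K u) * propagator K₂ (-u) := by
          simp only [U, V, mul_assoc]
      _ = 1 := by rw [propagator_neg_mul, mul_one, propagator_mul_neg]
  have hUu : ∀ u, U u ∈ unitary 𝔸 := fun u =>
    mul_mem (propagator_mem_unitary hK _) (propagator_mem_unitary sK₂ _)
  have hVu : ∀ u, V u ∈ unitary 𝔸 := fun u =>
    mul_mem (propagator_mem_unitary sK₂ _) (propagator_mem_unitary hK _)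
  have hev : ∀ u, evolve K u h = U u * h * V u := by
    intro u
    have c : propagator K₂ (-u) * h = h * propagator K₂ (-u) := (commute_propagator hc (-u)).eq.symm
    calc evolve K u h
        = propagator K u * h * (propagator K₂ (-u) * propagator K₂ u) * propagator K (-u) := by
          rw [propagator_neg_mul, mul_one]; rfl
      _ = propagator K u * (h * propagator K₂ (-u)) * propagator K₂ u * propagator K (-u) := by
          simp only [mul_assoc]
      _ = _ := by rw [← c]; simp only [U, V, mul_assoc]
  have dU : ∀ u, HasDerivAt U (Complex.I • (evolve K u K₁ * U u)) u := by
    intro u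
    have := (hasDerivAt_propagator K u).mul (hasDerivAt_propagator_neg K₂ u)
    convert! this using 1
    calc Complex.I • (evolve K u K₁ * U u)
        = Complex.I • (propagator K u * K₁ * (propagator K (-u) * propagator K u)
            * propagator K₂ (-u)) := by simp only [evolve, U, mul_assoc]
      _ = Complex.I • (propagator K u * K₁ * propagator K₂ (-u)) := by
          rw [propagator_neg_mul, mul_one]
      _ = _ := by
          have : K₁ = K - K₂ := by simp [K₂]
          rw [this]
          simp only [smul_sub, mul_sub, sub_mul, mul_neg, smul_mul_assoc, mul_smul_comm, mul_assoc]
          rw [sub_eq_add_neg]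
  have dV : ∀ u, HasDerivAt V (-(Complex.I • (V u * evolve K u K₁))) u := by
    intro u
    have := (hasDerivAt_propagator' K₂ u).mul (hasDerivAt_propagator_neg K u)
    convert! this using 1
    have c2 := (commute_propagator_self K₂ u).eq
    have c1 := (commute_propagator_self K (-u)).eq
    calc -(Complex.I • (V u * evolve K u K₁))
        = -(Complex.I • (propagator K₂ u * (propagator K (-u) * propagator K u) * K₁
            * propagator K (-u))) := by simp only [evolve, V, mul_assoc]
      _ = -(Complex.I • (propagator K₂ u * K₁ * propagator K (-u))) := by
          rw [propagator_neg_mul, mul_one]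
      _ = _ := by
          have : K₁ = K - K₂ := by simp [K₂]
          rw [this, smul_mul_assoc, c2]
          simp only [smul_sub, mul_sub, sub_mul, mul_neg, smul_mul_assoc, mul_smul_comm, mul_assoc]
          abel
  set R : ℝ → 𝔸 := fun u => evolve K u K₁ * B - B * evolve K u K₁
  have dG : ∀ u, HasDerivAt (fun u => h * (V u * B * U u) - (V u * B * U u) * h)
      (-(Complex.I • (h * (V u * R u * U u) - (V u * R u * U u) * h))) u := by
    intro u
    have d1 := ((dV u).mul_const B).mul (dU u)
    have d2 := (d1.const_mul h).sub (d1.mul_const h)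
    convert! d2 using 1
    simp only [R, smul_sub, mul_sub, sub_mul, mul_neg, smul_mul_assoc, mul_smul_comm, mul_assoc,
      neg_mul, mul_add, add_mul]
    abel
  have cU : Continuous U := continuous_iff_continuousAt.2 fun u => (dU u).continuousAt
  have cV : Continuous V := continuous_iff_continuousAt.2 fun u => (dV u).continuousAt
  have cR : Continuous R := by
    have := continuous_evolve K K₁
    exact (this.mul continuous_const).sub (continuous_const.mul this)
  have cE := continuous_evolve K K₁
  have hint := norm_sub_le_integral_of_hasDerivAt dG (by fun_prop) hs
  have e1 : ∀ u, ‖h * (V u * B * U u) - (V u * B * U u) * h‖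
      = ‖evolve K u h * B - B * evolve K u h‖ := by
    intro u
    rw [hev, ← CStarRing.norm_mem_unitary_mul (U := U u) _ (hUu u),
      ← CStarRing.norm_mul_mem_unitary (U := V u) _ (hVu u)]
    congr 1
    calc U u * (h * (V u * B * U u) - V u * B * U u * h) * V u
        = U u * h * V u * B * (U u * V u) - (U u * V u) * B * U u * h * V u := by
          simp only [mul_sub, sub_mul, mul_assoc]
      _ = _ := by rw [hUV]; simp only [mul_one, one_mul, mul_assoc]
  have e2 : ∀ u, ‖-(Complex.I • (h * (V u * R u * U u) - (V u * R u * U u) * h))‖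
      ≤ 2 * ‖h‖ * ‖R u‖ := by
    intro u
    rw [norm_neg, norm_smul, Complex.norm_I, one_mul]
    refine (norm_commutator_le _ _).trans (le_of_eq ?_)
    rw [CStarRing.norm_mul_mem_unitary _ (hUu u), CStarRing.norm_mem_unitary_mul _ (hVu u)]
  have h0 : ‖h * (V 0 * B * U 0) - (V 0 * B * U 0) * h‖ = ‖h * B - B * h‖ := by
    rw [e1]; simp
  rw [← e1 s, ← h0]
  have h3 : ‖h * (V s * B * U s) - (V s * B * U s) * h‖
      ≤ ‖h * (V 0 * B * U 0) - (V 0 * B * U 0) * h‖ + _ :=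
    (norm_le_norm_add_norm_sub' _ _).trans (add_le_add le_rfl hint)
  refine h3.trans (add_le_add le_rfl ?_)
  refine intervalIntegral.integral_mono_on hs ?_ ?_ fun u _ => e2 u
  · exact Continuous.intervalIntegrable (by fun_prop) _ _
  · exact Continuous.intervalIntegrable (by fun_prop) _ _

/-- The right-hand side `g` of the integral inequality satisfies `g' = c f ≤ c g`, so `g(s)
exp(-cs)` is non-increasing on `[0, ∞)` and starts at `A`. -/
lemma gronwall_integral {f : ℝ → ℝ} (hf : Continuous f) {A c : ℝ} (hc : 0 ≤ c)
    (h : ∀ s, 0 ≤ s → f s ≤ A + c * ∫ u in (0 : ℝ)..s, f u) {s : ℝ} (hs : 0 ≤ s) :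
    f s ≤ A * Real.exp (c * s) := by
  set g : ℝ → ℝ := fun s => A + c * ∫ u in (0 : ℝ)..s, f u
  have dg : ∀ s, HasDerivAt g (c * f s) s := fun s =>
    ((intervalIntegral.integral_hasDerivAt_right (hf.intervalIntegrable _ _)
      (hf.stronglyMeasurableAtFilter _ _) hf.continuousAt).const_mul c).const_add A
  have dk : ∀ s, HasDerivAt (fun s => g s * Real.exp (-(c * s)))
      (c * f s * Real.exp (-(c * s)) + g s * (Real.exp (-(c * s)) * (-(c * 1)))) s := fun s =>
    (dg s).mul (((hasDerivAt_id s).const_mul c).neg.exp)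
  have hanti : AntitoneOn (fun s => g s * Real.exp (-(c * s))) (Set.Ici 0) := by
    refine antitoneOn_of_deriv_nonpos (convex_Ici 0)
      (fun x _ => (dk x).continuousAt.continuousWithinAt)
      (fun x _ => (dk x).differentiableAt.differentiableWithinAt) fun x hx => ?_
    rw [interior_Ici] at hx
    rw [(dk x).deriv]
    have := mul_le_mul_of_nonneg_left (h x hx.le) hc
    have h2 := mul_le_mul_of_nonneg_right this (Real.exp_pos (-(c * x))).le
    change c * f x * _ ≤ c * g x * _ at h2
    linarith
  have h1 : g s * Real.exp (-(c * s)) ≤ A := by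
    have := hanti (Set.mem_Ici.2 le_rfl) (Set.mem_Ici.2 hs) hs
    simpa [g] using this
  calc f s ≤ g s := h s hs
    _ = g s * Real.exp (-(c * s)) * Real.exp (c * s) := by
      rw [mul_assoc, ← Real.exp_add]; simp
    _ ≤ _ := mul_le_mul_of_nonneg_right h1 (Real.exp_pos _).le

/-- A weighted Lieb-Robinson bound for the terms `h Y`, `Y ∈ P`, evolved with the terms in `P'`. -/
theorem lieb_robinson {P P' : Finset (Finset ι)} (hPP : P' ⊆ P) {h : Finset ι → 𝔸}
    (hsa : ∀ Y ∈ P, IsSelfAdjoint (h Y))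
    (hcomm : ∀ Y ∈ P, ∀ Y' ∈ P, Disjoint Y Y' → Commute (h Y) (h Y'))
    {X : Finset ι} {O : 𝔸} (hO : ∀ Y ∈ P, Disjoint Y X → Commute (h Y) O)
    {wt : ι → ℝ} (hwt : ∀ x, 0 ≤ wt x) {κ : ℝ} (hκ0 : 0 ≤ κ)
    (hκ : ∀ z, ∑ Y ∈ P with z ∈ Y, ‖h Y‖ * ∑ x ∈ Y, wt x ≤ κ * wt z) {s : ℝ} (hs : 0 ≤ s) :
    ∑ Y ∈ P, (∑ x ∈ Y, wt x) *
        ‖evolve (∑ Y ∈ P', h Y) s (h Y) * O - O * evolve (∑ Y ∈ P', h Y) s (h Y)‖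
      ≤ 2 * κ * ‖O‖ * (∑ x ∈ X, wt x) * Real.exp (2 * κ * s) := by
  set K := ∑ Y ∈ P', h Y
  have hK : IsSelfAdjoint K := isSelfAdjoint_sum _ fun Y hY => hsa Y (hPP hY)
  set Wt : Finset ι → ℝ := fun Y => ∑ x ∈ Y, wt x
  have hW : ∀ Y, 0 ≤ Wt Y := fun Y => Finset.sum_nonneg fun x _ => hwt x
  set γ : Finset ι → ℝ → ℝ := fun Y s => ‖evolve K s (h Y) * O - O * evolve K s (h Y)‖
  have hγ0 : ∀ Y s, 0 ≤ γ Y s := fun Y s => norm_nonneg _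
  have cγ : ∀ Y, Continuous (γ Y) := fun Y => by
    have := continuous_evolve K (h Y)
    exact ((this.mul continuous_const).sub (continuous_const.mul this)).norm
  -- sums over sets meeting a given set
  have meet : ∀ Y', ∑ Y ∈ P with ¬ Disjoint Y Y', ‖h Y‖ * Wt Y ≤ κ * Wt Y' := by
    intro Y'
    calc ∑ Y ∈ P with ¬ Disjoint Y Y', ‖h Y‖ * Wt Y
        ≤ ∑ Y ∈ P, ∑ z ∈ Y' with z ∈ Y, ‖h Y‖ * Wt Y := by
          rw [Finset.sum_filter]
          refine Finset.sum_le_sum fun Y _ => ?_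
          have nn : 0 ≤ ‖h Y‖ * Wt Y := mul_nonneg (norm_nonneg _) (hW Y)
          by_cases hd : Disjoint Y Y'
          · rw [if_neg (not_not.2 hd)]
            exact Finset.sum_nonneg fun _ _ => nn
          · rw [if_pos hd]
            obtain ⟨z, hz, hz'⟩ := Finset.not_disjoint_iff.1 hd
            exact Finset.single_le_sum (f := fun _ => ‖h Y‖ * Wt Y) (fun _ _ => nn)
              (Finset.mem_filter.2 ⟨hz', hz⟩)
      _ = ∑ z ∈ Y', ∑ Y ∈ P with z ∈ Y, ‖h Y‖ * Wt Y := by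
          simp_rw [Finset.sum_filter]
          exact Finset.sum_comm
      _ ≤ ∑ z ∈ Y', κ * wt z := Finset.sum_le_sum fun z _ => hκ z
      _ = κ * Wt Y' := by rw [Finset.mul_sum]
  -- Terms disjoint from `Y` commute with `h Y`, so only the neighbours of `Y` feed its commutator.
  have step : ∀ Y ∈ P, ∀ s, 0 ≤ s → γ Y s ≤ ‖h Y * O - O * h Y‖
      + 2 * ‖h Y‖ * ∑ Y' ∈ P with ¬ Disjoint Y Y', ∫ u in (0 : ℝ)..s, γ Y' u := by
    intro Y hY s hs
    set K₁ := ∑ Y' ∈ P' with ¬ Disjoint Y Y', h Y'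
    have hK₁ : IsSelfAdjoint K₁ := isSelfAdjoint_sum _ fun Y hY =>
      hsa Y (hPP (Finset.mem_filter.1 hY).1)
    have hc : Commute (h Y) (K - K₁) := by
      have : K - K₁ = ∑ Y' ∈ P' with Disjoint Y Y', h Y' := by
        rw [sub_eq_iff_eq_add]
        exact (Finset.sum_filter_add_sum_filter_not _ _ _).symm
      rw [this]
      refine Commute.sum_right _ _ _ fun Y' hY' => ?_
      rw [Finset.mem_filter] at hY'
      exact hcomm Y hY Y' (hPP hY'.1) hY'.2
    refine (commutator_evolve_le_integral hK hK₁ hc O hs).trans (add_le_add le_rfl ?_)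
    rw [← intervalIntegral.integral_finsetSum fun Y' _ => (cγ Y').intervalIntegrable _ _,
      ← intervalIntegral.integral_const_mul]
    refine intervalIntegral.integral_mono_on hs ?_ ?_ fun u _ => ?_
    · have := continuous_evolve K K₁
      exact Continuous.intervalIntegrable (by fun_prop) _ _
    · exact Continuous.intervalIntegrable (by fun_prop) _ _
    · refine mul_le_mul_of_nonneg_left ?_ (by positivity)
      rw [evolve_sum, Finset.sum_mul, Finset.mul_sum, ← Finset.sum_sub_distrib]
      refine (norm_sum_le _ _).trans ?_
      -- Enlarging the neighbours from `P'` to `P` closes the system of inequalities in the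
      -- functions `γ Y`, `Y ∈ P`.
      exact Finset.sum_le_sum_of_subset_of_nonneg (Finset.filter_subset_filter _ hPP)
        fun Y' _ _ => hγ0 Y' u
  -- The weighted sum turns the system into one scalar inequality: by `meet`, the coupling to the
  -- neighbours multiplies the weights by at most `κ`.
  set Γ : ℝ → ℝ := fun s => ∑ Y ∈ P, Wt Y * γ Y s
  have cΓ : Continuous Γ := by fun_prop
  have h0 : ∑ Y ∈ P, Wt Y * ‖h Y * O - O * h Y‖ ≤ 2 * κ * ‖O‖ * Wt X := by
    calc ∑ Y ∈ P, Wt Y * ‖h Y * O - O * h Y‖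
        ≤ ∑ Y ∈ P with ¬ Disjoint Y X, 2 * ‖O‖ * (‖h Y‖ * Wt Y) := by
          rw [Finset.sum_filter]
          refine Finset.sum_le_sum fun Y hY => ?_
          by_cases hd : Disjoint Y X
          · rw [if_neg (not_not.2 hd), (hO Y hY hd).eq, sub_self, norm_zero, mul_zero]
          · rw [if_pos hd]
            calc Wt Y * ‖h Y * O - O * h Y‖ ≤ Wt Y * (2 * ‖h Y‖ * ‖O‖) :=
                mul_le_mul_of_nonneg_left (norm_commutator_le _ _) (hW Y)
              _ = _ := by ring
      _ = 2 * ‖O‖ * ∑ Y ∈ P with ¬ Disjoint Y X, ‖h Y‖ * Wt Y := by rw [Finset.mul_sum]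
      _ ≤ 2 * ‖O‖ * (κ * Wt X) := mul_le_mul_of_nonneg_left (meet X) (by positivity)
      _ = _ := by ring
  refine gronwall_integral cΓ (by positivity) (fun s hs => ?_) hs
  have hI : ∀ Y', 0 ≤ ∫ u in (0 : ℝ)..s, γ Y' u := fun Y' =>
    intervalIntegral.integral_nonneg hs fun u _ => hγ0 Y' u
  calc Γ s ≤ ∑ Y ∈ P, Wt Y * (‖h Y * O - O * h Y‖
      + 2 * ‖h Y‖ * ∑ Y' ∈ P with ¬ Disjoint Y Y', ∫ u in (0 : ℝ)..s, γ Y' u) :=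
        Finset.sum_le_sum fun Y hY => mul_le_mul_of_nonneg_left (step Y hY s hs) (hW Y)
    _ = ∑ Y ∈ P, Wt Y * ‖h Y * O - O * h Y‖
        + ∑ Y' ∈ P, 2 * (∫ u in (0 : ℝ)..s, γ Y' u) *
          ∑ Y ∈ P with ¬ Disjoint Y Y', ‖h Y‖ * Wt Y := by
        simp_rw [mul_add, Finset.sum_add_distrib, Finset.sum_filter, Finset.mul_sum]
        congr 1
        rw [Finset.sum_comm]
        refine Finset.sum_congr rfl fun Y' _ => Finset.sum_congr rfl fun Y _ => ?_
        split_ifs <;> ring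
    _ ≤ 2 * κ * ‖O‖ * Wt X + ∑ Y' ∈ P, 2 * (∫ u in (0 : ℝ)..s, γ Y' u) * (κ * Wt Y') := by
        refine add_le_add h0 (Finset.sum_le_sum fun Y' _ => ?_)
        exact mul_le_mul_of_nonneg_left (meet Y') (by have := hI Y'; positivity)
    _ = _ := by
        congr 1
        simp only [Γ]
        rw [intervalIntegral.integral_finsetSum fun Y' _ =>
          ((cγ Y').const_mul _).intervalIntegrable _ _, Finset.mul_sum]
        refine Finset.sum_congr rfl fun Y' _ => ?_
        rw [intervalIntegral.integral_const_mul]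
        ring

/-- Comparison of two local dynamics far away from the support of the observable. -/
theorem evolve_sub_evolve_le_of_weight {P P' : Finset (Finset ι)} (hPP : P' ⊆ P)
    {h : Finset ι → 𝔸} (hsa : ∀ Y ∈ P, IsSelfAdjoint (h Y))
    (hcomm : ∀ Y ∈ P, ∀ Y' ∈ P, Disjoint Y Y' → Commute (h Y) (h Y'))
    {X : Finset ι} {O : 𝔸} (hO : ∀ Y ∈ P, Disjoint Y X → Commute (h Y) O)
    {wt : ι → ℝ} (hwt : ∀ x, 0 ≤ wt x) {κ : ℝ} (hκ0 : 0 ≤ κ)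
    (hκ : ∀ z, ∑ Y ∈ P with z ∈ Y, ‖h Y‖ * ∑ x ∈ Y, wt x ≤ κ * wt z)
    {b : ℝ} (hb : ∀ Y ∈ P, Y ∉ P' → b ≤ ∑ x ∈ Y, wt x) (hb0 : 0 < b) (s : ℝ) :
    ‖evolve (∑ Y ∈ P, h Y) s O - evolve (∑ Y ∈ P', h Y) s O‖
      ≤ |s| * (2 * κ * ‖O‖ * (∑ x ∈ X, wt x) * Real.exp (2 * κ * |s|)) / b := by
  -- Stated for every family of terms, so that it can also be applied to `-h`, which covers negative
  -- times.
  have key : ∀ h : Finset ι → 𝔸, (∀ Y ∈ P, IsSelfAdjoint (h Y)) →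
      (∀ Y ∈ P, ∀ Y' ∈ P, Disjoint Y Y' → Commute (h Y) (h Y')) →
      (∀ Y ∈ P, Disjoint Y X → Commute (h Y) O) →
      (∀ z, ∑ Y ∈ P with z ∈ Y, ‖h Y‖ * ∑ x ∈ Y, wt x ≤ κ * wt z) → ∀ s, 0 ≤ s →
      ‖evolve (∑ Y ∈ P, h Y) s O - evolve (∑ Y ∈ P', h Y) s O‖
      ≤ s * (2 * κ * ‖O‖ * (∑ x ∈ X, wt x) * Real.exp (2 * κ * s)) / b := by
    clear hsa hcomm hO hκ s h
    intro h hsa hcomm hO hκ s hs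
    set K' := ∑ Y ∈ P', h Y
    have hK : IsSelfAdjoint (∑ Y ∈ P, h Y) := isSelfAdjoint_sum _ fun Y hY => hsa Y hY
    have hK' : IsSelfAdjoint K' := isSelfAdjoint_sum _ fun Y hY => hsa Y (hPP hY)
    have hWX : 0 ≤ ∑ x ∈ X, wt x := Finset.sum_nonneg fun x _ => hwt x
    -- the bound for the commutators with the additional terms
    have hneg : ∀ u, 0 ≤ u → ∑ Y ∈ P \ P', ‖h Y * evolve K' u O - evolve K' u O * h Y‖
        ≤ 2 * κ * ‖O‖ * (∑ x ∈ X, wt x) * Real.exp (2 * κ * s) / b * 1 ∨ s < u := by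
      intro u hu
      by_cases hus : s < u
      · exact Or.inr hus
      left
      rw [not_lt] at hus
      -- The commutator of `h Y` with the evolved `O` has the norm of the commutator of `O` with `h
      -- Y` evolved backwards. Backward evolution is forward evolution for the terms `-h`, to which
      -- the bound is applied.
      have hlr := lieb_robinson hPP (h := fun Y => -h Y) (X := X) (O := O) (wt := wt) (κ := κ)
        (fun Y hY => (hsa Y hY).neg)
        (fun Y hY Y' hY' hd => ((hcomm Y hY Y' hY' hd).neg_left).neg_right)
        (fun Y hY hd => (hO Y hY hd).neg_left) hwt hκ0 (by simpa using hκ) hu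
      have e : ∀ Y, ‖evolve (∑ Y ∈ P', -h Y) u (-h Y) * O - O * evolve (∑ Y ∈ P', -h Y) u (-h Y)‖
          = ‖h Y * evolve K' u O - evolve K' u O * h Y‖ := by
        intro Y
        rw [Finset.sum_neg_distrib, evolve_neg_ham,
          ← norm_evolve hK' u (evolve K' (-u) (-h Y) * O - O * evolve K' (-u) (-h Y)), evolve_sub,
          evolve_mul, evolve_mul]
        have : evolve K' u (evolve K' (-u) (-h Y)) = -h Y := by
          have := evolve_neg_evolve K' (-u) (-h Y)
          rwa [neg_neg] at this
        rw [this, neg_mul, mul_neg, ← norm_neg]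
        congr 1
        abel
      simp_rw [e] at hlr
      rw [mul_one, le_div_iff₀ hb0, Finset.sum_mul]
      calc ∑ Y ∈ P \ P', ‖h Y * evolve K' u O - evolve K' u O * h Y‖ * b
          ≤ ∑ Y ∈ P \ P', (∑ x ∈ Y, wt x) * ‖h Y * evolve K' u O - evolve K' u O * h Y‖ := by
            refine Finset.sum_le_sum fun Y hY => ?_
            rw [Finset.mem_sdiff] at hY
            rw [mul_comm]
            exact mul_le_mul_of_nonneg_right (hb Y hY.1 hY.2) (norm_nonneg _)
        _ ≤ ∑ Y ∈ P, (∑ x ∈ Y, wt x) * ‖h Y * evolve K' u O - evolve K' u O * h Y‖ :=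
            Finset.sum_le_sum_of_subset_of_nonneg Finset.sdiff_subset fun Y _ _ =>
              mul_nonneg (Finset.sum_nonneg fun x _ => hwt x) (norm_nonneg _)
        _ ≤ _ := hlr
        _ ≤ _ := by gcongr
    refine (evolve_sub_evolve_le_integral hK O hs).trans ?_
    have hle : ∫ u in (0 : ℝ)..s, ‖(K' - ∑ Y ∈ P, h Y) * evolve K' u O
          - evolve K' u O * (K' - ∑ Y ∈ P, h Y)‖
        ≤ ∫ u in (0 : ℝ)..s, 2 * κ * ‖O‖ * (∑ x ∈ X, wt x) * Real.exp (2 * κ * s) / b := by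
      refine intervalIntegral.integral_mono_on hs ?_ (by simp) fun u hu => ?_
      · have c := continuous_evolve K' O
        exact Continuous.intervalIntegrable (by fun_prop) _ _
      · have e : K' - ∑ Y ∈ P, h Y = -∑ Y ∈ P \ P', h Y := by
          rw [← Finset.sum_sdiff hPP]; simp [K']
        rw [e, neg_mul, mul_neg, Finset.sum_mul, Finset.mul_sum, neg_sub_neg,
          ← Finset.sum_sub_distrib]
        refine (norm_sum_le _ _).trans ?_
        simp_rw [norm_sub_rev (evolve K' u O * h _)]
        rcases hneg u hu.1 with h1 | h1
        · rwa [mul_one] at h1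
        · exact absurd h1 (not_lt.2 hu.2)
    refine hle.trans (le_of_eq ?_)
    rw [intervalIntegral.integral_const]
    simp
    ring
  rcases le_total 0 s with hs | hs
  · rw [abs_of_nonneg hs]
    exact key h hsa hcomm hO hκ s hs
  · have := key (fun Y => -h Y) (fun Y hY => (hsa Y hY).neg)
      (fun Y hY Y' hY' hd => ((hcomm Y hY Y' hY' hd).neg_left).neg_right)
      (fun Y hY hd => (hO Y hY hd).neg_left) (by simpa using hκ) (-s) (by linarith)
    rw [Finset.sum_neg_distrib, Finset.sum_neg_distrib, evolve_neg_ham, evolve_neg_ham,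
      neg_neg] at this
    rwa [abs_of_nonpos hs]

end LiebRobinson

/-! ### Families with polynomially bounded time derivatives -/

section Integral

/-- Dominated convergence of difference quotients within `I`. The mean value inequality on the
convex set `I` supplies the majorant, so endpoints of the interval need no separate treatment. -/
lemma hasDerivWithinAt_integral {Ω E : Type*} [MeasurableSpace Ω] {μ : Measure Ω}
    [NormedAddCommGroup E] [NormedSpace ℝ E] {I : Set ℝ} (hI : Convex ℝ I)
    {F F' : ℝ → Ω → E} (hF : ∀ t ∈ I, Integrable (F t) μ)
    (hd : ∀ x, ∀ t ∈ I, HasDerivWithinAt (fun t => F t x) (F' t x) I t)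
    {b : Ω → ℝ} (hb : Integrable b μ) (hbd : ∀ᵐ x ∂μ, ∀ t ∈ I, ‖F' t x‖ ≤ b x)
    {t₀ : ℝ} (ht₀ : t₀ ∈ I) :
    HasDerivWithinAt (fun t => ∫ x, F t x ∂μ) (∫ x, F' t₀ x ∂μ) I t₀ := by
  rw [hasDerivWithinAt_iff_tendsto_slope]
  have hmem : ∀ᶠ t in 𝓝[I \ {t₀}] t₀, t ∈ I \ {t₀} := self_mem_nhdsWithin
  have hlim : Tendsto (fun t => ∫ x, slope (fun t => F t x) t₀ t ∂μ) (𝓝[I \ {t₀}] t₀)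
      (𝓝 (∫ x, F' t₀ x ∂μ)) := by
    refine tendsto_integral_filter_of_dominated_convergence b ?_ ?_ hb ?_
    · filter_upwards [hmem] with t ht
      simp only [slope_def_module]
      exact (((hF t ht.1).sub (hF t₀ ht₀)).smul _).aestronglyMeasurable
    · filter_upwards [hmem] with t ht
      filter_upwards [hbd] with x hx
      have h1 := hI.norm_image_sub_le_of_norm_hasDerivWithin_le (fun t ht => hd x t ht) hx ht₀ ht.1
      have h2 : 0 < ‖t - t₀‖ := norm_pos_iff.2 (sub_ne_zero.2 ht.2)
      rw [slope_def_module, norm_smul, norm_inv, inv_mul_le_iff₀ h2, mul_comm]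
      exact h1
    · refine Eventually.of_forall fun x => ?_
      exact hasDerivWithinAt_iff_tendsto_slope.1 (hd x t₀ ht₀)
  refine hlim.congr' ?_
  filter_upwards [hmem] with t ht
  simp only [slope_def_module]
  rw [integral_smul, integral_sub (hF t ht.1) (hF t₀ ht₀)]

end Integral

section SmoothFamily

variable {Q : Type*} {E : Type*} [NormedAddCommGroup E] [NormedSpace ℝ E]

/-- A family `F q s t` that is bounded by a power of `(1 + |s|) * w q`, uniformly in `t ∈ I`, and
continuous in `s`. -/
def PolyBounded (I : Set ℝ) (w : Q → ℝ) (F : Q → ℝ → ℝ → E) : Prop :=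
  (∃ C : ℝ, ∃ n : ℕ, 0 ≤ C ∧ ∀ q s, ∀ t ∈ I, ‖F q s t‖ ≤ C * ((1 + |s|) * w q) ^ n) ∧
    ∀ q, ∀ t ∈ I, Continuous fun s => F q s t

/-- A family that is `n` times differentiable in `t ∈ I` with polynomially bounded derivatives. -/
def SmoothFamily (I : Set ℝ) (w : Q → ℝ) : ℕ → (Q → ℝ → ℝ → E) → Prop
  | 0, F => PolyBounded I w F
  | n + 1, F => PolyBounded I w F ∧ ∃ F' : Q → ℝ → ℝ → E,
      (∀ q s, ∀ t ∈ I, HasDerivWithinAt (F q s) (F' q s t) I t) ∧ SmoothFamily I w n F'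

namespace SmoothFamily

variable {I : Set ℝ} {w : Q → ℝ} {n : ℕ} {F G : Q → ℝ → ℝ → E}

lemma polyBounded (h : SmoothFamily I w n F) : PolyBounded I w F := by
  cases n with
  | zero => exact h
  | succ n => exact h.1

lemma pred (h : SmoothFamily I w (n + 1) F) : SmoothFamily I w n F := by
  induction n generalizing F with
  | zero => exact h.1
  | succ n ih =>
    obtain ⟨h1, F', h2, h3⟩ := h
    exact ⟨h1, F', h2, ih h3⟩

lemma congr (h : SmoothFamily I w n F) (e : ∀ q s, ∀ t ∈ I, F q s t = G q s t) :
    SmoothFamily I w n G := by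
  have hp : PolyBounded I w F → PolyBounded I w G := by
    rintro ⟨⟨C, m, h0, h1⟩, h2⟩
    refine ⟨⟨C, m, h0, fun q s t ht => by rw [← e q s t ht]; exact h1 q s t ht⟩, fun q t ht => ?_⟩
    have : (fun s => G q s t) = fun s => F q s t := funext fun s => (e q s t ht).symm
    rw [this]
    exact h2 q t ht
  cases n with
  | zero => exact hp h
  | succ n =>
    obtain ⟨h1, F', h2, h3⟩ := h
    exact ⟨hp h1, F', fun q s t ht => (h2 q s t ht).congr (fun t ht => (e q s t ht).symm)
      (e q s t ht).symm, h3⟩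

lemma one_le_base (hw : ∀ q, 1 ≤ w q) (q : Q) (s : ℝ) : 1 ≤ (1 + |s|) * w q :=
  one_le_mul_of_one_le_of_one_le (by linarith [abs_nonneg s]) (hw q)

lemma add (hw : ∀ q, 1 ≤ w q) (hF : SmoothFamily I w n F) (hG : SmoothFamily I w n G) :
    SmoothFamily I w n (fun q s t => F q s t + G q s t) := by
  have hp : ∀ {F G : Q → ℝ → ℝ → E}, PolyBounded I w F → PolyBounded I w G →
      PolyBounded I w (fun q s t => F q s t + G q s t) := by
    rintro F G ⟨⟨C, m, h0, h1⟩, h2⟩ ⟨⟨C', m', h0', h1'⟩, h2'⟩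
    refine ⟨⟨C + C', m + m', by positivity, fun q s t ht => ?_⟩,
      fun q t ht => (h2 q t ht).add (h2' q t ht)⟩
    have hb := one_le_base hw q s
    calc ‖F q s t + G q s t‖ ≤ C * ((1 + |s|) * w q) ^ m + C' * ((1 + |s|) * w q) ^ m' :=
          (norm_add_le _ _).trans (add_le_add (h1 q s t ht) (h1' q s t ht))
      _ ≤ C * ((1 + |s|) * w q) ^ (m + m') + C' * ((1 + |s|) * w q) ^ (m + m') := by
          gcongr <;> first | exact hb | omega
      _ = _ := by ring
  induction n generalizing F G with
  | zero => exact hp hF hG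
  | succ n ih =>
    obtain ⟨h1, F', h2, h3⟩ := hF
    obtain ⟨g1, G', g2, g3⟩ := hG
    exact ⟨hp h1 g1, _, fun q s t ht => (h2 q s t ht).add (g2 q s t ht), ih h3 g3⟩

lemma zero : SmoothFamily I w n (fun _ _ _ => (0 : E)) := by
  have hp : PolyBounded I w (fun _ _ _ => (0 : E)) :=
    ⟨⟨0, 0, le_rfl, by simp⟩, fun _ _ _ => continuous_const⟩
  induction n with
  | zero => exact hp
  | succ n ih => exact ⟨hp, _, fun q s t _ => hasDerivWithinAt_const _ _ _, ih⟩

lemma const {A : E} : SmoothFamily I w n (fun _ _ _ => A) := by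
  have hp : PolyBounded I w (fun _ _ _ => A) :=
    ⟨⟨‖A‖, 0, norm_nonneg _, by simp⟩, fun _ _ _ => continuous_const⟩
  cases n with
  | zero => exact hp
  | succ n => exact ⟨hp, _, fun q s t _ => hasDerivWithinAt_const _ _ _, zero⟩

/-- Multiplication by a polynomially bounded function of `s`. -/
lemma smul_fun {𝕜 : Type*} [NormedField 𝕜] [NormedSpace 𝕜 E] [SMulCommClass ℝ 𝕜 E]
    (hw : ∀ q, 1 ≤ w q) {c : ℝ → 𝕜} (hc : Continuous c) {m : ℕ}
    (hcm : ∀ s, ‖c s‖ ≤ (1 + |s|) ^ m) (hF : SmoothFamily I w n F) :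
    SmoothFamily I w n (fun q s t => c s • F q s t) := by
  have hp : ∀ {F : Q → ℝ → ℝ → E}, PolyBounded I w F →
      PolyBounded I w (fun q s t => c s • F q s t) := by
    rintro F ⟨⟨C, k, h0, h1⟩, h2⟩
    refine ⟨⟨C, m + k, h0, fun q s t ht => ?_⟩, fun q t ht => hc.smul (h2 q t ht)⟩
    have hs : 0 ≤ |s| := abs_nonneg s
    have hwq := hw q
    have e : (1 + |s|) ^ m ≤ ((1 + |s|) * w q) ^ m :=
      pow_le_pow_left₀ (by positivity) (le_mul_of_one_le_right (by positivity) hwq) _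
    calc ‖c s • F q s t‖ = ‖c s‖ * ‖F q s t‖ := norm_smul _ _
      _ ≤ ((1 + |s|) * w q) ^ m * (C * ((1 + |s|) * w q) ^ k) :=
          mul_le_mul ((hcm s).trans e) (h1 q s t ht) (norm_nonneg _) (by positivity)
      _ = _ := by ring
  induction n generalizing F with
  | zero => exact hp hF
  | succ n ih =>
    obtain ⟨h1, F', h2, h3⟩ := hF
    exact ⟨hp h1, _, fun q s t ht => (h2 q s t ht).const_smul (c s), ih h3⟩

lemma neg (hF : SmoothFamily I w n F) : SmoothFamily I w n (fun q s t => -F q s t) := by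
  have hp : ∀ {F : Q → ℝ → ℝ → E}, PolyBounded I w F → PolyBounded I w (fun q s t => -F q s t) := by
    rintro F ⟨⟨C, k, h0, h1⟩, h2⟩
    exact ⟨⟨C, k, h0, fun q s t ht => by rw [norm_neg]; exact h1 q s t ht⟩,
      fun q t ht => (h2 q t ht).neg⟩
  induction n generalizing F with
  | zero => exact hp hF
  | succ n ih =>
    obtain ⟨h1, F', h2, h3⟩ := hF
    exact ⟨hp h1, _, fun q s t ht => (h2 q s t ht).fun_neg, ih h3⟩

lemma sub (hw : ∀ q, 1 ≤ w q) (hF : SmoothFamily I w n F) (hG : SmoothFamily I w n G) :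
    SmoothFamily I w n (fun q s t => F q s t - G q s t) := by
  simp_rw [sub_eq_add_neg]
  exact hF.add hw hG.neg

lemma comp_neg (hF : SmoothFamily I w n F) : SmoothFamily I w n (fun q s t => F q (-s) t) := by
  have hp : ∀ {F : Q → ℝ → ℝ → E}, PolyBounded I w F →
      PolyBounded I w (fun q s t => F q (-s) t) := by
    rintro F ⟨⟨C, k, h0, h1⟩, h2⟩
    exact ⟨⟨C, k, h0, fun q s t ht => by simpa using h1 q (-s) t ht⟩,
      fun q t ht => (h2 q t ht).comp continuous_neg⟩
  induction n generalizing F with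
  | zero => exact hp hF
  | succ n ih =>
    obtain ⟨h1, F', h2, h3⟩ := hF
    exact ⟨hp h1, _, fun q s t ht => h2 q (-s) t ht, ih h3⟩

/-- Freezing `s = 0`. -/
lemma freeze (hw : ∀ q, 1 ≤ w q) (hF : SmoothFamily I w n F) :
    SmoothFamily I w n (fun q _ t => F q 0 t) := by
  have hp : ∀ {F : Q → ℝ → ℝ → E}, PolyBounded I w F →
      PolyBounded I w (fun q _ t => F q 0 t) := by
    rintro F ⟨⟨C, k, h0, h1⟩, h2⟩
    refine ⟨⟨C, k, h0, fun q s t ht => (h1 q 0 t ht).trans ?_⟩, fun q t ht => continuous_const⟩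
    have hs : 0 ≤ |s| := abs_nonneg s
    have := hw q
    refine mul_le_mul_of_nonneg_left (pow_le_pow_left₀ (by positivity) ?_ _) h0
    refine mul_le_mul_of_nonneg_right ?_ (by positivity)
    rw [abs_zero]
    linarith
  induction n generalizing F with
  | zero => exact hp hF
  | succ n ih =>
    obtain ⟨h1, F', h2, h3⟩ := hF
    exact ⟨hp h1, _, fun q s t ht => h2 q 0 t ht, ih h3⟩

lemma integrable_kernel_smul {K : ℝ → ℝ} (hK : ∀ n : ℕ, Integrable fun s => K s * (1 + |s|) ^ n)
    (hF : PolyBounded I w F) (q : Q) {t : ℝ} (ht : t ∈ I) :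
    Integrable fun s => K s • F q s t := by
  obtain ⟨⟨C, k, h0, h1⟩, h2⟩ := hF
  have hK0 : AEStronglyMeasurable K := by
    have := (hK 0).aestronglyMeasurable
    simpa using this
  refine Integrable.mono' (((hK k).norm).const_mul (C * |w q| ^ k)) ?_ ?_
  · exact hK0.smul (h2 q t ht).aestronglyMeasurable
  · refine Eventually.of_forall fun s => ?_
    have hs : 0 ≤ |s| := abs_nonneg s
    rw [norm_smul, norm_mul, Real.norm_of_nonneg (by positivity : 0 ≤ (1 + |s|) ^ k)]
    calc ‖K s‖ * ‖F q s t‖ ≤ ‖K s‖ * (C * ((1 + |s|) * |w q|) ^ k) := by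
          refine mul_le_mul_of_nonneg_left ((h1 q s t ht).trans ?_) (norm_nonneg _)
          refine mul_le_mul_of_nonneg_left ?_ h0
          rw [mul_pow, mul_pow]
          refine mul_le_mul_of_nonneg_left ?_ (by positivity)
          rw [← abs_pow]
          exact le_abs_self _
      _ = _ := by rw [mul_pow]; ring

/-- Integration against a kernel with finite moments. -/
lemma kernel_integral [CompleteSpace E] (hI : Convex ℝ I) (hw : ∀ q, 1 ≤ w q) {K : ℝ → ℝ}
    (hK : ∀ n : ℕ, Integrable fun s => K s * (1 + |s|) ^ n)
    (hF : SmoothFamily I w n F) :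
    SmoothFamily I w n (fun q _ t => ∫ s, K s • F q s t) := by
  have hp : ∀ {F : Q → ℝ → ℝ → E}, PolyBounded I w F →
      PolyBounded I w (fun q _ t => ∫ s, K s • F q s t) := by
    intro F hF
    obtain ⟨⟨C, k, h0, h1⟩, h2⟩ := hF
    refine ⟨⟨C * ∫ s, ‖K s * (1 + |s|) ^ k‖, k, mul_nonneg h0 (by positivity),
      fun q s' t ht => ?_⟩, fun q t ht => continuous_const⟩
    have hwq : 0 ≤ w q := by linarith [hw q]
    calc ‖∫ s, K s • F q s t‖ ≤ ∫ s, ‖K s * (1 + |s|) ^ k‖ * (C * w q ^ k) := by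
          refine norm_integral_le_of_norm_le (((hK k).norm).mul_const _)
            (Eventually.of_forall fun s => ?_)
          have hs : 0 ≤ |s| := abs_nonneg s
          rw [norm_smul, norm_mul, Real.norm_of_nonneg (by positivity : 0 ≤ (1 + |s|) ^ k)]
          refine (mul_le_mul_of_nonneg_left (h1 q s t ht) (norm_nonneg _)).trans (le_of_eq ?_)
          rw [mul_pow]; ring
      _ = C * (∫ s, ‖K s * (1 + |s|) ^ k‖) * w q ^ k := by
          rw [integral_mul_const]; ring
      _ ≤ C * (∫ s, ‖K s * (1 + |s|) ^ k‖) * ((1 + |s'|) * w q) ^ k := by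
          have : 0 ≤ ∫ s, ‖K s * (1 + |s|) ^ k‖ := by positivity
          refine mul_le_mul_of_nonneg_left ?_ (by positivity)
          refine pow_le_pow_left₀ hwq ?_ _
          exact le_mul_of_one_le_left hwq (by linarith [abs_nonneg s'])
  induction n generalizing F with
  | zero => exact hp hF
  | succ n ih =>
    obtain ⟨h1, F', h2, h3⟩ := hF
    refine ⟨hp h1, _, fun q s' t ht => ?_, ih h3⟩
    obtain ⟨⟨C, k, h0, hb⟩, -⟩ := h3.polyBounded
    refine hasDerivWithinAt_integral hI
      (F := fun t s => K s • F q s t) (F' := fun t s => K s • F' q s t)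
      (b := fun s => ‖K s * (1 + |s|) ^ k‖ * (C * w q ^ k))
      (fun t ht => integrable_kernel_smul hK h1 q ht)
      (fun s t ht => (h2 q s t ht).const_smul (K s)) (((hK k).norm).mul_const _)
      (Eventually.of_forall fun s t ht => ?_) ht
    have hs : 0 ≤ |s| := abs_nonneg s
    rw [norm_smul, norm_mul, Real.norm_of_nonneg (by positivity : 0 ≤ (1 + |s|) ^ k)]
    refine (mul_le_mul_of_nonneg_left (hb q s t ht) (norm_nonneg _)).trans (le_of_eq ?_)
    rw [mul_pow]; ring

end SmoothFamily

end SmoothFamily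

/-! ### Products, convolutions and propagators of smooth families -/

section SmoothFamilyAlgebra

namespace SmoothFamily

variable {Q : Type*} {𝔸 : Type*} [CStarAlgebra 𝔸]
variable {I : Set ℝ} {w : Q → ℝ} {n : ℕ} {F G : Q → ℝ → ℝ → 𝔸}

lemma mul (hw : ∀ q, 1 ≤ w q) (hF : SmoothFamily I w n F) (hG : SmoothFamily I w n G) :
    SmoothFamily I w n (fun q s t => F q s t * G q s t) := by
  have hp : ∀ {F G : Q → ℝ → ℝ → 𝔸}, PolyBounded I w F → PolyBounded I w G →
      PolyBounded I w (fun q s t => F q s t * G q s t) := by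
    rintro F G ⟨⟨C, m, h0, h1⟩, h2⟩ ⟨⟨C', m', h0', h1'⟩, h2'⟩
    refine ⟨⟨C * C', m + m', by positivity, fun q s t ht => ?_⟩,
      fun q t ht => (h2 q t ht).mul (h2' q t ht)⟩
    have hb := one_le_base hw q s
    calc ‖F q s t * G q s t‖ ≤ (C * ((1 + |s|) * w q) ^ m) * (C' * ((1 + |s|) * w q) ^ m') :=
          (norm_mul_le _ _).trans (mul_le_mul (h1 q s t ht) (h1' q s t ht) (norm_nonneg _)
            (by have := one_pos.trans_le hb; positivity))
      _ = _ := by ring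
  induction n generalizing F G with
  | zero => exact hp hF hG
  | succ n ih =>
    have hF' := hF.pred
    have hG' := hG.pred
    obtain ⟨h1, F', h2, h3⟩ := hF
    obtain ⟨g1, G', g2, g3⟩ := hG
    exact ⟨hp h1 g1, _, fun q s t ht => (h2 q s t ht).mul (g2 q s t ht),
      (ih h3 hG').add hw (ih hF' g3)⟩

lemma continuous_conv {f g : ℝ → 𝔸} (hf : Continuous f) (hg : Continuous g) :
    Continuous fun s : ℝ => ∫ u in (0 : ℝ)..1, f (u * s) * g ((1 - u) * s) :=
  intervalIntegral.continuous_parametric_intervalIntegral_of_continuous'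
    (f := fun s u => f (u * s) * g ((1 - u) * s)) (by fun_prop) _ _

lemma norm_conv_integrand_le (hw : ∀ q, 1 ≤ w q) {C C' : ℝ} {m m' : ℕ} (h0 : 0 ≤ C) (h0' : 0 ≤ C')
    (h1 : ∀ q s, ∀ t ∈ I, ‖F q s t‖ ≤ C * ((1 + |s|) * w q) ^ m)
    (h1' : ∀ q s, ∀ t ∈ I, ‖G q s t‖ ≤ C' * ((1 + |s|) * w q) ^ m') (q : Q) (s : ℝ) {t : ℝ}
    (ht : t ∈ I) {u : ℝ} (hu : u ∈ Set.Ioc (0 : ℝ) 1) :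
    ‖F q (u * s) t * G q ((1 - u) * s) t‖ ≤ C * C' * ((1 + |s|) * w q) ^ (m + m') := by
  have hwq : 0 ≤ w q := by linarith [hw q]
  have hs : 0 ≤ |s| := abs_nonneg s
  have e1 : |u * s| ≤ |s| := by
    rw [abs_mul]
    exact mul_le_of_le_one_left hs (by rw [abs_of_nonneg hu.1.le]; exact hu.2)
  have e2 : |(1 - u) * s| ≤ |s| := by
    rw [abs_mul]
    exact mul_le_of_le_one_left hs (by rw [abs_of_nonneg (by linarith [hu.2])]; linarith [hu.1])
  calc ‖F q (u * s) t * G q ((1 - u) * s) t‖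
      ≤ (C * ((1 + |u * s|) * w q) ^ m) * (C' * ((1 + |(1 - u) * s|) * w q) ^ m') :=
        (norm_mul_le _ _).trans (mul_le_mul (h1 q _ t ht) (h1' q _ t ht) (norm_nonneg _)
          (by positivity))
    _ ≤ (C * ((1 + |s|) * w q) ^ m) * (C' * ((1 + |s|) * w q) ^ m') := by gcongr
    _ = _ := by ring

/-- The rescaled convolution of two families. -/
lemma conv (hI : Convex ℝ I) (hw : ∀ q, 1 ≤ w q) (hF : SmoothFamily I w n F)
    (hG : SmoothFamily I w n G) :
    SmoothFamily I w n
      (fun q s t => ∫ u in (0 : ℝ)..1, F q (u * s) t * G q ((1 - u) * s) t) := by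
  have hp : ∀ {F G : Q → ℝ → ℝ → 𝔸}, PolyBounded I w F → PolyBounded I w G →
      PolyBounded I w (fun q s t => ∫ u in (0 : ℝ)..1, F q (u * s) t * G q ((1 - u) * s) t) := by
    rintro F G ⟨⟨C, m, h0, h1⟩, h2⟩ ⟨⟨C', m', h0', h1'⟩, h2'⟩
    refine ⟨⟨C * C', m + m', by positivity, fun q s t ht => ?_⟩,
      fun q t ht => continuous_conv (h2 q t ht) (h2' q t ht)⟩
    refine (intervalIntegral.norm_integral_le_of_norm_le_const fun u hu => ?_).trans
      (le_of_eq (by rw [sub_zero, abs_one, mul_one]))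
    rw [Set.uIoc_of_le zero_le_one] at hu
    exact norm_conv_integrand_le hw h0 h0' h1 h1' q s ht hu
  induction n generalizing F G with
  | zero => exact hp hF hG
  | succ n ih =>
    have hF' := hF.pred
    have hG' := hG.pred
    obtain ⟨h1, F', h2, h3⟩ := hF
    obtain ⟨g1, G', g2, g3⟩ := hG
    -- By the Leibniz rule the derivative is a sum of two convolutions of families of one order
    -- less.
    have hsum := (ih h3 hG').add hw (ih hF' g3)
    refine ⟨hp h1 g1, _, fun q s t ht => ?_, hsum⟩
    have cont : ∀ {F G : Q → ℝ → ℝ → 𝔸}, PolyBounded I w F → PolyBounded I w G → ∀ t ∈ I,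
        Continuous fun u : ℝ => F q (u * s) t * G q ((1 - u) * s) t := by
      intro F G hF hG t ht
      have := hF.2 q t ht
      have := hG.2 q t ht
      fun_prop
    obtain ⟨⟨C1, m1, p1, b1⟩, -⟩ := h1
    obtain ⟨⟨C2, m2, p2, b2⟩, -⟩ := g1
    obtain ⟨⟨C3, m3, p3, b3⟩, -⟩ := h3.polyBounded
    obtain ⟨⟨C4, m4, p4, b4⟩, -⟩ := g3.polyBounded
    rw [← intervalIntegral.integral_add
      ((cont h3.polyBounded hG'.polyBounded t ht).intervalIntegrable _ _)
      ((cont hF'.polyBounded g3.polyBounded t ht).intervalIntegrable _ _)]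
    simp only [intervalIntegral.integral_of_le (zero_le_one (α := ℝ))]
    refine hasDerivWithinAt_integral hI
      (F := fun t u => F q (u * s) t * G q ((1 - u) * s) t)
      (F' := fun t u => F' q (u * s) t * G q ((1 - u) * s) t
        + F q (u * s) t * G' q ((1 - u) * s) t)
      (b := fun _ => C3 * C2 * ((1 + |s|) * w q) ^ (m3 + m2)
        + C1 * C4 * ((1 + |s|) * w q) ^ (m1 + m4))
      (fun t ht => ?_) (fun u t ht => (h2 q _ t ht).mul (g2 q _ t ht)) (by simp) ?_ ht
    · have := ((cont hF'.polyBounded hG'.polyBounded t ht).intervalIntegrable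
        (μ := volume) 0 1)
      exact (intervalIntegrable_iff_integrableOn_Ioc_of_le zero_le_one).1 this
    · refine ae_restrict_of_forall_mem measurableSet_Ioc fun u hu t ht => ?_
      exact (norm_add_le _ _).trans (add_le_add
        (norm_conv_integrand_le hw p3 p2 b3 b2 q s ht hu)
        (norm_conv_integrand_le hw p1 p4 b1 b4 q s ht hu))

end SmoothFamily

/-! ### Time derivatives of propagators -/

variable {𝔸 : Type*} [CStarAlgebra 𝔸]

/-- Duhamel's formula, with the time interval rescaled to `[0, 1]` so that the integral has the
shape of `SmoothFamily.conv`. -/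
lemma propagator_sub_propagator (K L : 𝔸) (s : ℝ) :
    propagator K s - propagator L s = (Complex.I * s) •
      ∫ u in (0 : ℝ)..1, propagator K (u * s) * ((K - L) * propagator L ((1 - u) * s)) := by
  have hd : ∀ u : ℝ, HasDerivAt (fun u => propagator K (u * s) * propagator L ((1 - u) * s))
      ((Complex.I * s) • (propagator K (u * s) * ((K - L) * propagator L ((1 - u) * s)))) u := by
    intro u
    have h1 := (hasDerivAt_propagator K (u * s)).scomp u ((hasDerivAt_id u).mul_const s)
    have h2 := (hasDerivAt_propagator' L ((1 - u) * s)).scomp u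
      (((hasDerivAt_id u).const_sub 1).mul_const s)
    convert! h1.mul h2 using 1
    have e : ∀ (x : ℝ) (A : 𝔸), x • A = (x : ℂ) • A := fun x A => (Complex.coe_smul x A).symm
    simp only [e, Function.comp, one_mul, id]
    push_cast
    simp only [sub_mul, mul_sub, smul_sub, smul_mul_assoc, mul_smul_comm, smul_smul, mul_assoc]
    rw [sub_eq_add_neg, ← neg_smul]
    congr 2 <;> ring
  have hc : Continuous fun u : ℝ =>
      propagator K (u * s) * ((K - L) * propagator L ((1 - u) * s)) := by
    have := continuous_propagator K
    have := continuous_propagator L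
    fun_prop
  have := intervalIntegral.integral_eq_sub_of_hasDerivAt (fun x _ => hd x)
    ((hc.const_smul _).intervalIntegrable 0 1)
  rw [intervalIntegral.integral_smul] at this
  rw [this]
  simp

/-- Duhamel's formula expresses the difference quotient of the propagator through that of `H`. The
latter converges, hence is eventually bounded, and the propagators are contractions; this gives a
constant majorant. -/
lemma hasDerivWithinAt_propagator {I : Set ℝ} {H : ℝ → 𝔸} {H' : 𝔸} {t : ℝ} (ht : t ∈ I)
    (hsa : ∀ t ∈ I, IsSelfAdjoint (H t)) (hd : HasDerivWithinAt H H' I t) (s : ℝ) :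
    HasDerivWithinAt (fun t => propagator (H t) s) ((Complex.I * s) •
      ∫ u in (0 : ℝ)..1, propagator (H t) (u * s) * (H' * propagator (H t) ((1 - u) * s))) I t := by
  have hslope := hasDerivWithinAt_iff_tendsto_slope.1 hd
  rw [hasDerivWithinAt_iff_tendsto_slope]
  have hmem : ∀ᶠ t' in 𝓝[I \ {t}] t, t' ∈ I \ {t} := self_mem_nhdsWithin
  have hlim : Tendsto (fun t' => (Complex.I * s) • ∫ u in (0 : ℝ)..1,
      propagator (H t') (u * s) * (slope H t t' * propagator (H t) ((1 - u) * s)))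
      (𝓝[I \ {t}] t) (𝓝 ((Complex.I * s) •
      ∫ u in (0 : ℝ)..1, propagator (H t) (u * s) * (H' * propagator (H t) ((1 - u) * s)))) := by
    refine Tendsto.const_smul ?_ _
    have hbd : ∀ᶠ t' in 𝓝[I \ {t}] t, ‖slope H t t'‖ ≤ ‖H'‖ + 1 := by
      have := hslope.norm.eventually (gt_mem_nhds (lt_add_one ‖H'‖))
      filter_upwards [this] with t' h using h.le
    refine intervalIntegral.tendsto_integral_filter_of_dominated_convergence (fun _ => ‖H'‖ + 1)
      ?_ ?_ (by simp) ?_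
    · refine Eventually.of_forall fun t' => Continuous.aestronglyMeasurable ?_
      have := continuous_propagator (H t')
      have := continuous_propagator (H t)
      fun_prop
    · filter_upwards [hmem, hbd] with t' h1 h2
      refine Eventually.of_forall fun u _ => ?_
      calc ‖propagator (H t') (u * s) * (slope H t t' * propagator (H t) ((1 - u) * s))‖
          ≤ 1 * ((‖H'‖ + 1) * 1) :=
            (norm_mul_le _ _).trans (mul_le_mul (norm_propagator_le (hsa t' h1.1) _)
              ((norm_mul_le _ _).trans (mul_le_mul h2 (norm_propagator_le (hsa t ht) _)
                (norm_nonneg _) (by positivity))) (norm_nonneg _) zero_le_one)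
        _ = _ := by ring
    · refine Eventually.of_forall fun u _ => ?_
      refine Tendsto.mul ?_ (hslope.mul tendsto_const_nhds)
      have h1 : Tendsto H (𝓝[I \ {t}] t) (𝓝 (H t)) :=
        hd.continuousWithinAt.mono_left (nhdsWithin_mono _ Set.sdiff_subset)
      exact (continuous_exp'.tendsto _).comp (h1.const_smul _)
  refine hlim.congr fun t' => ?_
  rw [slope_def_module, slope_def_module, propagator_sub_propagator, smul_comm]
  congr 1
  rw [← intervalIntegral.integral_smul]
  refine intervalIntegral.integral_congr fun u _ => ?_
  simp only [smul_mul_assoc, mul_smul_comm]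

namespace SmoothFamily

variable {Q : Type*} {I : Set ℝ} {w : Q → ℝ} {n : ℕ}

/-- The derivative is a convolution of two propagators with `H'`, so order `n + 1` follows from
order `n`. Each differentiation costs a factor `|s|` and a derivative of `H`, which keeps the bounds
polynomial. -/
lemma propagator (hI : Convex ℝ I) (hw : ∀ q, 1 ≤ w q) {H : Q → ℝ → 𝔸}
    (hsa : ∀ q, ∀ t ∈ I, IsSelfAdjoint (H q t)) (hH : SmoothFamily I w n (fun q _ t => H q t)) :
    SmoothFamily I w n (fun q s t => propagator (H q t) s) := by
  have hp : PolyBounded I w (fun q s t => LatticeFermions.propagator (H q t) s) :=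
    ⟨⟨1, 0, zero_le_one, fun q s t ht => by simpa using norm_propagator_le (hsa q t ht) s⟩,
      fun q t _ => continuous_propagator _⟩
  induction n with
  | zero => exact hp
  | succ n ih =>
    have hU := ih hH.pred
    obtain ⟨-, H', h2, h3⟩ := hH
    -- The derivative family supplied by `SmoothFamily` may formally depend on `s`; its value at `s
    -- = 0` is a derivative of `H`.
    have h4 := h3.freeze hw
    have h5 := (hU.conv hI hw (h4.mul hw hU)).smul_fun hw
      (c := fun s : ℝ => Complex.I * s) (m := 1) (by fun_prop)
      (fun s => by simp)
    exact ⟨hp, _, fun q s t ht => hasDerivWithinAt_propagator ht (hsa q) (h2 q 0 t ht) s, h5⟩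

lemma evolve (hI : Convex ℝ I) (hw : ∀ q, 1 ≤ w q) {H A : Q → ℝ → 𝔸}
    (hsa : ∀ q, ∀ t ∈ I, IsSelfAdjoint (H q t)) (hH : SmoothFamily I w n (fun q _ t => H q t))
    (hA : SmoothFamily I w n (fun q _ t => A q t)) :
    SmoothFamily I w n (fun q s t => evolve (H q t) s (A q t)) :=
  ((propagator hI hw hsa hH).mul hw hA).mul hw (propagator hI hw hsa hH).comp_neg

end SmoothFamily

/-- `∫ K(s) ∫₀ˢ e^{iuH} C e^{-iuH} du ds`. -/
noncomputable def kernelInt (K : ℝ → ℝ) (H C : 𝔸) : 𝔸 :=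
  ∫ s, K s • (s • ∫ u in (0 : ℝ)..1, evolve H (u * s) C)

lemma SmoothFamily.kernelInt {Q : Type*} {I : Set ℝ} {w : Q → ℝ} {n : ℕ}
    (hI : Convex ℝ I) (hw : ∀ q, 1 ≤ w q) {K : ℝ → ℝ}
    (hK : ∀ n : ℕ, Integrable fun s => K s * (1 + |s|) ^ n) {H A : Q → ℝ → 𝔸}
    (hsa : ∀ q, ∀ t ∈ I, IsSelfAdjoint (H q t)) (hH : SmoothFamily I w n (fun q _ t => H q t))
    (hA : SmoothFamily I w n (fun q _ t => A q t)) :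
    SmoothFamily I w n (fun q _ t => kernelInt K (H q t) (A q t)) := by
  -- The average over `[0, 1]` is the convolution with the constant family `1`.
  have h1 := (evolve hI hw hsa hH hA).conv hI hw (const (A := (1 : 𝔸)))
  have h2 := h1.smul_fun hw (c := fun s : ℝ => s) (m := 1) continuous_id
    (fun s => by rw [Real.norm_eq_abs, pow_one]; linarith [abs_nonneg s])
  have h3 := h2.kernel_integral hI hw hK
  simpa only [mul_one, LatticeFermions.kernelInt] using h3

end SmoothFamilyAlgebra

/-! ### Iterated derivatives on intervals -/

section Interval

variable {E : Type*} [NormedAddCommGroup E] [NormedSpace ℝ E] {I : Set ℝ}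

/-- On a set with at most one point all derivatives of positive order are zero by convention.
Otherwise derivatives within `I` are unique, and there is room in `I` for steps of a fixed length.
-/
lemma subsingleton_or_exists_Icc (hI : I.OrdConnected) :
    I.Subsingleton ∨ ∃ a b, a < b ∧ Set.Icc a b ⊆ I := by
  by_cases h : I.Subsingleton
  · exact Or.inl h
  · right
    rw [Set.not_subsingleton_iff] at h
    obtain ⟨a, ha, b, hb, hab⟩ := h.exists_lt
    exact ⟨a, b, hab, hI.out ha hb⟩

lemma uniqueDiffOn_of_Icc (hI : I.OrdConnected) {a b : ℝ} (hab : a < b) (h : Set.Icc a b ⊆ I) :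
    UniqueDiffOn ℝ I := by
  refine uniqueDiffOn_convex hI.convex ⟨(a + b) / 2, ?_⟩
  refine interior_mono h ?_
  rw [interior_Icc]
  constructor <;> linarith

lemma derivWithin_of_subsingleton (hI : I.Subsingleton) (f : ℝ → E) {t : ℝ} (ht : t ∈ I) :
    derivWithin f I t = 0 := by
  refine derivWithin_zero_of_not_accPt ?_
  rw [accPt_principal_iff_nhdsWithin]
  have : I \ {t} = ∅ := by
    ext x
    simp only [Set.mem_sdiff, Set.mem_singleton_iff, Set.mem_empty_iff_false, iff_false, not_and,
      not_not]
    exact fun hx => hI hx ht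
  rw [this, nhdsWithin_empty]
  exact fun h => h.ne rfl

lemma iteratedDerivWithin_succ_of_subsingleton (hI : I.Subsingleton) (f : ℝ → E) (n : ℕ) {t : ℝ}
    (ht : t ∈ I) : iteratedDerivWithin (n + 1) f I t = 0 := by
  rw [iteratedDerivWithin_succ, derivWithin_of_subsingleton hI _ ht]

lemma hasDerivWithinAt_of_subsingleton (hI : I.Subsingleton) (f : ℝ → E) (f' : E) {t : ℝ}
    (ht : t ∈ I) : HasDerivWithinAt f f' I t := by
  rw [hasDerivWithinAt_iff_tendsto_slope]
  have : I \ {t} = ∅ := by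
    ext x
    simp only [Set.mem_sdiff, Set.mem_singleton_iff, Set.mem_empty_iff_false, iff_false, not_and,
      not_not]
    exact fun hx => hI hx ht
  rw [this, nhdsWithin_empty]
  exact tendsto_bot

lemma hasDerivWithinAt_iteratedDerivWithin (hI : I.OrdConnected) {f : ℝ → E}
    (hf : ContDiffOn ℝ ∞ f I) (i : ℕ) {t : ℝ} (ht : t ∈ I) :
    HasDerivWithinAt (iteratedDerivWithin i f I) (iteratedDerivWithin (i + 1) f I t) I t := by
  rcases subsingleton_or_exists_Icc hI with h | ⟨a, b, hab, h⟩
  · exact hasDerivWithinAt_of_subsingleton h _ _ ht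
  · have hu := uniqueDiffOn_of_Icc hI hab h
    rw [iteratedDerivWithin_succ]
    exact (hf.differentiableOn_iteratedDerivWithin (m := i)
      (by exact_mod_cast WithTop.coe_lt_coe.2 (ENat.natCast_lt_top i)) hu t ht).hasDerivWithinAt

lemma iteratedDerivWithin_finset_sum (hI : I.OrdConnected) {ι : Type*} (s : Finset ι)
    {f : ι → ℝ → E} (hf : ∀ j ∈ s, ContDiffOn ℝ ∞ (f j) I) (i : ℕ) {t : ℝ} (ht : t ∈ I) :
    iteratedDerivWithin i (fun t => ∑ j ∈ s, f j t) I t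
      = ∑ j ∈ s, iteratedDerivWithin i (f j) I t := by
  rcases subsingleton_or_exists_Icc hI with h | ⟨a, b, hab, h⟩
  · cases i with
    | zero => simp
    | succ i => simp [iteratedDerivWithin_succ_of_subsingleton h _ _ ht]
  · have hu := uniqueDiffOn_of_Icc hI hab h
    have hle : (i : WithTop ℕ∞) ≤ (∞ : WithTop ℕ∞) := by exact_mod_cast le_top
    classical
    induction s using Finset.induction_on with
    | empty => simp
    | insert j s hj ih =>
      have h1 : ContDiffOn ℝ ∞ (fun t => ∑ j ∈ s, f j t) I :=
        ContDiffOn.sum fun k hk => hf k (Finset.mem_insert_of_mem hk)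
      simp_rw [Finset.sum_insert hj]
      rw [iteratedDerivWithin_fun_add ht hu ((hf j (Finset.mem_insert_self _ _) t ht).of_le hle)
        ((h1 t ht).of_le hle), ih fun k hk => hf k (Finset.mem_insert_of_mem hk)]

lemma iteratedDerivWithin_fun_sub' (hI : I.OrdConnected) {f g : ℝ → E}
    (hf : ContDiffOn ℝ ∞ f I) (hg : ContDiffOn ℝ ∞ g I) (i : ℕ) {t : ℝ} (ht : t ∈ I) :
    iteratedDerivWithin i (fun t => f t - g t) I t
      = iteratedDerivWithin i f I t - iteratedDerivWithin i g I t := by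
  rcases subsingleton_or_exists_Icc hI with h | ⟨a, b, hab, h⟩
  · cases i with
    | zero => simp
    | succ i => simp [iteratedDerivWithin_succ_of_subsingleton h _ _ ht]
  · have hu := uniqueDiffOn_of_Icc hI hab h
    have hle : (i : WithTop ℕ∞) ≤ (∞ : WithTop ℕ∞) := by exact_mod_cast le_top
    exact iteratedDerivWithin_sub ht hu ((hf t ht).of_le hle) ((hg t ht).of_le hle)

namespace SmoothFamily

variable {Q : Type*} {w : Q → ℝ} {n : ℕ} {F : Q → ℝ → ℝ → E}

lemma of_contDiffOn (hI : I.OrdConnected) {f : Q → ℝ → E} (hf : ∀ q, ContDiffOn ℝ ∞ (f q) I)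
    (hw : ∀ q, 1 ≤ w q) (hb : ∀ i : ℕ, ∃ C : ℝ, ∃ m : ℕ, 0 ≤ C ∧ ∀ q, ∀ t ∈ I,
      ‖iteratedDerivWithin i (f q) I t‖ ≤ C * w q ^ m) (n : ℕ) :
    SmoothFamily I w n (fun q _ t => f q t) := by
  have key : ∀ n i, SmoothFamily I w n (fun q _ t => iteratedDerivWithin i (f q) I t) := by
    intro n
    have hp : ∀ i, PolyBounded I w (fun q _ t => iteratedDerivWithin i (f q) I t) := by
      intro i
      obtain ⟨C, m, h0, h1⟩ := hb i
      refine ⟨⟨C, m, h0, fun q s t ht => (h1 q t ht).trans ?_⟩, fun _ _ _ => continuous_const⟩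
      have hwq : 0 ≤ w q := by linarith [hw q]
      refine mul_le_mul_of_nonneg_left (pow_le_pow_left₀ hwq ?_ _) h0
      exact le_mul_of_one_le_left hwq (by linarith [abs_nonneg s])
    induction n with
    | zero => exact hp
    | succ n ih =>
      exact fun i => ⟨hp i, _, fun q s t ht => hasDerivWithinAt_iteratedDerivWithin hI (hf q) i ht,
        ih (i + 1)⟩
  simpa using key n 0

lemma derivWithin (hI : I.OrdConnected) (hF : SmoothFamily I w (n + 1) F) :
    SmoothFamily I w n (fun q s t => derivWithin (F q s) I t) := by
  rcases subsingleton_or_exists_Icc hI with h | ⟨a, b, hab, h⟩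
  · exact zero.congr fun q s t ht => (derivWithin_of_subsingleton h _ ht).symm
  · have hu := uniqueDiffOn_of_Icc hI hab h
    obtain ⟨-, F', h2, h3⟩ := hF
    exact h3.congr fun q s t ht => ((h2 q s t ht).derivWithin (hu t ht)).symm

lemma iteratedDerivWithin (hI : I.OrdConnected) (hF : ∀ n, SmoothFamily I w n F) (i n : ℕ) :
    SmoothFamily I w n (fun q s t => iteratedDerivWithin i (F q s) I t) := by
  induction i generalizing n with
  | zero => simpa using hF n
  | succ i ih =>
    simp_rw [iteratedDerivWithin_succ]
    exact (ih (n + 1)).derivWithin hI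

lemma differentiableOn (hF : SmoothFamily I w 1 F) (q : Q) (s : ℝ) :
    DifferentiableOn ℝ (F q s) I := by
  obtain ⟨-, F', h2, -⟩ := hF
  exact fun t ht => (h2 q s t ht).differentiableWithinAt

lemma contDiffOn (hI : I.OrdConnected) (hF : ∀ n, SmoothFamily I w n F) (q : Q) (s : ℝ) :
    ContDiffOn ℝ ∞ (F q s) I := by
  rcases subsingleton_or_exists_Icc hI with h | ⟨a, b, hab, h⟩
  · intro t ht
    have : ContDiffOn ℝ ∞ (fun _ : ℝ => F q s t) I := contDiffOn_const
    exact (this.congr fun t' ht' => by rw [h ht' ht]) t ht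
  · exact contDiffOn_of_differentiableOn_deriv fun m _ =>
      (iteratedDerivWithin hI hF m 1).differentiableOn q s

lemma bound (hI : I.OrdConnected) {f : Q → ℝ → E}
    (hf : ∀ n, SmoothFamily I w n (fun q _ t => f q t)) (i : ℕ) :
    ∃ C : ℝ, ∃ m : ℕ, 0 ≤ C ∧ ∀ q, ∀ t ∈ I,
      ‖_root_.iteratedDerivWithin i (f q) I t‖ ≤ C * w q ^ m := by
  obtain ⟨⟨C, m, h0, h1⟩, -⟩ := (iteratedDerivWithin hI hf i 0).polyBounded
  exact ⟨C, m, h0, fun q t ht => by simpa using h1 q 0 t ht⟩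

end SmoothFamily

/-! ### Interpolation between a function and its second derivative -/

/-- A Landau inequality: first-order Taylor expansion with step `h` has an error of at most `h² K`.
Since `2h ≤ b - a`, every `t` has room for the step inside `I` on at least one side. -/
lemma norm_deriv_le_interpolation {f f' f'' : ℝ → E} (hI : I.OrdConnected) {a b : ℝ}
    (hab : Set.Icc a b ⊆ I) (hf : ∀ t ∈ I, HasDerivWithinAt f (f' t) I t)
    (hf' : ∀ t ∈ I, HasDerivWithinAt f' (f'' t) I t) {ε K : ℝ} (hε : ∀ t ∈ I, ‖f t‖ ≤ ε)
    (hK : ∀ t ∈ I, ‖f'' t‖ ≤ K) {h : ℝ} (h0 : 0 < h) (hh : h ≤ (b - a) / 2) {t : ℝ} (ht : t ∈ I) :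
    ‖f' t‖ ≤ 2 * ε / h + h * K := by
  -- a point of `I` at distance `h` from `t`
  obtain ⟨t', ht', hd⟩ : ∃ t' ∈ I, |t' - t| = h := by
    have ha : a ∈ I := hab ⟨le_rfl, by linarith⟩
    have hb : b ∈ I := hab ⟨by linarith, le_rfl⟩
    rcases le_total t ((a + b) / 2) with hm | hm
    · refine ⟨t + h, hI.out ht hb ⟨by linarith, by linarith⟩, ?_⟩
      rw [add_sub_cancel_left, abs_of_pos h0]
    · refine ⟨t - h, hI.out ha ht ⟨by linarith, by linarith⟩, ?_⟩
      rw [sub_sub_cancel_left, abs_neg, abs_of_pos h0]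
  have hJ : Set.uIcc t t' ⊆ I := hI.uIcc_subset ht ht'
  have hf'sub : ∀ x ∈ Set.uIcc t t', ‖f' x - f' t‖ ≤ K * h := by
    intro x hx
    have h1 := (convex_uIcc t t').norm_image_sub_le_of_norm_hasDerivWithin_le
      (fun y hy => (hf' y (hJ hy)).mono hJ) (fun y hy => hK y (hJ hy)) Set.left_mem_uIcc hx
    refine h1.trans (mul_le_mul_of_nonneg_left ?_ ((norm_nonneg _).trans (hK t ht)))
    rw [Real.norm_eq_abs, ← hd]
    exact Set.abs_sub_left_of_mem_uIcc hx
  -- The mean value inequality for `f` minus the linear function with slope `f' t` is the Taylor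
  -- remainder estimate.
  have h2 := (convex_uIcc t t').norm_image_sub_le_of_norm_hasDerivWithin_le
    (f := fun x => f x - x • f' t) (f' := fun x => f' x - f' t) (C := K * h)
    (fun y hy => by
      have := ((hf y (hJ hy)).mono hJ).sub
        ((hasDerivWithinAt_id y (Set.uIcc t t')).smul_const (f' t))
      simpa using! this) hf'sub Set.left_mem_uIcc Set.right_mem_uIcc
  rw [Real.norm_eq_abs, hd] at h2
  have h3 : ‖(t' - t) • f' t‖ ≤ 2 * ε + K * h * h := by
    have e : (t' - t) • f' t = f t' - f t - (f t' - t' • f' t - (f t - t • f' t)) := by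
      rw [sub_smul]; abel
    rw [e]
    calc _ ≤ ‖f t' - f t‖ + ‖f t' - t' • f' t - (f t - t • f' t)‖ := norm_sub_le _ _
      _ ≤ (‖f t'‖ + ‖f t‖) + K * h * h := add_le_add (norm_sub_le _ _) h2
      _ ≤ _ := by linarith [hε t' ht', hε t ht]
  rw [norm_smul, Real.norm_eq_abs, hd] at h3
  rw [← mul_le_mul_iff_right₀ h0]
  refine h3.trans (le_of_eq ?_)
  field_simp

namespace SmoothFamily

variable {Q : Type*} {w : Q → ℝ}

/-- If a smooth family decays faster than every power of the weight, so do its derivatives. -/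
lemma rapidDecay (hI : I.OrdConnected) (hw : ∀ q, 1 ≤ w q) {f : Q → ℝ → E}
    (hf : ∀ n, SmoothFamily I w n (fun q _ t => f q t))
    (hd : ∀ N : ℕ, ∃ C, ∀ q, ∀ t ∈ I, ‖f q t‖ * w q ^ N ≤ C) (i N : ℕ) :
    ∃ C, ∀ q, ∀ t ∈ I, ‖_root_.iteratedDerivWithin i (f q) I t‖ * w q ^ N ≤ C := by
  rcases subsingleton_or_exists_Icc hI with h | ⟨a, b, hab, h⟩
  · cases i with
    | zero => simpa using hd N
    | succ i =>
      exact ⟨0, fun q t ht => by simp [iteratedDerivWithin_succ_of_subsingleton h _ _ ht]⟩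
  · induction i generalizing N with
    | zero => simpa using hd N
    | succ i ih =>
      obtain ⟨C₂, m, h0, h2⟩ := bound hI hf (i + 2)
      -- The second derivative of size `w^m` forces a step of order `w^(-(N + m))`. Decay of order
      -- `2N + m` of the lower derivative then makes both terms of the interpolation inequality of
      -- order `w^(-N)`.
      obtain ⟨C, hC⟩ := ih (2 * N + m)
      set L := (b - a) / 2
      have hL : 0 < L := by simp only [L]; linarith
      refine ⟨2 * C / L + L * C₂, fun q t ht => ?_⟩
      have hcd := contDiffOn hI hf q 0
      have hwq : 0 < w q := by linarith [hw q]
      have hp : ∀ k : ℕ, 0 < w q ^ k := fun k => pow_pos hwq k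
      have key := norm_deriv_le_interpolation hI h
        (fun t ht => hasDerivWithinAt_iteratedDerivWithin hI hcd i ht)
        (fun t ht => hasDerivWithinAt_iteratedDerivWithin hI hcd (i + 1) ht)
        (ε := C / w q ^ (2 * N + m)) (K := C₂ * w q ^ m)
        (fun t ht => by rw [le_div_iff₀ (hp _)]; exact hC q t ht) (h2 q)
        (h := L / w q ^ (N + m)) (div_pos hL (hp _))
        (div_le_self hL.le (one_le_pow₀ (hw q))) ht
      refine (mul_le_mul_of_nonneg_right key (hp N).le).trans (le_of_eq ?_)
      have h1 := (hp N).ne'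
      have h3 := (hp m).ne'
      rw [pow_add, pow_mul', sq, pow_add]
      field_simp

/-- If a smooth sequence converges uniformly to zero, so do its derivatives. -/
lemma tendsto_zero (hI : I.OrdConnected) {f : ℕ → ℝ → E}
    (hf : ∀ n, SmoothFamily I (fun _ => 1) n (fun q _ t => f q t))
    (hd : ∀ ε > 0, ∀ᶠ k in atTop, ∀ t ∈ I, ‖f k t‖ ≤ ε) (i : ℕ) :
    ∀ ε > 0, ∀ᶠ k in atTop, ∀ t ∈ I, ‖_root_.iteratedDerivWithin i (f k) I t‖ ≤ ε := by
  rcases subsingleton_or_exists_Icc hI with h | ⟨a, b, hab, h⟩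
  · cases i with
    | zero => simpa using hd
    | succ i =>
      exact fun ε hε => Eventually.of_forall fun k t ht => by
        simpa [iteratedDerivWithin_succ_of_subsingleton h _ _ ht] using hε.le
  · induction i with
    | zero => simpa using hd
    | succ i ih =>
      intro ε hε
      obtain ⟨C₂, m, h0, h2⟩ := bound hI hf (i + 2)
      set L := (b - a) / 2
      have hL : 0 < L := by simp only [L]; linarith
      -- The step is so small that the second derivative contributes at most `ε / 2`; a bound `h' ε
      -- / 4` on the lower derivative then yields the other half.
      set h' := min L (ε / (2 * (C₂ + 1)))
      have hh' : 0 < h' := lt_min hL (by positivity)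
      have hle : h' * C₂ ≤ ε / 2 := by
        calc h' * C₂ ≤ ε / (2 * (C₂ + 1)) * (C₂ + 1) := by
              refine mul_le_mul (min_le_right _ _) (by linarith) h0 (by positivity)
          _ = ε / 2 := by field_simp
      filter_upwards [ih (h' * ε / 4) (by positivity)] with k hk t ht
      have hcd := contDiffOn hI hf k 0
      have key := norm_deriv_le_interpolation hI h
        (fun t ht => hasDerivWithinAt_iteratedDerivWithin hI hcd i ht)
        (fun t ht => hasDerivWithinAt_iteratedDerivWithin hI hcd (i + 1) ht)
        (ε := h' * ε / 4) (K := C₂) hk (fun t ht => by simpa using h2 k t ht)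
        (h := h') hh' (min_le_left _ _) ht
      refine key.trans ?_
      have : 2 * (h' * ε / 4) / h' = ε / 2 := by field_simp; norm_num
      linarith

end SmoothFamily

end Interval

/-! ### Elementary decay estimates -/

section Decay

lemma exists_pow_le_exp {μ : ℝ} (hμ : 0 < μ) (p : ℕ) :
    ∃ C : ℝ, 0 ≤ C ∧ ∀ s : ℝ, 0 ≤ s → (1 + s) ^ p ≤ C * Real.exp (μ * s) := by
  refine ⟨p.factorial / μ ^ p * Real.exp μ, by positivity, fun s hs => ?_⟩
  have h := Real.pow_div_factorial_le_exp (μ * (1 + s)) (by positivity) p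
  rw [div_le_iff₀ (by positivity), mul_pow] at h
  rw [mul_assoc, ← Real.exp_add, div_mul_eq_mul_div, le_div_iff₀ (by positivity)]
  calc (1 + s) ^ p * μ ^ p = μ ^ p * (1 + s) ^ p := mul_comm _ _
    _ ≤ Real.exp (μ * (1 + s)) * p.factorial := h
    _ = _ := by rw [mul_comm]; congr 2; ring

/-- An exponential light cone bound gives a polynomial one. -/
lemma exists_lightCone_bound {μ c : ℝ} (hμ : 0 < μ) (hc : 0 ≤ c) (p : ℕ) :
    ∃ C : ℝ, 0 ≤ C ∧ ∀ s r m B v : ℝ, 0 ≤ s → 0 ≤ r → 0 ≤ m → 0 ≤ B → v ≤ 2 * B →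
      v ≤ B * Real.exp (c * s + μ * r - μ * m + μ) →
      v * (1 + m) ^ p ≤ C * B * ((1 + s) * (1 + r)) ^ p := by
  obtain ⟨C₁, h1, hC₁⟩ := exists_pow_le_exp (half_pos hμ) p
  set A := 2 * c / μ + 3
  have hA : 0 ≤ A := by positivity
  refine ⟨C₁ * Real.exp μ + 2 * A ^ p, by positivity, fun s r m B v hs hr hm hB hv1 hv2 => ?_⟩
  have h1le : 1 ≤ ((1 + s) * (1 + r)) ^ p :=
    one_le_pow₀ (one_le_mul_of_one_le_of_one_le (by linarith) (by linarith))
  -- Outside the light cone half of the exponential decay in `m` survives and beats `(1 + m)^p`.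
  -- Inside, `m` is at most linear in `s` and `r`, and the trivial bound `2B` suffices.
  by_cases hcase : c * s + μ * r ≤ μ / 2 * m
  · have he : Real.exp (c * s + μ * r - μ * m + μ) ≤ Real.exp (μ - μ / 2 * m) :=
      Real.exp_le_exp.2 (by linarith)
    calc v * (1 + m) ^ p ≤ (B * Real.exp (μ - μ / 2 * m)) * (C₁ * Real.exp (μ / 2 * m)) := by
          refine (mul_le_mul_of_nonneg_right (hv2.trans (mul_le_mul_of_nonneg_left he hB))
            (by positivity)).trans ?_
          exact mul_le_mul_of_nonneg_left (hC₁ m hm) (by positivity)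
      _ = C₁ * Real.exp μ * B := by
          rw [Real.exp_sub]; field_simp
      _ ≤ (C₁ * Real.exp μ + 2 * A ^ p) * B * 1 := by
          rw [mul_one]
          exact mul_le_mul_of_nonneg_right (by linarith [pow_nonneg hA p]) hB
      _ ≤ _ := mul_le_mul_of_nonneg_left h1le (by positivity)
  · have hm2 : 1 + m ≤ A * ((1 + s) * (1 + r)) := by
      rw [not_le] at hcase
      have h2 : m < 2 * c / μ * s + 2 * r := by
        have : m = 2 / μ * (μ / 2 * m) := by field_simp
        rw [this]
        calc 2 / μ * (μ / 2 * m) < 2 / μ * (c * s + μ * r) :=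
              mul_lt_mul_of_pos_left hcase (by positivity)
          _ = _ := by field_simp
      have h3 : 0 ≤ 2 * c / μ := by positivity
      have h4 := mul_nonneg hs hr
      have h5 := mul_nonneg h3 hs
      have h6 := mul_nonneg h3 hr
      have h7 := mul_nonneg h3 h4
      simp only [A]
      nlinarith
    calc v * (1 + m) ^ p ≤ 2 * B * (A * ((1 + s) * (1 + r))) ^ p :=
          (mul_le_mul_of_nonneg_right hv1 (by positivity)).trans
            (mul_le_mul_of_nonneg_left (pow_le_pow_left₀ (by positivity) hm2 p) (by positivity))
      _ = 2 * A ^ p * B * ((1 + s) * (1 + r)) ^ p := by rw [mul_pow A]; ring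
      _ ≤ _ := by
          refine mul_le_mul_of_nonneg_right (mul_le_mul_of_nonneg_right ?_ hB) (by positivity)
          have : 0 ≤ C₁ * Real.exp μ := by positivity
          linarith

/-- Every family of polynomial bounds is dominated by a decay function of class `S`. -/
lemma exists_classS (d : ℕ) (C : ℕ → ℝ) :
    ∃ ζ : ℝ → ℝ, ClassS ζ ∧ ∃ B : ℝ, 0 ≤ B ∧ ∀ s v : ℝ, 0 ≤ s →
      (∀ p : ℕ, v * (1 + s) ^ p ≤ C p) → v ≤ B * decayF d ζ s := by
  -- These scales grow at least geometrically and dominate the given constants. The shift `d + 3`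
  -- comes from the final count: `N` powers for `ζ`, `d + 1` for `decayF` and one to absorb `R (N -
  -- 1) ≤ s` make `N + d + 2 = (N - 1) + d + 3`.
  set R : ℕ → ℝ := fun p => 2 ^ p * (1 + ∑ j ∈ Finset.range (p + 1), |C (j + d + 3)|)
  have hsum0 : ∀ p, 0 ≤ ∑ j ∈ Finset.range (p + 1), |C (j + d + 3)| :=
    fun p => Finset.sum_nonneg fun _ _ => abs_nonneg _
  have hR2 : ∀ p, (2 : ℝ) ^ p ≤ R p := fun p =>
    le_mul_of_one_le_right (by positivity) (by linarith [hsum0 p])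
  have hR1 : ∀ p, 1 ≤ R p := fun p => (one_le_pow₀ (by norm_num)).trans (hR2 p)
  have hR0 : ∀ p, 0 < R p := fun p => one_pos.trans_le (hR1 p)
  have hRC : ∀ p, C (p + d + 3) ≤ R p := by
    intro p
    have h1 : |C (p + d + 3)| ≤ ∑ j ∈ Finset.range (p + 1), |C (j + d + 3)| :=
      Finset.single_le_sum (f := fun j => |C (j + d + 3)|) (fun _ _ => abs_nonneg _)
        (Finset.mem_range.2 (Nat.lt_succ_self p))
    have h2 : 1 + ∑ j ∈ Finset.range (p + 1), |C (j + d + 3)| ≤ R p :=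
      le_mul_of_one_le_left (by linarith [hsum0 p]) (one_le_pow₀ (by norm_num))
    linarith [le_abs_self (C (p + d + 3))]
  have hRstep : ∀ N i, 2 ^ i * R N ≤ R (N + i) := by
    intro N i
    simp only [R]
    rw [pow_add, ← mul_assoc, mul_comm ((2 : ℝ) ^ i)]
    refine mul_le_mul_of_nonneg_left ?_ (by positivity)
    have : ∑ j ∈ Finset.range (N + 1), |C (j + d + 3)|
        ≤ ∑ j ∈ Finset.range (N + i + 1), |C (j + d + 3)| :=
      Finset.sum_le_sum_of_subset_of_nonneg
        (Finset.range_subset_range.2 (by omega)) fun _ _ _ => abs_nonneg _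
    linarith
  set L : ℝ → ℕ → ℝ := fun s p => Real.log (1 + s / R p)
  have hL0 : ∀ s, 0 ≤ s → ∀ p, 0 ≤ L s p := fun s hs p =>
    Real.log_nonneg (by have := div_nonneg hs (hR0 p).le; linarith)
  have hLle : ∀ s, 0 ≤ s → ∀ p, L s p ≤ s / R p := fun s hs p => by
    have := div_nonneg hs (hR0 p).le
    exact (Real.log_le_sub_one_of_pos (by linarith)).trans (by linarith)
  have hsummable : ∀ s, 0 ≤ s → Summable (L s) := by
    intro s hs
    refine Summable.of_nonneg_of_le (hL0 s hs) (fun p => ?_) (summable_geometric_two.mul_left s)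
    refine (hLle s hs p).trans ?_
    rw [div_pow, one_pow, mul_one_div]
    exact div_le_div_of_nonneg_left hs (by positivity) (hR2 p)
  -- This is the infinite product of the factors `1 / (1 + s / R p)`. Each factor is non-increasing
  -- and logarithmically superadditive, and the first `n` of them already give decay of order `n`.
  set ζ : ℝ → ℝ := fun s => Real.exp (-∑' p, L s p)
  have hζ : ClassS ζ := by
    refine ⟨fun s _ => Real.exp_pos _, ⟨1, fun s hs => ?_⟩, ?_, ?_, ?_⟩
    · rw [Real.exp_le_one_iff, neg_nonpos]
      exact tsum_nonneg (hL0 s hs)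
    · intro s hs t ht hst
      refine Real.exp_le_exp.2 (neg_le_neg ?_)
      refine (hsummable s hs).tsum_le_tsum (fun p => ?_) (hsummable t ht)
      have := div_nonneg hs (hR0 p).le
      refine Real.log_le_log (by linarith) ?_
      have := div_le_div_of_nonneg_right hst (hR0 p).le
      linarith
    · intro s t hs ht
      rw [← Real.exp_add, Real.exp_le_exp, ← neg_add, neg_le_neg_iff,
        ← (hsummable s hs).tsum_add (hsummable t ht)]
      refine (hsummable _ (add_nonneg hs ht)).tsum_le_tsum (fun p => ?_)
        ((hsummable s hs).add (hsummable t ht))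
      have h1 := div_nonneg hs (hR0 p).le
      have h2 := div_nonneg ht (hR0 p).le
      simp only [L]
      rw [← Real.log_mul (by linarith) (by linarith), add_div]
      refine Real.log_le_log (by linarith) ?_
      nlinarith [mul_nonneg h1 h2]
    · intro n
      refine ⟨∏ p ∈ Finset.range n, R p, fun s hs => ?_⟩
      have h1 : ζ s ≤ ∏ p ∈ Finset.range n, (1 + s / R p)⁻¹ := by
        have h2 : ∑ p ∈ Finset.range n, L s p ≤ ∑' p, L s p :=
          (hsummable s hs).sum_le_tsum _ fun p _ => hL0 s hs p
        refine (Real.exp_le_exp.2 (neg_le_neg h2)).trans (le_of_eq ?_)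
        rw [← Finset.sum_neg_distrib, Real.exp_sum]
        refine Finset.prod_congr rfl fun p _ => ?_
        have := div_nonneg hs (hR0 p).le
        rw [Real.exp_neg, Real.exp_log (by linarith)]
      refine (mul_le_mul_of_nonneg_left h1 (by positivity)).trans ?_
      have e : s ^ n = ∏ _p ∈ Finset.range n, s := by simp
      rw [e, ← Finset.prod_mul_distrib]
      refine Finset.prod_le_prod (fun p _ => ?_) fun p _ => ?_
      · have := div_nonneg hs (hR0 p).le
        positivity
      · have h3 := div_nonneg hs (hR0 p).le
        rw [← div_eq_mul_inv, div_le_iff₀ (by linarith), mul_add, mul_div_cancel₀ _ (hR0 p).ne']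
        linarith [hR0 p]
  refine ⟨ζ, hζ, Real.exp 2 * (|C (d + 1)| + 1), by positivity, fun s v hs hv => ?_⟩
  have hex : ∃ N, s < R N := by
    obtain ⟨N, hN⟩ := pow_unbounded_of_one_lt s (one_lt_two (α := ℝ))
    exact ⟨N, hN.trans_le (hR2 N)⟩
  classical
  -- The factors before `N` cost at most `(1 + s)^N`; all others together cost at most `exp 2`,
  -- because `R` grows geometrically beyond `s < R N`.
  set N := Nat.find hex
  have hN : s < R N := Nat.find_spec hex
  have hφ : ∑' p, L s p ≤ N * Real.log (1 + s) + 2 := by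
    rw [← (hsummable s hs).sum_add_tsum_nat_add N]
    refine add_le_add ?_ ?_
    · refine (Finset.sum_le_card_nsmul _ _ (Real.log (1 + s)) fun p _ => ?_).trans
        (le_of_eq (by simp))
      have := div_nonneg hs (hR0 p).le
      refine Real.log_le_log (by linarith) ?_
      linarith [div_le_self hs (hR1 p)]
    · rw [← tsum_geometric_two]
      refine ((summable_nat_add_iff N).2 (hsummable s hs)).tsum_le_tsum (fun i => ?_)
        summable_geometric_two
      refine (hLle s hs _).trans ?_
      rw [div_le_iff₀ (hR0 _), div_pow, one_pow, div_mul_eq_mul_div, one_mul,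
        le_div_iff₀ (by positivity)]
      have := hRstep N i
      rw [add_comm i N]
      nlinarith [pow_pos (two_pos (α := ℝ)) i]
  have hζle : Real.exp (-2) * ((1 + s) ^ N)⁻¹ ≤ ζ s := by
    have e : Real.exp (-2) * ((1 + s) ^ N)⁻¹ = Real.exp (-(N * Real.log (1 + s) + 2)) := by
      rw [neg_add, Real.exp_add, Real.exp_neg (_ * _), ← Real.log_pow,
        Real.exp_log (by positivity), mul_comm]
    rw [e]
    exact Real.exp_le_exp.2 (neg_le_neg hφ)
  have hmain : v * (1 + s) ^ (N + d + 1) ≤ |C (d + 1)| + 1 := by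
    -- For `N = 0` there is no preceding scale below `s`, and the polynomial bound of order `d + 1`
    -- is used directly.
    rcases Nat.eq_zero_or_pos N with h0 | h0
    · rw [h0, zero_add]
      linarith [hv (d + 1), le_abs_self (C (d + 1))]
    · have h1 : R (N - 1) ≤ s := not_lt.1 (Nat.find_min hex (Nat.sub_lt h0 one_pos))
      have h2 := hv (N + d + 2)
      have h3 := hRC (N - 1)
      have e : N - 1 + d + 3 = N + d + 2 := by omega
      rw [e] at h3
      have h4 : v * (1 + s) ^ (N + d + 1) * (1 + s) ≤ 1 * (1 + s) := by
        rw [mul_assoc, ← pow_succ]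
        linarith
      have h5 := le_of_mul_le_mul_right h4 (by linarith)
      linarith [abs_nonneg (C (d + 1))]
  have hv' : v ≤ (|C (d + 1)| + 1) * (((1 + s) ^ N)⁻¹ / (1 + s) ^ (d + 1)) := by
    rw [div_eq_mul_inv, ← mul_inv, ← pow_add, ← add_assoc, ← div_eq_mul_inv,
      le_div_iff₀ (by positivity)]
    exact hmain
  refine hv'.trans ?_
  rw [mul_comm (Real.exp 2), mul_assoc]
  refine mul_le_mul_of_nonneg_left ?_ (by positivity)
  rw [decayF, ← mul_div_assoc]
  refine div_le_div_of_nonneg_right ?_ (by positivity)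
  calc ((1 + s) ^ N)⁻¹ = Real.exp 2 * (Real.exp (-2) * ((1 + s) ^ N)⁻¹) := by
        rw [← mul_assoc, ← Real.exp_add]; simp
    _ ≤ _ := mul_le_mul_of_nonneg_left hζle (Real.exp_pos _).le

end Decay

/-! ### Sums over boxes -/

section Lattice

variable {d : ℕ}

lemma l1dist_nonneg (x y : Site d) : 0 ≤ l1dist x y :=
  Finset.sum_nonneg fun _ _ => abs_nonneg _

lemma l1dist_self (x : Site d) : l1dist x x = 0 := by simp [l1dist]

lemma mem_box {k : ℕ} {x : Site d} : x ∈ box d k ↔ ∀ j, -(k : ℤ) ≤ x j ∧ x j ≤ k := by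
  simp [box, Fintype.mem_piFinset]

lemma box_mono {k l : ℕ} (h : k ≤ l) : box d k ⊆ box d l := by
  intro x hx
  rw [mem_box] at hx ⊢
  intro j
  have := hx j
  constructor <;> omega

lemma l1dist_le_of_mem_box {k : ℕ} {x y : Site d} (hx : x ∈ box d k) (hy : y ∈ box d k) :
    l1dist x y ≤ 2 * d * k := by
  rw [mem_box] at hx hy
  calc l1dist x y ≤ ∑ _j : Fin d, (2 * k : ℝ) := by
        refine Finset.sum_le_sum fun j _ => ?_
        rw [abs_le]
        have h1 : (-(k : ℝ)) ≤ x j := by exact_mod_cast (hx j).1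
        have h2 : (x j : ℝ) ≤ k := by exact_mod_cast (hx j).2
        have h3 : (-(k : ℝ)) ≤ y j := by exact_mod_cast (hy j).1
        have h4 : (y j : ℝ) ≤ k := by exact_mod_cast (hy j).2
        constructor <;> linarith
    _ = _ := by simp; ring

namespace BoxMetrics

variable (D : BoxMetrics d) {k : ℕ} {x y z : Site d}

lemma dist_self (hx : x ∈ box d k) : D.dist k x x = 0 := (D.eq_zero_iff k x hx x hx).2 rfl

lemma dist_nonneg (hx : x ∈ box d k) (hy : y ∈ box d k) : 0 ≤ D.dist k x y := by
  have h1 := D.triangle k x hx y hy x hx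
  rw [D.dist_self hx, D.symm k y hy x hx] at h1
  linarith

end BoxMetrics

lemma exists_int_sum_bound : ∃ K : ℝ, 0 ≤ K ∧ ∀ (s : Finset ℤ) (a : ℤ),
    ∑ u ∈ s, ((1 + |(a : ℝ) - u| / 2) ^ 2)⁻¹ ≤ K := by
  have hs : Summable fun v : ℤ => ((1 + |(v : ℝ)| / 2) ^ 2)⁻¹ := by
    have h1 : Summable fun v : ℤ => 4 * (1 / (v : ℝ) ^ 2) :=
      (Real.summable_one_div_int_pow.2 one_lt_two).mul_left 4
    refine Summable.of_norm_bounded_eventually (g := fun v : ℤ => 4 * (1 / (v : ℝ) ^ 2)) h1 ?_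
    have : ∀ᶠ v : ℤ in cofinite, v ≠ 0 := by
      simp only [ne_eq]
      exact (Set.finite_singleton (0 : ℤ)).subset (fun v hv => by simpa using hv)
    filter_upwards [this] with v hv
    have hv' : 0 < |(v : ℝ)| := abs_pos.2 (by exact_mod_cast hv)
    rw [Real.norm_of_nonneg (by positivity), ← sq_abs (v : ℝ), mul_one_div,
      inv_le_comm₀ (by positivity) (by positivity), inv_div]
    nlinarith
  refine ⟨∑' v : ℤ, ((1 + |(v : ℝ)| / 2) ^ 2)⁻¹, tsum_nonneg fun v => by positivity,
    fun s a => ?_⟩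
  have e : ∑ u ∈ s, ((1 + |(a : ℝ) - u| / 2) ^ 2)⁻¹
      = ∑ v ∈ s.image (fun u => a - u), ((1 + |(v : ℝ)| / 2) ^ 2)⁻¹ := by
    rw [Finset.sum_image (fun u _ v _ h => by simpa using h)]
    simp
  rw [e]
  exact hs.sum_le_tsum _ fun v _ => by positivity

/-- Two powers per coordinate reduce the sum to a product of convergent one-dimensional sums. The
halved distance is the form needed for the nearest-point argument in `exists_dist_sum_bound`. -/
lemma exists_l1_sum_bound (d : ℕ) : ∃ K : ℝ, 0 ≤ K ∧ ∀ (k : ℕ) (x : Site d),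
    ∑ z ∈ box d k, ((1 + l1dist x z / 2) ^ (2 * d))⁻¹ ≤ K := by
  obtain ⟨K, hK0, hK⟩ := exists_int_sum_bound
  refine ⟨K ^ d, by positivity, fun k x => ?_⟩
  calc ∑ z ∈ box d k, ((1 + l1dist x z / 2) ^ (2 * d))⁻¹
      ≤ ∑ z ∈ box d k, ∏ j, ((1 + |(x j : ℝ) - z j| / 2) ^ 2)⁻¹ := by
        refine Finset.sum_le_sum fun z _ => ?_
        rw [Finset.prod_inv_distrib, pow_mul]
        refine inv_anti₀ (Finset.prod_pos fun j _ => by positivity) ?_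
        calc ∏ j, (1 + |(x j : ℝ) - z j| / 2) ^ 2
            ≤ ∏ _j : Fin d, (1 + l1dist x z / 2) ^ 2 := by
              refine Finset.prod_le_prod (fun j _ => by positivity) fun j _ => ?_
              refine pow_le_pow_left₀ (by positivity) ?_ 2
              have : |(x j : ℝ) - z j| ≤ l1dist x z :=
                Finset.single_le_sum (f := fun j => |(x j : ℝ) - z j|)
                  (fun _ _ => abs_nonneg _) (Finset.mem_univ j)
              linarith
          _ = _ := by simp
    _ = ∏ j, ∑ u ∈ Finset.Icc (-(k : ℤ)) k, ((1 + |(x j : ℝ) - u| / 2) ^ 2)⁻¹ := by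
        rw [box, Finset.prod_univ_sum]
    _ ≤ ∏ _j : Fin d, K := Finset.prod_le_prod
        (fun j _ => Finset.sum_nonneg fun u _ => by positivity) fun j _ => hK _ _
    _ = _ := by simp

/-- Points of the box in the same cell have `ℓ¹`-distance at most `k`. -/
def cell (d k : ℕ) (x : Site d) : Fin d → ℕ := fun j => ((x j + k) / ((k / d : ℕ) + 1)).toNat

/-- Cells are cubes with `⌊k/d⌋ + 1` sites per direction, so the `d` coordinate differences add up
to at most `k`. -/
lemma l1dist_le_of_cell_eq {k : ℕ} {x y : Site d} (hx : x ∈ box d k) (hy : y ∈ box d k)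
    (h : cell d k x = cell d k y) : l1dist x y ≤ k := by
  rw [mem_box] at hx hy
  have h1 : ∀ j, |(x j : ℝ) - y j| ≤ (k / d : ℕ) := by
    intro j
    have hj := congrFun h j
    simp only [cell] at hj
    have px : 0 ≤ (x j + k) / (((k / d : ℕ) : ℤ) + 1) :=
      Int.ediv_nonneg (by linarith [(hx j).1]) (by positivity)
    have py : 0 ≤ (y j + k) / (((k / d : ℕ) : ℤ) + 1) :=
      Int.ediv_nonneg (by linarith [(hy j).1]) (by positivity)
    have hj' : (x j + k) / (((k / d : ℕ) : ℤ) + 1) = (y j + k) / (((k / d : ℕ) : ℤ) + 1) := by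
      rw [← Int.toNat_of_nonneg px, ← Int.toNat_of_nonneg py]
      exact_mod_cast hj
    set l : ℤ := ((k / d : ℕ) : ℤ)
    have hl : 0 < l + 1 := by positivity
    have e1 := Int.emod_add_mul_ediv (x j + k) (l + 1)
    have e2 := Int.emod_add_mul_ediv (y j + k) (l + 1)
    have b1 := Int.emod_nonneg (x j + k) hl.ne'
    have b2 := Int.emod_lt_of_pos (x j + k) hl
    have b3 := Int.emod_nonneg (y j + k) hl.ne'
    have b4 := Int.emod_lt_of_pos (y j + k) hl
    rw [hj'] at e1
    have : |x j - y j| ≤ l := by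
      rw [abs_le]
      constructor <;> linarith
    have h2 : ((|x j - y j| : ℤ) : ℝ) ≤ ((l : ℤ) : ℝ) := by exact_mod_cast this
    rw [Int.cast_abs, Int.cast_sub] at h2
    exact h2
  calc l1dist x y ≤ ∑ _j : Fin d, ((k / d : ℕ) : ℝ) := Finset.sum_le_sum fun j _ => h1 j
    _ = ((d * (k / d) : ℕ) : ℝ) := by simp
    _ ≤ k := by exact_mod_cast Nat.mul_div_le k d

/-- The side of a cell exceeds `k/d`, so the number of cells is bounded independently of `k`. -/
lemma cell_mem {k : ℕ} {x : Site d} (hx : x ∈ box d k) :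
    cell d k x ∈ Fintype.piFinset fun _ : Fin d => Finset.range (2 * d + 1) := by
  rw [mem_box] at hx
  rw [Fintype.mem_piFinset]
  intro j
  rw [Finset.mem_range, cell]
  have hd : 0 < d := Fin.pos j
  have h1 : (x j + k) / (((k / d : ℕ) : ℤ) + 1) < 2 * d + 1 := by
    rw [Int.ediv_lt_iff_lt_mul (by positivity)]
    have h2 : (k : ℤ) < d * (((k / d : ℕ) : ℤ) + 1) := by
      exact_mod_cast Nat.lt_mul_div_succ k hd
    have h3 : (0 : ℤ) ≤ ((k / d : ℕ) : ℤ) := by positivity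
    have := (hx j).2
    nlinarith
  have px : 0 ≤ (x j + k) / (((k / d : ℕ) : ℤ) + 1) :=
    Int.ediv_nonneg (by linarith [(hx j).1]) (by positivity)
  omega

/-- Inverse powers of the distance are summable over the boxes, uniformly in the box. -/
lemma exists_dist_sum_bound (D : BoxMetrics d) : ∃ K : ℝ, 0 ≤ K ∧ ∀ k, ∀ x ∈ box d k,
    ∑ z ∈ box d k, ((1 + D.dist k x z) ^ (2 * d))⁻¹ ≤ K := by
  obtain ⟨K, hK0, hK⟩ := exists_l1_sum_bound d
  refine ⟨(2 * d + 1) ^ d * K, by positivity, fun k x hx => ?_⟩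
  classical
  rw [← Finset.sum_fiberwise_of_maps_to (fun z hz => cell_mem hz)]
  have hcell : ∀ c ∈ Fintype.piFinset fun _ : Fin d => Finset.range (2 * d + 1),
      ∑ z ∈ box d k with cell d k z = c, ((1 + D.dist k x z) ^ (2 * d))⁻¹ ≤ K := by
    intro c _
    rcases (Finset.filter (fun z => cell d k z = c) (box d k)).eq_empty_or_nonempty with he | hne
    · rw [he, Finset.sum_empty]
      exact hK0
    · obtain ⟨z₀, hz₀, hmin⟩ := Finset.exists_min_image _ (fun z => D.dist k x z) hne
      rw [Finset.mem_filter] at hz₀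
      calc ∑ z ∈ box d k with cell d k z = c, ((1 + D.dist k x z) ^ (2 * d))⁻¹
          ≤ ∑ z ∈ box d k with cell d k z = c, ((1 + l1dist z₀ z / 2) ^ (2 * d))⁻¹ := by
            refine Finset.sum_le_sum fun z hz => ?_
            have hle := hmin z hz
            rw [Finset.mem_filter] at hz
            have h1 : D.dist k z₀ z = l1dist z₀ z := D.eq_l1dist k z₀ hz₀.1 z hz.1
              (l1dist_le_of_cell_eq hz₀.1 hz.1 (hz₀.2.trans hz.2.symm))
            have h2 := D.triangle k z₀ hz₀.1 x hx z hz.1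
            rw [D.symm k z₀ hz₀.1 x hx, h1] at h2
            have h3 := l1dist_nonneg z₀ z
            refine inv_anti₀ (by positivity) (pow_le_pow_left₀ (by positivity) ?_ _)
            linarith
        _ ≤ ∑ z ∈ box d k, ((1 + l1dist z₀ z / 2) ^ (2 * d))⁻¹ :=
            Finset.sum_le_sum_of_subset_of_nonneg (Finset.filter_subset _ _) fun z _ _ => by
              have := l1dist_nonneg z₀ z
              positivity
        _ ≤ K := hK k z₀
  refine (Finset.sum_le_card_nsmul _ _ K hcell).trans (le_of_eq ?_)
  rw [Fintype.card_piFinset]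
  simp

end Lattice

/-! ### Interaction norms and moments -/

section Moments

variable {d r : ℕ}

/-- The diameter as a real number. -/
noncomputable def rdiam (δ : Site d → Site d → ℝ) (X : Finset (Site d)) : ℝ := (diam δ X).toReal

lemma diam_ne_top (δ : Site d → Site d → ℝ) (X : Finset (Site d)) : diam δ X ≠ ⊤ := by
  have h : diam δ X ≤ ∑ x ∈ X, ∑ y ∈ X, ENNReal.ofReal (δ x y) := by
    refine iSup₂_le fun x hx => iSup₂_le fun y hy => ?_
    refine le_trans ?_ (Finset.single_le_sum
      (f := fun x => ∑ y ∈ X, ENNReal.ofReal (δ x y)) (fun _ _ => zero_le) hx)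
    exact Finset.single_le_sum (f := fun y => ENNReal.ofReal (δ x y)) (fun _ _ => zero_le) hy
  refine ne_top_of_le_ne_top ?_ h
  simp [ENNReal.sum_eq_top]

lemma rdiam_nonneg (δ : Site d → Site d → ℝ) (X : Finset (Site d)) : 0 ≤ rdiam δ X :=
  ENNReal.toReal_nonneg

lemma le_rdiam (δ : Site d → Site d → ℝ) {X : Finset (Site d)} {x y : Site d} (hx : x ∈ X)
    (hy : y ∈ X) : δ x y ≤ rdiam δ X := by
  rw [rdiam, ← ENNReal.ofReal_le_iff_le_toReal (diam_ne_top δ X)]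
  exact le_trans (le_iSup₂ (f := fun y (_ : y ∈ X) => ENNReal.ofReal (δ x y)) y hy)
    (le_iSup₂ (f := fun x (_ : x ∈ X) => ⨆ y ∈ X, ENNReal.ofReal (δ x y)) x hx)

lemma rdiam_le {δ : Site d → Site d → ℝ} {X : Finset (Site d)} {c : ℝ} (hc : 0 ≤ c)
    (h : ∀ x ∈ X, ∀ y ∈ X, δ x y ≤ c) : rdiam δ X ≤ c := by
  refine ENNReal.toReal_le_of_le_ofReal hc ?_
  exact iSup₂_le fun x hx => iSup₂_le fun y hy => ENNReal.ofReal_le_ofReal (h x hx y hy)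

lemma rdiam_congr {δ δ' : Site d → Site d → ℝ} {X : Finset (Site d)}
    (h : ∀ x ∈ X, ∀ y ∈ X, δ x y = δ' x y) : rdiam δ X = rdiam δ' X := by
  unfold rdiam diam
  congr 1
  exact iSup_congr fun x => iSup_congr fun hx => iSup_congr fun y => iSup_congr fun hy => by
    rw [h x hx y hy]

lemma decayF_pos {ζ : ℝ → ℝ} (hζ : ∀ s, 0 ≤ s → 0 < ζ s) {s : ℝ} (hs : 0 ≤ s) :
    0 < decayF d ζ s := div_pos (hζ s hs) (by positivity)

lemma sum_diam_eq (δ : Site d → Site d → ℝ) (n : ℕ) (P : Finset (Finset (Site d)))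
    (φ : Finset (Site d) → Op d r) {F : ℝ} (hF : 0 < F) :
    ∑ X ∈ P, diam δ X ^ n * ‖φ X‖ₑ / ENNReal.ofReal F
      = ENNReal.ofReal ((∑ X ∈ P, rdiam δ X ^ n * ‖φ X‖) / F) := by
  rw [ENNReal.ofReal_div_of_pos hF, ENNReal.ofReal_sum_of_nonneg
    fun X _ => mul_nonneg (pow_nonneg (rdiam_nonneg δ X) n) (norm_nonneg _),
    div_eq_mul_inv, Finset.sum_mul]
  refine Finset.sum_congr rfl fun X _ => ?_
  rw [ENNReal.ofReal_mul (pow_nonneg (rdiam_nonneg δ X) n), ofReal_norm,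
    ENNReal.ofReal_pow (rdiam_nonneg δ X), rdiam, ENNReal.ofReal_toReal (diam_ne_top δ X),
    div_eq_mul_inv]

lemma volNorm_le_iff {δ : Site d → Site d → ℝ} {ζ : ℝ → ℝ} (hζ : ∀ s, 0 ≤ s → 0 < ζ s) {n : ℕ}
    {Λ : Finset (Site d)} (hδ : ∀ x ∈ Λ, ∀ y ∈ Λ, 0 ≤ δ x y) {φ : Finset (Site d) → Op d r}
    {C : ℝ} (hC : 0 ≤ C) :
    volNorm δ ζ n Λ φ ≤ ENNReal.ofReal C ↔ ∀ x ∈ Λ, ∀ y ∈ Λ,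
      ∑ X ∈ Λ.powerset with x ∈ X ∧ y ∈ X, rdiam δ X ^ n * ‖φ X‖ ≤ C * decayF d ζ (δ x y) := by
  simp only [volNorm, iSup_le_iff]
  refine forall₂_congr fun x hx => forall₂_congr fun y hy => ?_
  have hF := decayF_pos (d := d) hζ (hδ x hx y hy)
  rw [sum_diam_eq δ n _ φ hF, ENNReal.ofReal_le_ofReal_iff hC, div_le_iff₀ hF]

lemma iSup_interactionNorm_lt_top_iff {D : BoxMetrics d} {I : Set ℝ} {ζ : ℝ → ℝ}
    (hζ : ∀ s, 0 ≤ s → 0 < ζ s) {n : ℕ} {φ : ℝ → ℕ → Finset (Site d) → Op d r} :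
    ⨆ t ∈ I, interactionNorm D ζ n (φ t) < ⊤ ↔
      ∃ C : ℝ, 0 ≤ C ∧ ∀ t ∈ I, ∀ k, ∀ x ∈ box d k, ∀ y ∈ box d k,
        ∑ X ∈ (box d k).powerset with x ∈ X ∧ y ∈ X, rdiam (D.dist k) X ^ n * ‖φ t k X‖
          ≤ C * decayF d ζ (D.dist k x y) := by
  have key : ∀ C : ℝ, 0 ≤ C → (⨆ t ∈ I, interactionNorm D ζ n (φ t) ≤ ENNReal.ofReal C ↔
      ∀ t ∈ I, ∀ k, ∀ x ∈ box d k, ∀ y ∈ box d k,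
        ∑ X ∈ (box d k).powerset with x ∈ X ∧ y ∈ X, rdiam (D.dist k) X ^ n * ‖φ t k X‖
          ≤ C * decayF d ζ (D.dist k x y)) := by
    intro C hC
    simp only [iSup_le_iff, interactionNorm]
    exact forall₂_congr fun t _ => forall_congr' fun k =>
      volNorm_le_iff hζ (fun x hx y hy => D.dist_nonneg hx hy) hC
  constructor
  · intro h
    refine ⟨(⨆ t ∈ I, interactionNorm D ζ n (φ t)).toReal, ENNReal.toReal_nonneg,
      (key _ ENNReal.toReal_nonneg).1 ?_⟩
    rw [ENNReal.ofReal_toReal h.ne]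
  · rintro ⟨C, hC, h⟩
    exact ((key C hC).2 h).trans_lt ENNReal.ofReal_lt_top

/-- All moments of all time derivatives of the interaction are bounded uniformly in the site, the
box and the time. -/
def HasMoments (D : BoxMetrics d) (I : Set ℝ) (Φ : Interaction d r) : Prop :=
  ∀ i p : ℕ, ∃ C : ℝ, ∀ k, ∀ t ∈ I, ∀ x ∈ box d k,
    ∑ X ∈ (box d k).powerset with x ∈ X,
      (1 + rdiam (D.dist k) X) ^ p * ‖timeDeriv I i (Φ k) t X‖ ≤ C

/-- The zeroth moments of all time derivatives are bounded uniformly in the site, the box and the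
time. -/
def HasBoundedSums (I : Set ℝ) (Φ : Interaction d r) : Prop :=
  ∀ i : ℕ, ∃ C : ℝ, ∀ k, ∀ t ∈ I, ∀ x ∈ box d k,
    ∑ X ∈ (box d k).powerset with x ∈ X, ‖timeDeriv I i (Φ k) t X‖ ≤ C

lemma HasMoments.hasBoundedSums {D : BoxMetrics d} {I : Set ℝ} {Φ : Interaction d r}
    (h : HasMoments D I Φ) : HasBoundedSums I Φ := by
  intro i
  simpa only [pow_zero, one_mul] using h i 0

/-- Bulk convergence of the local terms, uniformly in time. -/
def BulkConverges (I : Set ℝ) (Φ : Interaction d r) (Ψ : ℝ → Finset (Site d) → Op d r) : Prop :=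
  ∀ X : Finset (Site d), X.Nonempty → ∀ ε > 0, ∀ᶠ k in atTop, ∀ t ∈ I, ‖Ψ t X - Φ k t X‖ ≤ ε

lemma one_add_pow_le {s : ℝ} (hs : 0 ≤ s) (p : ℕ) : (1 + s) ^ p ≤ 2 ^ p * (1 + s ^ p) := by
  rcases le_total s 1 with h | h
  · calc (1 + s) ^ p ≤ 2 ^ p := pow_le_pow_left₀ (by linarith) (by linarith) p
      _ ≤ _ := le_mul_of_one_le_right (by positivity) (by linarith [pow_nonneg hs p])
  · calc (1 + s) ^ p ≤ (2 * s) ^ p := pow_le_pow_left₀ (by linarith) (by linarith) p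
      _ = 2 ^ p * s ^ p := mul_pow _ _ _
      _ ≤ _ := mul_le_mul_of_nonneg_left (by linarith) (by positivity)

/-- The diagonal `x = y` of the norm is already a moment bound, whatever the decay function. -/
lemma exists_moment_bound {D : BoxMetrics d} {I : Set ℝ} {ζ : ℝ → ℝ} {n : ℕ} {Φ : Interaction d r}
    {ζs : ℕ → ℝ → ℝ} (h : Admissible D I ζ n Φ ζs) (i : ℕ) :
    ∃ C : ℝ, ∀ k, ∀ t ∈ I, ∀ x ∈ box d k, ∑ X ∈ (box d k).powerset with x ∈ X,
      rdiam (D.dist k) X ^ n * ‖timeDeriv I i (Φ k) t X‖ ≤ C := by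
  obtain ⟨C, -, hC⟩ := (iSup_interactionNorm_lt_top_iff (h.classS i).pos).1 (h.bounded i)
  refine ⟨C * decayF d (ζs i) 0, fun k t ht x hx => ?_⟩
  have := hC t ht k x hx x hx
  simpa only [and_self, D.dist_self hx] using this

lemma hasBoundedSums_of_admissible {D : BoxMetrics d} {I : Set ℝ} {ζ : ℝ → ℝ}
    {Φ : Interaction d r} {ζs : ℕ → ℝ → ℝ} (h : Admissible D I ζ 0 Φ ζs) :
    HasBoundedSums I Φ := by
  intro i
  simpa only [pow_zero, one_mul] using exists_moment_bound h i

lemma hasMoments_of_admissible {D : BoxMetrics d} {I : Set ℝ} {Φ : Interaction d r}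
    (h : ∀ n : ℕ, ∃ ζ ζs, Admissible D I ζ n Φ ζs) : HasMoments D I Φ := by
  intro i p
  obtain ⟨_, _, h0⟩ := h 0
  obtain ⟨_, _, hp⟩ := h p
  obtain ⟨C₀, hC₀⟩ := exists_moment_bound h0 i
  obtain ⟨C, hC⟩ := exists_moment_bound hp i
  refine ⟨2 ^ p * (C₀ + C), fun k t ht x hx => ?_⟩
  refine le_trans ?_ (mul_le_mul_of_nonneg_left (add_le_add (hC₀ k t ht x hx) (hC k t ht x hx))
    (by positivity))
  rw [← Finset.sum_add_distrib, Finset.mul_sum]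
  refine Finset.sum_le_sum fun X _ => ?_
  rw [pow_zero, ← add_mul, ← mul_assoc]
  exact mul_le_mul_of_nonneg_right (one_add_pow_le (rdiam_nonneg _ _) p) (norm_nonneg _)

lemma exists_pair_bound {D : BoxMetrics d} {I : Set ℝ} {ζ : ℝ → ℝ} {Φ : Interaction d r}
    {ζs : ℕ → ℝ → ℝ} (h : Admissible D I ζ 0 Φ ζs) :
    ∃ C : ℝ, 0 ≤ C ∧ ∀ k, ∀ t ∈ I, ∀ x ∈ box d k, ∀ y ∈ box d k,
      ∑ X ∈ (box d k).powerset with x ∈ X ∧ y ∈ X, ‖Φ k t X‖ ≤ C * ζ (D.dist k x y) := by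
  obtain ⟨C, h0, hC⟩ := (iSup_interactionNorm_lt_top_iff (h.classS 0).pos).1 (h.bounded 0)
  refine ⟨C, h0, fun k t ht x hx y hy => ?_⟩
  have h1 := hC t ht k x hx y hy
  have h2 := D.dist_nonneg hx hy
  simp only [pow_zero, one_mul, timeDeriv, iteratedDerivWithin_zero, h.zero] at h1
  refine h1.trans (mul_le_mul_of_nonneg_left ?_ h0)
  have h3 := (h.classS 0).pos _ h2
  rw [h.zero] at h3
  exact div_le_self h3.le (one_le_pow₀ (by linarith))

lemma exists_mem_box (X : Finset (Site d)) : ∃ M, ∀ k, M ≤ k → X ⊆ box d k := by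
  refine ⟨∑ x ∈ X, ∑ j, (x j).natAbs, fun k hk x hx => ?_⟩
  rw [mem_box]
  intro j
  have h1 : (x j).natAbs ≤ ∑ j, (x j).natAbs :=
    Finset.single_le_sum (f := fun j => (x j).natAbs) (fun _ _ => Nat.zero_le _)
      (Finset.mem_univ j)
  have h2 : ∑ j, (x j).natAbs ≤ ∑ x ∈ X, ∑ j, (x j).natAbs :=
    Finset.single_le_sum (f := fun x : Site d => ∑ j, (x j).natAbs) (fun _ _ => Nat.zero_le _) hx
  omega

/-- A single term is bounded by the sum at `x = y ∈ X`. This requires a site in `X`: the norms do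
not see the term of the empty set. -/
lemma bulkConverges_of_tendsto {I : Set ℝ} {ζ : ℝ → ℝ} (hζ : ∀ s, 0 ≤ s → 0 < ζ s)
    {Φ : Interaction d r} {Ψ : ℝ → Finset (Site d) → Op d r}
    (h : ∀ M : ℕ, Tendsto
      (fun k => ⨆ t ∈ I, bulkNorm ζ 0 M (timeDeriv I 0 (fun s X => Ψ s X - Φ k s X) t))
      atTop (𝓝 0)) : BulkConverges I Φ Ψ := by
  intro X hX ε hε
  obtain ⟨M, hM⟩ := exists_mem_box X
  obtain ⟨x, hx⟩ := hX
  have hXM := hM M le_rfl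
  have hF := decayF_pos (d := d) hζ (l1dist_nonneg x x)
  have h1 := ENNReal.tendsto_nhds_zero.1 (h M) (ENNReal.ofReal (ε / decayF d ζ (l1dist x x)))
    (ENNReal.ofReal_pos.2 (div_pos hε hF))
  filter_upwards [h1] with k hk t ht
  have h2 := (volNorm_le_iff hζ (fun x _ y _ => l1dist_nonneg x y) (div_pos hε hF).le).1
    ((le_iSup₂ (f := fun t (_ : t ∈ I) => bulkNorm ζ 0 M
      (timeDeriv I 0 (fun s X => Ψ s X - Φ k s X) t)) t ht).trans hk) x (hXM hx) x (hXM hx)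
  rw [div_mul_cancel₀ _ hF.ne'] at h2
  refine le_trans ?_ h2
  have h3 := Finset.single_le_sum (s := (box d M).powerset.filter fun X => x ∈ X ∧ x ∈ X)
    (f := fun X => rdiam l1dist X ^ 0 *
    ‖timeDeriv I 0 (fun s X => Ψ s X - Φ k s X) t X‖) (fun X _ => by positivity)
    (a := X) (by simp [hXM, hx])
  simpa [timeDeriv] using h3

/-- A set containing `x` and `y` has at least their distance as diameter, so higher moments become
decay in the distance. -/
lemma sum_pair_le_moment {D : BoxMetrics d} {φ : Finset (Site d) → Op d r} {k : ℕ} {x y : Site d}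
    (hx : x ∈ box d k) (hy : y ∈ box d k) (n p : ℕ) :
    (∑ X ∈ (box d k).powerset with x ∈ X ∧ y ∈ X, rdiam (D.dist k) X ^ n * ‖φ X‖)
        * (1 + D.dist k x y) ^ p
      ≤ ∑ X ∈ (box d k).powerset with x ∈ X, (1 + rdiam (D.dist k) X) ^ (n + p) * ‖φ X‖ := by
  rw [Finset.sum_mul]
  calc ∑ X ∈ (box d k).powerset with x ∈ X ∧ y ∈ X, rdiam (D.dist k) X ^ n * ‖φ X‖
        * (1 + D.dist k x y) ^ p
      ≤ ∑ X ∈ (box d k).powerset with x ∈ X ∧ y ∈ X,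
          (1 + rdiam (D.dist k) X) ^ (n + p) * ‖φ X‖ := by
        refine Finset.sum_le_sum fun X hX => ?_
        rw [Finset.mem_filter] at hX
        have h1 := le_rdiam (D.dist k) hX.2.1 hX.2.2
        have h2 := D.dist_nonneg hx hy
        have h3 := rdiam_nonneg (D.dist k) X
        calc rdiam (D.dist k) X ^ n * ‖φ X‖ * (1 + D.dist k x y) ^ p
            = rdiam (D.dist k) X ^ n * (1 + D.dist k x y) ^ p * ‖φ X‖ := by ring
          _ ≤ (1 + rdiam (D.dist k) X) ^ n * (1 + rdiam (D.dist k) X) ^ p * ‖φ X‖ := by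
              gcongr
              linarith
          _ = _ := by rw [pow_add]
    _ ≤ _ := by
        refine Finset.sum_le_sum_of_subset_of_nonneg (fun X hX => ?_) fun X _ _ => ?_
        · rw [Finset.mem_filter] at hX ⊢
          exact ⟨hX.1, hX.2.1⟩
        · have h3 := rdiam_nonneg (D.dist k) X
          positivity

/-- Bounded moments are the same as bounded norms for suitable decay functions of class `S`. -/
lemma exists_admissible {D D' : BoxMetrics d} {I : Set ℝ} {Φ Φ' : Interaction d r}
    (h : HasMoments D I Φ) (h' : HasMoments D' I Φ') (n : ℕ) :
    ∃ ζs : ℕ → ℝ → ℝ, Admissible D I (ζs 0) n Φ ζs ∧ Admissible D' I (ζs 0) n Φ' ζs := by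
  choose C hC using h
  choose C' hC' using h'
  -- One decay function is chosen for both interactions, because the limit has to lie in the space
  -- with the same `ζ`.
  choose ζs hS B hB0 hB using fun i => exists_classS d fun p => max (C i (n + p)) (C' i (n + p))
  refine ⟨ζs, ⟨rfl, hS, fun i => ?_⟩, ⟨rfl, hS, fun i => ?_⟩⟩
  · refine (iSup_interactionNorm_lt_top_iff (hS i).pos).2 ⟨B i, hB0 i, fun t ht k x hx y hy => ?_⟩
    exact hB i _ _ (D.dist_nonneg hx hy) fun p =>
      (sum_pair_le_moment hx hy n p).trans ((hC i (n + p) k t ht x hx).trans (le_max_left _ _))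
  · refine (iSup_interactionNorm_lt_top_iff (hS i).pos).2 ⟨B i, hB0 i, fun t ht k x hx y hy => ?_⟩
    exact hB i _ _ (D'.dist_nonneg hx hy) fun p =>
      (sum_pair_le_moment hx hy n p).trans ((hC' i (n + p) k t ht x hx).trans (le_max_right _ _))

/-- A fixed box has finitely many subsets and the decay function is bounded below on it, so termwise
convergence is enough for every power of the diameter. -/
lemma tendsto_bulkNorm {I : Set ℝ} {ζ : ℝ → ℝ} (hζ : ClassS ζ) (n M : ℕ)
    {φ : ℕ → ℝ → Finset (Site d) → Op d r}
    (h : ∀ X : Finset (Site d), X.Nonempty → ∀ ε > 0, ∀ᶠ k in atTop, ∀ t ∈ I, ‖φ k t X‖ ≤ ε) :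
    Tendsto (fun k => ⨆ t ∈ I, bulkNorm ζ n M (φ k t)) atTop (𝓝 0) := by
  rw [ENNReal.tendsto_nhds_zero]
  intro ε hε
  -- a lower bound for the decay function on the box
  set F := decayF d ζ (2 * d * M)
  have hF : 0 < F := decayF_pos hζ.pos (by positivity)
  have hFle : ∀ x ∈ box d M, ∀ y ∈ box d M, F ≤ decayF d ζ (l1dist x y) := by
    intro x hx y hy
    have h1 := l1dist_le_of_mem_box hx hy
    have h2 := l1dist_nonneg x y
    have h3 := hζ.antitone (Set.mem_Ici.2 h2) (Set.mem_Ici.2 (h2.trans h1)) h1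
    have h4 := (hζ.pos _ (h2.trans h1)).le
    exact div_le_div₀ (h4.trans h3) h3 (by positivity)
      (pow_le_pow_left₀ (by positivity) (by linarith) _)
  obtain ⟨ε', hε', hle⟩ : ∃ ε' : ℝ, 0 < ε' ∧ ENNReal.ofReal ε' ≤ ε := by
    rcases eq_or_ne ε ⊤ with rfl | ht
    · exact ⟨1, one_pos, le_top⟩
    · exact ⟨ε.toReal, ENNReal.toReal_pos hε.ne' ht, by rw [ENNReal.ofReal_toReal ht]⟩
  set S := ∑ X ∈ (box d M).powerset, rdiam l1dist X ^ n
  have hS : 0 ≤ S := Finset.sum_nonneg fun X _ => pow_nonneg (rdiam_nonneg _ _) n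
  have hη : 0 < ε' * F / (S + 1) := by positivity
  have hev : ∀ᶠ k in atTop, ∀ X ∈ (box d M).powerset, X.Nonempty → ∀ t ∈ I,
      ‖φ k t X‖ ≤ ε' * F / (S + 1) := by
    rw [eventually_all_finset]
    intro X _
    by_cases hX : X.Nonempty
    · exact (h X hX _ hη).mono fun k hk _ => hk
    · exact Eventually.of_forall fun k hne => absurd hne hX
  filter_upwards [hev] with k hk
  refine le_trans (iSup₂_le fun t ht => ?_) hle
  refine (volNorm_le_iff hζ.pos (fun x _ y _ => l1dist_nonneg x y) hε'.le).2
    fun x hx y hy => ?_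
  calc ∑ X ∈ (box d M).powerset with x ∈ X ∧ y ∈ X, rdiam l1dist X ^ n * ‖φ k t X‖
      ≤ ∑ X ∈ (box d M).powerset with x ∈ X ∧ y ∈ X,
          rdiam l1dist X ^ n * (ε' * F / (S + 1)) := by
        refine Finset.sum_le_sum fun X hX => ?_
        rw [Finset.mem_filter] at hX
        exact mul_le_mul_of_nonneg_left (hk X hX.1 ⟨x, hX.2.1⟩ t ht)
          (pow_nonneg (rdiam_nonneg _ _) n)
    _ ≤ S * (ε' * F / (S + 1)) := by
        rw [← Finset.sum_mul]
        refine mul_le_mul_of_nonneg_right ?_ hη.le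
        exact Finset.sum_le_sum_of_subset_of_nonneg (Finset.filter_subset _ _)
          fun X _ _ => pow_nonneg (rdiam_nonneg _ _) n
    _ ≤ ε' * F := by
        rw [mul_div_assoc', div_le_iff₀ (by positivity)]
        nlinarith [mul_pos hε' hF]
    _ ≤ _ := mul_le_mul_of_nonneg_left (hFle x hx y hy) hε'.le

/-- A criterion for membership in `L_{I,S,∞}` together with a thermodynamic limit. -/
lemma hasLimitLS_of_moments {D : BoxMetrics d} {I : Set ℝ} {A : OpFamily d r}
    {Φ : Interaction d r} {Ψ : ℝ → Finset (Site d) → Op d r} (hA : Represents I Φ A)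
    (hΦ : IsSmoothInteraction I Φ) (hm : HasMoments D I Φ)
    (hΨ : IsSmoothInteraction I (restrictToBoxes Ψ))
    (hm' : HasMoments (openMetrics d) I (restrictToBoxes Ψ))
    (hlim : ∀ i : ℕ, ∀ X : Finset (Site d), X.Nonempty → ∀ ε > 0, ∀ᶠ k in atTop, ∀ t ∈ I,
      ‖timeDeriv I i (fun s X => Ψ s X - Φ k s X) t X‖ ≤ ε) : HasLimitLS D I A := by
  refine ⟨Φ, hA, fun n => ?_⟩
  obtain ⟨ζs, h1, h2⟩ := exists_admissible hm hm' n
  exact ⟨ζs 0, h1.classS 0, hΦ, ζs, h1, Ψ, ⟨hΨ, ζs, h2⟩, fun i M =>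
    tendsto_bulkNorm (h1.classS i) n M (hlim i)⟩

lemma HasLimitLS.memLS {D : BoxMetrics d} {I : Set ℝ} {A : OpFamily d r}
    (h : HasLimitLS D I A) : MemLS D I A := by
  obtain ⟨Φ, hA, h⟩ := h
  refine ⟨Φ, hA, fun n => ?_⟩
  obtain ⟨ζ, hζ, hΦ, ζs, h1, -⟩ := h n
  exact ⟨ζ, hζ, hΦ, ζs, h1⟩

end Moments

/-! ### Kernel integrals -/

section KernelInt

/-- A closed subspace is complete, so an integrable function can be integrated inside it; the
integral of a non-integrable function is zero by convention. -/
lemma integral_mem_of_isClosed {E Ω : Type*} [NormedAddCommGroup E] [NormedSpace ℝ E]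
    [CompleteSpace E] [MeasurableSpace Ω] {μ : Measure Ω} (p : Submodule ℝ E)
    (hp : IsClosed (p : Set E)) {f : Ω → E} (hf : ∀ s, f s ∈ p) : ∫ s, f s ∂μ ∈ p := by
  by_cases hi : Integrable f μ
  · let _ : CompleteSpace p := hp.completeSpace_coe
    have hg : AEStronglyMeasurable (fun s => (⟨f s, hf s⟩ : p)) μ :=
      (Topology.IsEmbedding.subtypeVal.aestronglyMeasurable_comp_iff
        (f := fun s => (⟨f s, hf s⟩ : p))).1 hi.aestronglyMeasurable
    have hgi : Integrable (fun s => (⟨f s, hf s⟩ : p)) μ :=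
      hi.mono hg (Eventually.of_forall fun s => le_rfl)
    have := p.subtypeL.integral_comp_comm hgi
    have e : ∫ s, f s ∂μ = p.subtypeL (∫ s, (⟨f s, hf s⟩ : p) ∂μ) := this
    rw [e]
    exact Subtype.property _
  · rw [integral_undef hi]
    exact p.zero_mem

variable {𝔸 : Type*} [CStarAlgebra 𝔸]

lemma exp_mem_of_isClosed {S : StarSubalgebra ℂ 𝔸} (hS : IsClosed (S : Set 𝔸)) {A : 𝔸}
    (hA : A ∈ S) : NormedSpace.exp A ∈ S := by
  let _ : NormedAlgebra ℚ 𝔸 := NormedAlgebra.restrictScalars ℚ ℂ 𝔸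
  exact NormedSpace.exp_mem (s := S) hS hA

lemma propagator_mem {S : StarSubalgebra ℂ 𝔸} (hS : IsClosed (S : Set 𝔸)) {H : 𝔸} (hH : H ∈ S)
    (s : ℝ) : propagator H s ∈ S :=
  exp_mem_of_isClosed hS (S.toSubalgebra.smul_mem hH _)

lemma evolve_mem {S : StarSubalgebra ℂ 𝔸} (hS : IsClosed (S : Set 𝔸)) {H C : 𝔸} (hH : H ∈ S)
    (hC : C ∈ S) (s : ℝ) : evolve H s C ∈ S :=
  mul_mem (mul_mem (propagator_mem hS hH s) hC) (propagator_mem hS hH (-s))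

lemma kernelInt_mem_of_isClosed (K : ℝ → ℝ) {H C : 𝔸} (p : Submodule ℝ 𝔸)
    (hp : IsClosed (p : Set 𝔸)) (h : ∀ s, evolve H s C ∈ p) : kernelInt K H C ∈ p := by
  refine integral_mem_of_isClosed p hp fun s => p.smul_mem _ (p.smul_mem _ ?_)
  rw [intervalIntegral.integral_of_le zero_le_one]
  exact integral_mem_of_isClosed p hp fun u => h _

lemma kernelInt_mem (K : ℝ → ℝ) {S : StarSubalgebra ℂ 𝔸} (hS : IsClosed (S : Set 𝔸)) {H C : 𝔸}
    (hH : H ∈ S) (hC : C ∈ S) : kernelInt K H C ∈ S :=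
  kernelInt_mem_of_isClosed K (S.toSubalgebra.toSubmodule.restrictScalars ℝ) hS
    fun s => evolve_mem hS hH hC s

lemma isSelfAdjoint_kernelInt (K : ℝ → ℝ) {H C : 𝔸} (hH : IsSelfAdjoint H)
    (hC : IsSelfAdjoint C) : IsSelfAdjoint (kernelInt K H C) := by
  refine kernelInt_mem_of_isClosed K (selfAdjoint.submodule ℝ 𝔸) ?_
    fun s => isSelfAdjoint_evolve hH hC s
  exact isClosed_eq continuous_star continuous_id

lemma continuous_integral_evolve (H C : 𝔸) :
    Continuous fun s : ℝ => ∫ u in (0 : ℝ)..1, evolve H (u * s) C := by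
  refine intervalIntegral.continuous_parametric_intervalIntegral_of_continuous' ?_ 0 1
  exact (continuous_evolve H C).comp (continuous_snd.mul continuous_fst)

lemma norm_intervalIntegral_le {E : Type*} [NormedAddCommGroup E] [NormedSpace ℝ E] {f : ℝ → E}
    {b : ℝ} (h : ∀ u, |u| ≤ 1 → ‖f u‖ ≤ b) : ‖∫ u in (0 : ℝ)..1, f u‖ ≤ b := by
  have := intervalIntegral.norm_integral_le_of_norm_le_const (a := (0 : ℝ)) (b := 1) (f := f)
    (C := b) fun u hu => h u (by
      rw [Set.uIoc_of_le zero_le_one] at hu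
      rw [abs_of_pos hu.1]
      exact hu.2)
  simpa using this

/-- The moments of a kernel. -/
noncomputable def kernelMoment (K : ℝ → ℝ) (n : ℕ) : ℝ := ∫ s, |K s| * (1 + |s|) ^ n

lemma kernelMoment_nonneg (K : ℝ → ℝ) (n : ℕ) : 0 ≤ kernelMoment K n :=
  integral_nonneg fun s => by positivity

variable {K : ℝ → ℝ}

lemma integrable_abs_mul_pow (hK : ∀ n : ℕ, Integrable fun s => K s * (1 + |s|) ^ n) (n : ℕ) :
    Integrable fun s => |K s| * (1 + |s|) ^ n := by
  refine (hK n).norm.congr (Eventually.of_forall fun s => ?_)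
  simp only [norm_mul, Real.norm_eq_abs, norm_pow]
  rw [abs_of_nonneg (by positivity : 0 ≤ 1 + |s|)]

lemma integrable_kernelInt (hK : ∀ n : ℕ, Integrable fun s => K s * (1 + |s|) ^ n) {H : 𝔸}
    (hH : IsSelfAdjoint H) (C : 𝔸) :
    Integrable fun s => K s • (s • ∫ u in (0 : ℝ)..1, evolve H (u * s) C) := by
  have hK0 : AEStronglyMeasurable K := by
    have := (hK 0).aestronglyMeasurable
    simpa using this
  refine ((integrable_abs_mul_pow hK 1).mul_const ‖C‖).mono'
    (hK0.smul (continuous_id.smul (continuous_integral_evolve H C)).aestronglyMeasurable)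
    (Eventually.of_forall fun s => ?_)
  rw [norm_smul, norm_smul, Real.norm_eq_abs, Real.norm_eq_abs, mul_assoc, pow_one]
  refine mul_le_mul_of_nonneg_left (mul_le_mul (by linarith [abs_nonneg s]) ?_ (norm_nonneg _)
    (by positivity)) (abs_nonneg _)
  exact norm_intervalIntegral_le fun u _ => (norm_evolve hH _ C).le

lemma intervalIntegrable_evolve (H C : 𝔸) (s : ℝ) :
    IntervalIntegrable (fun u => evolve H (u * s) C) volume 0 1 :=
  ((continuous_evolve H C).comp (continuous_id.mul continuous_const)).intervalIntegrable 0 1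

lemma kernelInt_sum (hK : ∀ n : ℕ, Integrable fun s => K s * (1 + |s|) ^ n) {H : 𝔸}
    (hH : IsSelfAdjoint H) {ι : Type*} (P : Finset ι) (C : ι → 𝔸) :
    kernelInt K H (∑ i ∈ P, C i) = ∑ i ∈ P, kernelInt K H (C i) := by
  unfold kernelInt
  rw [← integral_finsetSum P fun i _ => integrable_kernelInt hK hH (C i)]
  refine integral_congr_ae (Eventually.of_forall fun s => ?_)
  simp only [evolve_sum]
  rw [intervalIntegral.integral_finsetSum fun i _ => intervalIntegrable_evolve H (C i) s,
    Finset.smul_sum, Finset.smul_sum]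

lemma kernelInt_add (hK : ∀ n : ℕ, Integrable fun s => K s * (1 + |s|) ^ n) {H : 𝔸}
    (hH : IsSelfAdjoint H) (C C' : 𝔸) :
    kernelInt K H (C + C') = kernelInt K H C + kernelInt K H C' := by
  simpa using kernelInt_sum hK hH Finset.univ ![C, C']

lemma evolve_real_smul (H : 𝔸) (s c : ℝ) (A : 𝔸) : evolve H s (c • A) = c • evolve H s A := by
  simp [evolve]

lemma kernelInt_smul (H : 𝔸) (c : ℝ) (C : 𝔸) : kernelInt K H (c • C) = c • kernelInt K H C := by
  unfold kernelInt
  rw [← integral_smul]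
  refine integral_congr_ae (Eventually.of_forall fun s => ?_)
  simp only [evolve_real_smul, intervalIntegral.integral_smul]
  rw [smul_comm s c, smul_comm (K s) c]

lemma norm_kernelInt_le (hK : ∀ n : ℕ, Integrable fun s => K s * (1 + |s|) ^ n) {H : 𝔸}
    (hH : IsSelfAdjoint H) (C : 𝔸) : ‖kernelInt K H C‖ ≤ kernelMoment K 1 * ‖C‖ := by
  rw [kernelMoment, ← integral_mul_const]
  refine norm_integral_le_of_norm_le ((integrable_abs_mul_pow hK 1).mul_const ‖C‖)
    (Eventually.of_forall fun s => ?_)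
  rw [norm_smul, norm_smul, Real.norm_eq_abs, Real.norm_eq_abs, mul_assoc, pow_one]
  refine mul_le_mul_of_nonneg_left (mul_le_mul (by linarith [abs_nonneg s]) ?_ (norm_nonneg _)
    (by positivity)) (abs_nonneg _)
  exact norm_intervalIntegral_le fun u _ => (norm_evolve hH _ C).le

/-- The additional power in the moment comes from the length `s` of the inner time integral. -/
lemma norm_kernelInt_sub_le (hK : ∀ n : ℕ, Integrable fun s => K s * (1 + |s|) ^ n) {H H' : 𝔸}
    (hH : IsSelfAdjoint H) (hH' : IsSelfAdjoint H') {C : 𝔸} {b : ℝ} (hb : 0 ≤ b) {p : ℕ}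
    (h : ∀ u, ‖evolve H u C - evolve H' u C‖ ≤ b * (1 + |u|) ^ p) :
    ‖kernelInt K H C - kernelInt K H' C‖ ≤ kernelMoment K (p + 1) * b := by
  unfold kernelInt
  rw [← integral_sub (integrable_kernelInt hK hH C) (integrable_kernelInt hK hH' C), kernelMoment,
    ← integral_mul_const]
  refine norm_integral_le_of_norm_le ((integrable_abs_mul_pow hK (p + 1)).mul_const b)
    (Eventually.of_forall fun s => ?_)
  rw [← smul_sub, ← smul_sub, ← intervalIntegral.integral_sub (intervalIntegrable_evolve H C s)
    (intervalIntegrable_evolve H' C s), norm_smul, norm_smul, Real.norm_eq_abs, Real.norm_eq_abs,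
    mul_assoc]
  refine mul_le_mul_of_nonneg_left ?_ (abs_nonneg _)
  rw [pow_succ', mul_assoc]
  refine mul_le_mul (by linarith [abs_nonneg s]) ?_ (norm_nonneg _) (by positivity)
  refine norm_intervalIntegral_le fun u hu => (h _).trans ?_
  rw [mul_comm]
  refine mul_le_mul_of_nonneg_right (pow_le_pow_left₀ (by positivity) ?_ p) hb
  rw [abs_mul]
  have := mul_le_of_le_one_left (abs_nonneg s) hu
  linarith

/-- A smoothing form of the inverse Liouvillian that depends on the commutator only. -/
lemma integral_evolve_eq_kernelInt (hK0 : Integrable K) (hodd : ∀ s, K (-s) = -K s) {H : 𝔸}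
    (hH : IsSelfAdjoint H) (B : 𝔸) :
    ∫ s, (K s : ℂ) • evolve H s B = kernelInt K H (Complex.I • (H * B - B * H)) := by
  -- Oddness makes the total mass vanish, so that `B` can be subtracted under the integral at no
  -- cost.
  have hz : ∫ s, K s = 0 := by
    have h1 : ∫ s, K (-s) = ∫ s, K s := integral_neg_eq_self K volume
    simp only [hodd, integral_neg] at h1
    linarith
  have hint : Integrable fun s => K s • evolve H s B := by
    refine (hK0.norm.mul_const ‖B‖).mono'
      (hK0.aestronglyMeasurable.smul (continuous_evolve H B).aestronglyMeasurable)
      (Eventually.of_forall fun s => ?_)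
    rw [norm_smul, norm_evolve hH]
  have hB : ∫ s, K s • B = 0 := by rw [integral_smul_const, hz, zero_smul]
  calc ∫ s, (K s : ℂ) • evolve H s B = ∫ s, K s • evolve H s B := by
        simp only [Complex.coe_smul]
    _ = ∫ s, (K s • evolve H s B - K s • B) := by
        rw [integral_sub hint (hK0.smul_const B), hB, sub_zero]
    _ = _ := by
        refine integral_congr_ae (Eventually.of_forall fun s => ?_)
        simp only
        rw [intervalIntegral.smul_integral_comp_mul_right
          (fun v => evolve H v (Complex.I • (H * B - B * H))), zero_mul, one_mul,
          intervalIntegral.integral_eq_sub_of_hasDerivAt (fun u _ => hasDerivAt_evolve H B u)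
            ((continuous_evolve _ _).intervalIntegrable _ _), evolve_zero, smul_sub]

lemma evolve_of_commute {H C : 𝔸} (h : Commute C H) (s : ℝ) : evolve H s C = C := by
  rw [evolve, ← (commute_propagator h s).eq, mul_assoc, propagator_mul_neg, mul_one]

/-- For the scalar part of the commutator: the evolution is trivial and only the first moment of the
kernel remains. -/
lemma kernelInt_of_commute {H C : 𝔸} (h : Commute C H) :
    kernelInt K H C = (∫ s, K s * s) • C := by
  simp only [kernelInt, evolve_of_commute h, intervalIntegral.integral_const, sub_zero, one_smul,
    smul_smul]
  rw [integral_smul_const]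

lemma propagator_add_of_commute {H H' : 𝔸} (h : Commute H H') (s : ℝ) :
    propagator (H + H') s = propagator H s * propagator H' s := by
  unfold propagator
  rw [smul_add, exp_add_of_commute' ((h.smul_left _).smul_right _)]

/-- A scalar in the Hamiltonian cancels between the two propagators. This removes the term of the
empty set, which bulk convergence does not control. -/
lemma evolve_algebraMap_add (c : ℂ) (H C : 𝔸) (s : ℝ) :
    evolve (algebraMap ℂ 𝔸 c + H) s C = evolve H s C := by
  have h1 : ∀ A : 𝔸, Commute (algebraMap ℂ 𝔸 c) A := fun A => Algebra.commutes c A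
  have h2 : ∀ (A : 𝔸) (s : ℝ), Commute A (propagator (algebraMap ℂ 𝔸 c) s) := fun A s =>
    commute_propagator (h1 A).symm s
  unfold evolve
  rw [add_comm, propagator_add_of_commute (h1 H).symm, propagator_add_of_commute (h1 H).symm,
    (h2 (propagator H (-s)) (-s)).eq, mul_assoc (propagator H s), ← (h2 C s).eq]
  calc propagator H s * (C * propagator (algebraMap ℂ 𝔸 c) s)
        * (propagator (algebraMap ℂ 𝔸 c) (-s) * propagator H (-s))
      = propagator H s * C * (propagator (algebraMap ℂ 𝔸 c) s
        * propagator (algebraMap ℂ 𝔸 c) (-s)) * propagator H (-s) := by noncomm_ring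
    _ = _ := by rw [propagator_mul_neg, mul_one]

lemma kernelInt_algebraMap_add (c : ℂ) (H C : 𝔸) :
    kernelInt K (algebraMap ℂ 𝔸 c + H) C = kernelInt K H C := by
  simp only [kernelInt, evolve_algebraMap_add]

/-! ### Moments of the admissible kernels -/

namespace IsKernel

variable {g g' : ℝ} {W : ℝ → ℝ}

lemma integrable_mul_pow (hW : IsKernel g g' W) (n : ℕ) :
    Integrable fun s => W s * (1 + |s|) ^ n := by
  obtain ⟨C₀, hC₀⟩ := hW.decay 0
  -- Two additional powers leave the integrable majorant `1 / (1 + s²)`.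
  obtain ⟨C, hC⟩ := hW.decay (n + 2)
  have hmeas : AEStronglyMeasurable (fun s => W s * (1 + |s|) ^ n) :=
    hW.integrable.aestronglyMeasurable.mul
      (by fun_prop : Continuous fun s : ℝ => (1 + |s|) ^ n).aestronglyMeasurable
  refine (integrable_inv_one_add_sq.const_mul (2 ^ (n + 2) * (C₀ + C))).mono' hmeas
    (Eventually.of_forall fun s => ?_)
  have h0 := abs_nonneg s
  have h1 := one_add_pow_le h0 (n + 2)
  have h2 : |W s| * (1 + |s|) ^ (n + 2) ≤ 2 ^ (n + 2) * (C₀ + C) := by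
    calc |W s| * (1 + |s|) ^ (n + 2) ≤ |W s| * (2 ^ (n + 2) * (1 + |s| ^ (n + 2))) :=
          mul_le_mul_of_nonneg_left h1 (abs_nonneg _)
      _ = 2 ^ (n + 2) * (|s| ^ 0 * |W s| + |s| ^ (n + 2) * |W s|) := by ring
      _ ≤ _ := mul_le_mul_of_nonneg_left (add_le_add (hC₀ s) (hC s)) (by positivity)
  rw [norm_mul, Real.norm_eq_abs, Real.norm_of_nonneg (by positivity), ← div_eq_mul_inv,
    le_div_iff₀ (by positivity)]
  refine le_trans ?_ h2
  rw [mul_assoc, pow_add]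
  refine mul_le_mul_of_nonneg_left (mul_le_mul_of_nonneg_left ?_ (by positivity)) (abs_nonneg _)
  nlinarith [sq_abs s]

end IsKernel

end KernelInt

/-! ### Localized inverse Liouvillians -/

section LocalPiece

variable {d r : ℕ} {𝔸 : Type*} [CStarAlgebra 𝔸]

/-- The sum of the local terms in `S`, up to the scalar term of the empty set. -/
noncomputable def localHam (h : Finset (Site d) → 𝔸) (S : Finset (Site d)) : 𝔸 :=
  ∑ Z ∈ S.powerset with Z.Nonempty, h Z

/-- The part of the local terms in `S` that is assigned to the site `y`. -/
noncomputable def localObs (c : Finset (Site d) → 𝔸) (y : Site d) (S : Finset (Site d)) :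
    𝔸 :=
  ∑ Z ∈ S.powerset with y ∈ Z, (Z.card : ℝ)⁻¹ • c Z

/-- The inverse Liouvillian of the part of the commutator assigned to `y`, computed in `S`. -/
noncomputable def localPiece (K : ℝ → ℝ) (h c : Finset (Site d) → 𝔸) (y : Site d)
    (S : Finset (Site d)) : 𝔸 :=
  kernelInt K (localHam h S) (localObs c y S)

variable {h c : Finset (Site d) → 𝔸} {S : Finset (Site d)} {K : ℝ → ℝ}

lemma isSelfAdjoint_real_smul (a : ℝ) {A : 𝔸} (hA : IsSelfAdjoint A) : IsSelfAdjoint (a • A) :=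
  (IsSelfAdjoint.all _).smul hA

variable {h₀ c₀ : Finset (Site d) → Op d r}

lemma isLocalTerm_localHam (hh : ∀ X ⊆ S, IsLocalTerm X (h₀ X)) : IsLocalTerm S (localHam h₀ S) := by
  rw [isLocalTerm_iff]
  refine ⟨sum_mem fun X hX => ?_, isSelfAdjoint_sum _ fun X hX => ?_⟩ <;>
    rw [Finset.mem_filter, Finset.mem_powerset] at hX
  · exact gaugeInvariant_mono hX.1 (isLocalTerm_iff.1 (hh X hX.1)).1
  · exact (hh X hX.1).2.2

lemma isLocalTerm_localObs (hc : ∀ X ⊆ S, IsLocalTerm X (c₀ X)) (y : Site d) :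
    IsLocalTerm S (localObs c₀ y S) := by
  rw [isLocalTerm_iff]
  refine ⟨sum_mem fun X hX => ?_, isSelfAdjoint_sum _ fun X hX => ?_⟩ <;>
    rw [Finset.mem_filter, Finset.mem_powerset] at hX
  · exact (gaugeInvariant (r := r) S).toSubalgebra.smul_mem
      (gaugeInvariant_mono hX.1 (isLocalTerm_iff.1 (hc X hX.1)).1) (((X.card : ℝ)⁻¹ : ℝ) : ℂ)
  · exact isSelfAdjoint_real_smul _ (hc X hX.1).2.2

lemma isLocalTerm_localPiece (K : ℝ → ℝ) (hh : ∀ X ⊆ S, IsLocalTerm X (h₀ X))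
    (hc : ∀ X ⊆ S, IsLocalTerm X (c₀ X)) (y : Site d) : IsLocalTerm S (localPiece K h₀ c₀ y S) := by
  have h1 := isLocalTerm_iff.1 (isLocalTerm_localHam hh)
  have h2 := isLocalTerm_iff.1 (isLocalTerm_localObs hc y)
  exact isLocalTerm_iff.2 ⟨kernelInt_mem K (isClosed_gaugeInvariant S) h1.1 h2.1,
    isSelfAdjoint_kernelInt K h1.2 h2.2⟩

lemma localHam_congr {h' : Finset (Site d) → 𝔸} (e : ∀ X ⊆ S, h X = h' X) :
    localHam h S = localHam h' S :=
  Finset.sum_congr rfl fun X hX => e X (by simpa using (Finset.mem_filter.1 hX).1)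

lemma localObs_congr {c' : Finset (Site d) → 𝔸} (e : ∀ X ⊆ S, c X = c' X) (y : Site d) :
    localObs c y S = localObs c' y S :=
  Finset.sum_congr rfl fun X hX => by rw [e X (by simpa using (Finset.mem_filter.1 hX).1)]

lemma localPiece_congr {h' c' : Finset (Site d) → 𝔸} (eh : ∀ X ⊆ S, h X = h' X)
    (ec : ∀ X ⊆ S, c X = c' X) (y : Site d) : localPiece K h c y S = localPiece K h' c' y S := by
  rw [localPiece, localHam_congr eh, localObs_congr ec, localPiece]

lemma localPiece_of_notMem {y : Site d} (hy : y ∉ S) : localPiece K h c y S = 0 := by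
  have : localObs c y S = 0 := by
    refine Finset.sum_eq_zero fun X hX => ?_
    rw [Finset.mem_filter, Finset.mem_powerset] at hX
    exact absurd (hX.1 hX.2) hy
  have e : ∀ s, evolve (localHam h S) s (0 : 𝔸) = 0 := fun s => by simp [evolve]
  simp only [localPiece, this, kernelInt, e, intervalIntegral.integral_zero, smul_zero,
    integral_zero]

lemma sum_eq_add_localHam : ∑ X ∈ S.powerset, h X = h ∅ + localHam h S := by
  rw [localHam, ← Finset.sum_filter_add_sum_filter_not S.powerset (fun Z => Z.Nonempty), add_comm]
  congr 1
  rw [Finset.sum_eq_single ∅]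
  · intro X hX hne
    rw [Finset.mem_filter] at hX
    exact absurd (Finset.nonempty_iff_ne_empty.2 hne) hX.2
  · intro hX
    simp at hX

lemma sum_powerset_mem (S : Finset (Site d)) {M : Type*} [AddCommMonoid M]
    (f : Finset (Site d) → M) :
    ∑ y ∈ S, ∑ Z ∈ S.powerset with y ∈ Z, f Z = ∑ Z ∈ S.powerset with Z.Nonempty, Z.card • f Z := by
  rw [Finset.sum_comm' (t' := S.powerset.filter fun Z => Z.Nonempty) (s' := fun Z => Z)]
  · exact Finset.sum_congr rfl fun Z _ => by rw [Finset.sum_const]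
  · intro y Z
    simp only [Finset.mem_filter, Finset.mem_powerset]
    constructor
    · rintro ⟨h1, h2, h3⟩
      exact ⟨h3, h2, ⟨y, h3⟩⟩
    · rintro ⟨h1, h2, -⟩
      exact ⟨h2 h1, h2, h1⟩

/-- Every nonempty set is met once for each of its sites, which the weight `1 / |Z|` compensates. -/
lemma sum_localObs : ∑ y ∈ S, localObs c y S = localHam c S := by
  unfold localObs localHam
  rw [sum_powerset_mem]
  refine Finset.sum_congr rfl fun Z hZ => ?_
  rw [Finset.mem_filter] at hZ
  have : (Z.card : ℝ) ≠ 0 := by exact_mod_cast (Finset.card_pos.2 hZ.2).ne'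
  rw [← Nat.cast_smul_eq_nsmul ℝ, smul_smul, mul_inv_cancel₀ this, one_smul]

lemma sum_nonempty_le (S : Finset (Site d)) {f : Finset (Site d) → ℝ} (hf : ∀ X, 0 ≤ f X) :
    ∑ Z ∈ S.powerset with Z.Nonempty, f Z ≤ ∑ y ∈ S, ∑ Z ∈ S.powerset with y ∈ Z, f Z := by
  rw [sum_powerset_mem]
  refine Finset.sum_le_sum fun Z hZ => ?_
  rw [Finset.mem_filter] at hZ
  have : (1 : ℝ) ≤ Z.card := by exact_mod_cast Finset.card_pos.2 hZ.2
  rw [nsmul_eq_mul]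
  exact le_mul_of_one_le_left (hf Z) this

lemma heisenberg_eq_evolve (H : Op d r) (s : ℝ) (A : Op d r) :
    heisenberg H s A = evolve H s A := by
  simp [heisenberg, evolve, propagator]

/-- The inverse Liouvillian as a sum of contributions of the sites. -/
lemma kernelInt_eq_sum_localPiece (hK : ∀ n : ℕ, Integrable fun s => K s * (1 + |s|) ^ n)
    (hh : ∀ X ⊆ S, IsSelfAdjoint (h X)) {cH cC : ℂ} (eH : h ∅ = algebraMap ℂ 𝔸 cH)
    (eC : c ∅ = algebraMap ℂ 𝔸 cC) :
    kernelInt K (∑ X ∈ S.powerset, h X) (∑ X ∈ S.powerset, c X)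
      = (∫ s, K s * s) • c ∅ + ∑ y ∈ S, localPiece K h c y S := by
  have hsa : IsSelfAdjoint (localHam h S) := isSelfAdjoint_sum _ fun X hX =>
    hh X (Finset.mem_powerset.1 (Finset.mem_filter.1 hX).1)
  have hcomm : Commute (c ∅) (localHam h S) := by
    rw [eC]
    exact Algebra.commutes cC _
  rw [sum_eq_add_localHam, sum_eq_add_localHam, eH, kernelInt_algebraMap_add, kernelInt_add hK hsa,
    kernelInt_of_commute hcomm, ← sum_localObs (c := c), kernelInt_sum hK hsa]
  rfl

lemma invLiouvillian_eq {g g' : ℝ} {W : ℝ → ℝ} (hW : IsKernel g g' W) {H B : OpFamily d r} {k : ℕ}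
    {t : ℝ} {h₀ c₀ : Finset (Site d) → Op d r} (hh : ∀ X ⊆ box d k, IsLocalTerm X (h₀ X))
    (hc : ∀ X ⊆ box d k, IsLocalTerm X (c₀ X))
    (eH : H k t = ∑ X ∈ (box d k).powerset, h₀ X)
    (eC : iCommutator H B k t = ∑ X ∈ (box d k).powerset, c₀ X) :
    invLiouvillian W H B k t
      = (∫ s, W s * s) • c₀ ∅ + ∑ y ∈ box d k, localPiece W h₀ c₀ y (box d k) := by
  have hsa : IsSelfAdjoint (H k t) := by
    rw [eH]
    exact isSelfAdjoint_sum _ fun X hX => (hh X (Finset.mem_powerset.1 hX)).2.2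
  have h1 : invLiouvillian W H B k t = kernelInt W (H k t) (iCommutator H B k t) := by
    refine Eq.trans ?_ (integral_evolve_eq_kernelInt hW.integrable hW.odd hsa (B k t))
    simp only [invLiouvillian, heisenberg_eq_evolve]
    rfl
  obtain ⟨cH, hcH⟩ := exists_scalar_of_mem_gaugeInvariant_empty
    (isLocalTerm_iff.1 (hh ∅ (Finset.empty_subset _))).1
  obtain ⟨cC, hcC⟩ := exists_scalar_of_mem_gaugeInvariant_empty
    (isLocalTerm_iff.1 (hc ∅ (Finset.empty_subset _))).1
  rw [h1, eC, eH]
  exact kernelInt_eq_sum_localPiece hW.integrable_mul_pow (fun X hX => (hh X hX).2.2) hcH hcC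

end LocalPiece

/-! ### Quasi-locality of the localized inverse Liouvillians -/

section Decay

variable {d : ℕ} {𝔸 : Type*} [CStarAlgebra 𝔸]

/-- After exchanging sums the terms containing `z` and `x` decay like `exp(-a d(z, x))`. Half of
this rate pays for moving the weight from `x` to `z`, the other half makes the sum over `x` converge
uniformly in the box. -/
lemma exists_weight_bound (D : BoxMetrics d) {a : ℝ} (ha : 0 < a) {A : ℝ} (hA : 0 ≤ A) :
    ∃ κ : ℝ, 0 ≤ κ ∧ ∀ k, ∀ y ∈ box d k, ∀ h : Finset (Site d) → 𝔸,
      (∀ x ∈ box d k, ∀ z ∈ box d k, ∑ X ∈ (box d k).powerset with x ∈ X ∧ z ∈ X, ‖h X‖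
        ≤ A * Real.exp (-a * D.dist k x z)) →
      ∀ z, ∑ Y ∈ (box d k).powerset with z ∈ Y,
          ‖h Y‖ * ∑ x ∈ Y, Real.exp (a / 2 * D.dist k y x)
        ≤ κ * Real.exp (a / 2 * D.dist k y z) := by
  obtain ⟨C, hC0, hC⟩ := exists_pow_le_exp (half_pos ha) (2 * d)
  obtain ⟨L, hL0, hL⟩ := exists_dist_sum_bound D
  refine ⟨A * C * L, by positivity, fun k y hy h hh z => ?_⟩
  by_cases hz : z ∈ box d k
  · calc ∑ Y ∈ (box d k).powerset with z ∈ Y, ‖h Y‖ * ∑ x ∈ Y, Real.exp (a / 2 * D.dist k y x)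
        = ∑ x ∈ box d k, ∑ Y ∈ (box d k).powerset with z ∈ Y ∧ x ∈ Y,
            ‖h Y‖ * Real.exp (a / 2 * D.dist k y x) := by
          simp only [Finset.mul_sum]
          refine Finset.sum_comm' fun Y x => ?_
          simp only [Finset.mem_filter, Finset.mem_powerset]
          constructor
          · rintro ⟨⟨h1, h2⟩, h3⟩
            exact ⟨⟨h1, h2, h3⟩, h1 h3⟩
          · rintro ⟨⟨h1, h2, h3⟩, -⟩
            exact ⟨⟨h1, h2⟩, h3⟩
      _ ≤ ∑ x ∈ box d k, A * C * ((1 + D.dist k z x) ^ (2 * d))⁻¹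
            * Real.exp (a / 2 * D.dist k y z) := by
          refine Finset.sum_le_sum fun x hx => ?_
          rw [← Finset.sum_mul]
          have h1 := hh z hz x hx
          have h2 := D.triangle k y hy z hz x hx
          have h3 := D.dist_nonneg hz hx
          have h4 := hC _ h3
          have e1 : Real.exp (a / 2 * D.dist k y x)
              ≤ Real.exp (a / 2 * D.dist k z x) * Real.exp (a / 2 * D.dist k y z) := by
            rw [← Real.exp_add, Real.exp_le_exp]
            nlinarith
          have e2 : Real.exp (-a * D.dist k z x) * Real.exp (a / 2 * D.dist k z x)
              ≤ C * ((1 + D.dist k z x) ^ (2 * d))⁻¹ := by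
            rw [← Real.exp_add, ← div_eq_mul_inv, le_div_iff₀ (by positivity)]
            refine (mul_le_mul_of_nonneg_left h4 (Real.exp_pos _).le).trans (le_of_eq ?_)
            rw [mul_left_comm, ← Real.exp_add]
            ring_nf
            simp
          calc (∑ X ∈ (box d k).powerset with z ∈ X ∧ x ∈ X, ‖h X‖)
                * Real.exp (a / 2 * D.dist k y x)
              ≤ (A * Real.exp (-a * D.dist k z x)) * (Real.exp (a / 2 * D.dist k z x)
                * Real.exp (a / 2 * D.dist k y z)) :=
                mul_le_mul h1 e1 (Real.exp_pos _).le (by positivity)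
            _ = A * (Real.exp (-a * D.dist k z x) * Real.exp (a / 2 * D.dist k z x))
                * Real.exp (a / 2 * D.dist k y z) := by ring
            _ ≤ A * (C * ((1 + D.dist k z x) ^ (2 * d))⁻¹) * Real.exp (a / 2 * D.dist k y z) := by
                gcongr
            _ = _ := by ring
      _ ≤ _ := by
          rw [← Finset.sum_mul, ← Finset.mul_sum]
          exact mul_le_mul_of_nonneg_right (mul_le_mul_of_nonneg_left (hL k z hz) (by positivity))
            (Real.exp_pos _).le
  · rw [Finset.filter_eq_empty_iff.2, Finset.sum_empty]
    · positivity
    · intro Y hY hzY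
      exact hz (Finset.mem_powerset.1 hY hzY)

/-- The change of a localized inverse Liouvillian when far away sites are removed. -/
theorem exists_localPiece_decay (D : BoxMetrics d) {K : ℝ → ℝ}
    (hK : ∀ n : ℕ, Integrable fun s => K s * (1 + |s|) ^ n) {a : ℝ} (ha : 0 < a) {A : ℝ}
    (hA : 0 ≤ A) (M : ℝ) (p : ℕ) :
    ∃ C : ℝ, ∀ k, ∀ y ∈ box d k, ∀ S' S : Finset (Site d), S' ⊆ S → S ⊆ box d k →
      ∀ m : ℝ, 0 ≤ m → (∀ z ∈ S, z ∉ S' → m < D.dist k y z + 1) →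
      ∀ h c : Finset (Site d) → 𝔸, (∀ X ⊆ box d k, IsSelfAdjoint (h X)) →
      (∀ X ⊆ box d k, ∀ Y ⊆ box d k, Disjoint X Y → Commute (h X) (h Y)) →
      (∀ X ⊆ box d k, ∀ Y ⊆ box d k, Disjoint X Y → Commute (h X) (c Y)) →
      (∀ x ∈ box d k, ∀ z ∈ box d k, ∑ X ∈ (box d k).powerset with x ∈ X ∧ z ∈ X, ‖h X‖
        ≤ A * Real.exp (-a * D.dist k x z)) →
      (∑ X ∈ (box d k).powerset with y ∈ X, (1 + rdiam (D.dist k) X) ^ p * ‖c X‖ ≤ M) →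
      ‖localPiece K h c y S - localPiece K h c y S'‖ * (1 + m) ^ p ≤ C := by
  obtain ⟨κ, hκ0, hκ⟩ := exists_weight_bound (𝔸 := 𝔸) D ha hA
  obtain ⟨C₁, hC₁, hlc⟩ := exists_lightCone_bound (half_pos ha) (by positivity : 0 ≤ 4 * κ) p
  -- The first part is for terms of the commutator inside `S'`, for which only the dynamics changes;
  -- the second is for terms that reach outside `S'` and are lost.
  set C₂ := kernelMoment K (p + 1) * C₁ + kernelMoment K 1 * 2 ^ p
  have hC₂ : 0 ≤ C₂ := by
    have h1 := kernelMoment_nonneg K (p + 1)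
    have h2 := kernelMoment_nonneg K 1
    positivity
  refine ⟨C₂ * M, fun k y hy S' S hSS hS m hm hfar h c hsa hcomm hcomm' hpair hmom => ?_⟩
  have hsub : ∀ {T X : Finset (Site d)}, T ⊆ box d k → X ∈ T.powerset → X ⊆ box d k :=
    fun hT hX => (Finset.mem_powerset.1 hX).trans hT
  have hHS : ∀ T ⊆ box d k, IsSelfAdjoint (localHam h T) := fun T hT =>
    isSelfAdjoint_sum _ fun X hX => hsa X (hsub hT (Finset.mem_filter.1 hX).1)
  have hS' : S' ⊆ box d k := hSS.trans hS
  -- the terms in the smaller set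
  have hnear : ∀ X ⊆ S', y ∈ X → ‖kernelInt K (localHam h S) (c X) - kernelInt K (localHam h S')
      (c X)‖ * (1 + m) ^ p
        ≤ kernelMoment K (p + 1) * C₁ * X.card * ((1 + rdiam (D.dist k) X) ^ p * ‖c X‖) := by
    intro X hX hyX
    set ρ := rdiam (D.dist k) X
    have hρ : 0 ≤ ρ := rdiam_nonneg _ _
    have hXb : X ⊆ box d k := hX.trans hS'
    have hcard : (1 : ℝ) ≤ X.card := by exact_mod_cast Finset.card_pos.2 ⟨y, hyX⟩
    have hev : ∀ u, ‖evolve (localHam h S) u (c X) - evolve (localHam h S') u (c X)‖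
        * (1 + m) ^ p ≤ C₁ * (‖c X‖ * X.card) * ((1 + |u|) * (1 + ρ)) ^ p := by
      intro u
      refine hlc _ _ _ _ _ (abs_nonneg u) hρ hm (by positivity) ?_ ?_
      · calc ‖evolve (localHam h S) u (c X) - evolve (localHam h S') u (c X)‖
            ≤ ‖c X‖ + ‖c X‖ := by
              refine (norm_sub_le _ _).trans (le_of_eq ?_)
              rw [norm_evolve (hHS S hS), norm_evolve (hHS S' hS')]
          _ = 2 * (‖c X‖ * 1) := by ring
          _ ≤ _ := by gcongr
      · have hw := evolve_sub_evolve_le_of_weight (P := S.powerset.filter fun Z => Z.Nonempty)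
          (P' := S'.powerset.filter fun Z => Z.Nonempty)
          (Finset.filter_subset_filter _ (Finset.powerset_mono.2 hSS)) (h := h)
          (fun Y hY => hsa Y (hsub hS (Finset.mem_filter.1 hY).1))
          (fun Y hY Y' hY' => hcomm Y (hsub hS (Finset.mem_filter.1 hY).1) Y'
            (hsub hS (Finset.mem_filter.1 hY').1))
          (X := X) (O := c X) (fun Y hY => hcomm' Y (hsub hS (Finset.mem_filter.1 hY).1) X hXb)
          (wt := fun x => Real.exp (a / 2 * D.dist k y x)) (fun x => (Real.exp_pos _).le) hκ0
          (fun z => (Finset.sum_le_sum_of_subset_of_nonneg (fun Y hY => by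
            rw [Finset.mem_filter, Finset.mem_filter] at hY
            rw [Finset.mem_filter, Finset.mem_powerset]
            exact ⟨hsub hS hY.1.1, hY.2⟩) fun Y _ _ =>
              mul_nonneg (norm_nonneg _) (Finset.sum_nonneg fun x _ => (Real.exp_pos _).le)).trans
            (hκ k y hy h hpair z))
          -- A term of the Hamiltonian that is not contained in `S'` has a site at distance more
          -- than `m - 1` from `y`, and this site alone gives the weight.
          (b := Real.exp (a / 2 * (m - 1))) (fun Y hY hY' => by
            rw [Finset.mem_filter, Finset.mem_powerset] at hY hY'
            have hns : ¬ Y ⊆ S' := fun hs => hY' ⟨hs, hY.2⟩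
            obtain ⟨z, hzY, hzS'⟩ := Finset.not_subset.1 hns
            refine le_trans ?_ (Finset.single_le_sum
              (f := fun x => Real.exp (a / 2 * D.dist k y x))
              (fun x _ => (Real.exp_pos _).le) hzY)
            rw [Real.exp_le_exp]
            have := hfar z (hY.1 hzY) hzS'
            nlinarith) (Real.exp_pos _) u
        refine hw.trans ?_
        have hWX : ∑ x ∈ X, Real.exp (a / 2 * D.dist k y x) ≤ X.card * Real.exp (a / 2 * ρ) := by
          rw [← nsmul_eq_mul]
          refine Finset.sum_le_card_nsmul _ _ _ fun x hx => ?_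
          rw [Real.exp_le_exp]
          exact mul_le_mul_of_nonneg_left (le_rdiam _ hyX hx) (by positivity)
        -- The linear prefactor in time is absorbed into the exponential, at the price of doubling
        -- its rate.
        have h2 : 2 * κ * |u| ≤ Real.exp (2 * κ * |u|) := by
          linarith [Real.add_one_le_exp (2 * κ * |u|)]
        rw [div_le_iff₀ (Real.exp_pos _)]
        calc |u| * (2 * κ * ‖c X‖ * (∑ x ∈ X, Real.exp (a / 2 * D.dist k y x))
              * Real.exp (2 * κ * |u|))
            = (2 * κ * |u|) * ‖c X‖ * (∑ x ∈ X, Real.exp (a / 2 * D.dist k y x))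
              * Real.exp (2 * κ * |u|) := by ring
          _ ≤ Real.exp (2 * κ * |u|) * ‖c X‖ * (X.card * Real.exp (a / 2 * ρ))
              * Real.exp (2 * κ * |u|) := by gcongr
          _ = ‖c X‖ * X.card * (Real.exp (2 * κ * |u|) * Real.exp (a / 2 * ρ)
              * Real.exp (2 * κ * |u|)) := by ring
          _ = ‖c X‖ * X.card * (Real.exp (4 * κ * |u| + a / 2 * ρ - a / 2 * m + a / 2)
              * Real.exp (a / 2 * (m - 1))) := by
              rw [← Real.exp_add, ← Real.exp_add, ← Real.exp_add]
              congr 2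
              ring
          _ = _ := by ring
    have hmp : 0 < (1 + m) ^ p := by positivity
    have hsub' := norm_kernelInt_sub_le hK (hHS S hS) (hHS S' hS') (C := c X)
      (b := C₁ * (‖c X‖ * X.card) * (1 + ρ) ^ p / (1 + m) ^ p) (by positivity) (p := p)
      (fun u => by
        rw [div_mul_eq_mul_div, le_div_iff₀ hmp]
        refine (hev u).trans (le_of_eq ?_)
        rw [mul_pow]
        ring)
    rw [mul_div_assoc', le_div_iff₀ hmp] at hsub'
    refine hsub'.trans (le_of_eq ?_)
    ring
  -- the remaining terms
  have hrest : ∀ X ⊆ S, y ∈ X → ¬ X ⊆ S' → ‖kernelInt K (localHam h S) (c X)‖ * (1 + m) ^ p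
      ≤ kernelMoment K 1 * 2 ^ p * ((1 + rdiam (D.dist k) X) ^ p * ‖c X‖) := by
    intro X hX hyX hns
    obtain ⟨z, hzX, hzS'⟩ := Finset.not_subset.1 hns
    have h1 := hfar z (hX hzX) hzS'
    have h2 := le_rdiam (D.dist k) hyX hzX
    have h3 := rdiam_nonneg (D.dist k) X
    have h4 := kernelMoment_nonneg K 1
    calc ‖kernelInt K (localHam h S) (c X)‖ * (1 + m) ^ p
        ≤ (kernelMoment K 1 * ‖c X‖) * (2 * (1 + rdiam (D.dist k) X)) ^ p :=
          mul_le_mul (norm_kernelInt_le hK (hHS S hS) _)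
            (pow_le_pow_left₀ (by positivity) (by linarith) p) (by positivity) (by positivity)
      _ = _ := by
          rw [mul_pow]
          ring
  have hterm : ∀ X ∈ S.powerset.filter fun X => y ∈ X,
      ‖(X.card : ℝ)⁻¹ • kernelInt K (localHam h S) (c X)
        - (if X ⊆ S' then (X.card : ℝ)⁻¹ • kernelInt K (localHam h S') (c X) else 0)‖
        * (1 + m) ^ p ≤ C₂ * ((1 + rdiam (D.dist k) X) ^ p * ‖c X‖) := by
    intro X hX
    rw [Finset.mem_filter, Finset.mem_powerset] at hX
    have hcard : (1 : ℝ) ≤ X.card := by exact_mod_cast Finset.card_pos.2 ⟨y, hX.2⟩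
    have hρ := rdiam_nonneg (D.dist k) X
    have k1 := kernelMoment_nonneg K (p + 1)
    have k2 := kernelMoment_nonneg K 1
    have hq : 0 ≤ (1 + rdiam (D.dist k) X) ^ p * ‖c X‖ := by positivity
    split_ifs with hXS
    -- The factor `|X|` from summing the weights over the support is cancelled by the share `1 /
    -- |X|` of the site.
    · rw [← smul_sub, norm_smul, norm_inv, Real.norm_natCast, mul_assoc,
        inv_mul_le_iff₀ (by linarith)]
      refine (hnear X hXS hX.2).trans ?_
      calc kernelMoment K (p + 1) * C₁ * X.card * ((1 + rdiam (D.dist k) X) ^ p * ‖c X‖)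
          = X.card * (kernelMoment K (p + 1) * C₁ * ((1 + rdiam (D.dist k) X) ^ p * ‖c X‖)) := by
            ring
        _ ≤ _ := by
            refine mul_le_mul_of_nonneg_left (mul_le_mul_of_nonneg_right ?_ hq) (by linarith)
            simp only [C₂]
            have : 0 ≤ kernelMoment K 1 * 2 ^ p := by positivity
            linarith
    · rw [sub_zero, norm_smul, norm_inv, Real.norm_natCast, mul_assoc]
      refine (mul_le_of_le_one_left (by positivity) (inv_le_one_of_one_le₀ hcard)).trans ?_
      refine (hrest X hX.1 hX.2 hXS).trans (mul_le_mul_of_nonneg_right ?_ hq)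
      simp only [C₂]
      have : 0 ≤ kernelMoment K (p + 1) * C₁ := by positivity
      linarith
  have hexp : ∀ T ⊆ box d k, localPiece K h c y T
      = ∑ X ∈ T.powerset with y ∈ X, (X.card : ℝ)⁻¹ • kernelInt K (localHam h T) (c X) := by
    intro T hT
    rw [localPiece, localObs, kernelInt_sum hK (hHS T hT)]
    exact Finset.sum_congr rfl fun X _ => kernelInt_smul _ _ _
  have hfil : (S'.powerset.filter fun X => y ∈ X)
      = (S.powerset.filter fun X => y ∈ X).filter fun X => X ⊆ S' := by
    ext X
    simp only [Finset.mem_filter, Finset.mem_powerset]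
    exact ⟨fun hX => ⟨⟨hX.1.trans hSS, hX.2⟩, hX.1⟩, fun hX => ⟨hX.2, hX.1.2⟩⟩
  rw [hexp S hS, hexp S' hS', hfil, Finset.sum_filter (fun X => X ⊆ S'),
    ← Finset.sum_sub_distrib]
  calc _ ≤ (∑ X ∈ S.powerset with y ∈ X, ‖(X.card : ℝ)⁻¹ • kernelInt K (localHam h S) (c X)
        - (if X ⊆ S' then (X.card : ℝ)⁻¹ • kernelInt K (localHam h S') (c X) else 0)‖)
          * (1 + m) ^ p :=
        mul_le_mul_of_nonneg_right (norm_sum_le _ _) (by positivity)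
    _ ≤ ∑ X ∈ S.powerset with y ∈ X, C₂ * ((1 + rdiam (D.dist k) X) ^ p * ‖c X‖) := by
        rw [Finset.sum_mul]
        exact Finset.sum_le_sum hterm
    _ ≤ C₂ * M := by
        rw [← Finset.mul_sum]
        refine mul_le_mul_of_nonneg_left (le_trans ?_ hmom) hC₂
        refine Finset.sum_le_sum_of_subset_of_nonneg
          (Finset.filter_subset_filter _ (Finset.powerset_mono.2 hS)) fun X _ _ => ?_
        have hρ := rdiam_nonneg (D.dist k) X
        positivity

end Decay

/-! ### Time dependence of the localized inverse Liouvillians -/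

section Smooth

variable {d r : ℕ} {𝔸 : Type*} [CStarAlgebra 𝔸] {Q : Type*} {I : Set ℝ} {w : Q → ℝ} {K : ℝ → ℝ}

/-- Bounded sums per site bound the derivatives by the number of sites, which is polynomial in the
weight by assumption. -/
lemma smoothFamily_localHam (hI : I.OrdConnected) (hw : ∀ q, 1 ≤ w q)
    {h : Q → ℝ → Finset (Site d) → 𝔸} {S : Q → Finset (Site d)}
    (hs : ∀ q, ∀ X ⊆ S q, ContDiffOn ℝ ∞ (fun t => h q t X) I)
    (hb : ∀ i : ℕ, ∃ C : ℝ, 0 ≤ C ∧ ∀ q, ∀ t ∈ I, ∀ x ∈ S q, ∑ X ∈ (S q).powerset with x ∈ X,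
      ‖iteratedDerivWithin i (fun t => h q t X) I t‖ ≤ C)
    {C₀ : ℝ} {m : ℕ} (hcard : ∀ q, ((S q).card : ℝ) ≤ C₀ * w q ^ m) (n : ℕ) :
    SmoothFamily I w n (fun q _ t => localHam (h q t) (S q)) := by
  have hs' : ∀ q, ∀ X ∈ (S q).powerset.filter fun Z => Z.Nonempty,
      ContDiffOn ℝ ∞ (fun t => h q t X) I := fun q X hX =>
    hs q X (Finset.mem_powerset.1 (Finset.mem_filter.1 hX).1)
  refine SmoothFamily.of_contDiffOn hI (fun q => ContDiffOn.sum (hs' q)) hw (fun i => ?_) n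
  obtain ⟨C, hC0, hC⟩ := hb i
  refine ⟨C * max C₀ 0, m, by positivity, fun q t ht => ?_⟩
  have hwq : 0 ≤ w q := by linarith [hw q]
  calc ‖iteratedDerivWithin i (fun t => localHam (h q t) (S q)) I t‖
      = ‖∑ X ∈ (S q).powerset with X.Nonempty,
          iteratedDerivWithin i (fun t => h q t X) I t‖ := by
        rw [← iteratedDerivWithin_finset_sum hI _ (hs' q) i ht]
        rfl
    _ ≤ ∑ x ∈ S q, ∑ X ∈ (S q).powerset with x ∈ X,
          ‖iteratedDerivWithin i (fun t => h q t X) I t‖ :=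
        (norm_sum_le _ _).trans (sum_nonempty_le _ fun _ => norm_nonneg _)
    _ ≤ (S q).card * C := by
        rw [← nsmul_eq_mul]
        exact Finset.sum_le_card_nsmul _ _ _ fun x hx => hC q t ht x hx
    _ ≤ (max C₀ 0 * w q ^ m) * C := by
        refine mul_le_mul_of_nonneg_right ((hcard q).trans ?_) hC0
        exact mul_le_mul_of_nonneg_right (le_max_left _ _) (by positivity)
    _ = _ := by ring

/-- All terms contain the same site, so in contrast to the Hamiltonian no volume factor appears. -/
lemma smoothFamily_localObs (hI : I.OrdConnected) (hw : ∀ q, 1 ≤ w q)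
    {c : Q → ℝ → Finset (Site d) → 𝔸} {S : Q → Finset (Site d)} {y : Q → Site d}
    (hs : ∀ q, ∀ X ⊆ S q, ContDiffOn ℝ ∞ (fun t => c q t X) I)
    (hb : ∀ i : ℕ, ∃ C : ℝ, 0 ≤ C ∧ ∀ q, ∀ t ∈ I, ∀ x ∈ S q, ∑ X ∈ (S q).powerset with x ∈ X,
      ‖iteratedDerivWithin i (fun t => c q t X) I t‖ ≤ C) (n : ℕ) :
    SmoothFamily I w n (fun q _ t => localObs (c q t) (y q) (S q)) := by
  have hs' : ∀ q, ∀ X ∈ (S q).powerset.filter fun Z => y q ∈ Z,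
      ContDiffOn ℝ ∞ (fun t => (X.card : ℝ)⁻¹ • c q t X) I := fun q X hX =>
    (hs q X (Finset.mem_powerset.1 (Finset.mem_filter.1 hX).1)).const_smul _
  refine SmoothFamily.of_contDiffOn hI (fun q => ContDiffOn.sum (hs' q)) hw (fun i => ?_) n
  obtain ⟨C, hC0, hC⟩ := hb i
  refine ⟨C, 0, hC0, fun q t ht => ?_⟩
  rw [pow_zero, mul_one]
  calc ‖iteratedDerivWithin i (fun t => localObs (c q t) (y q) (S q)) I t‖
      = ‖∑ X ∈ (S q).powerset with y q ∈ X,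
          iteratedDerivWithin i (fun t => (X.card : ℝ)⁻¹ • c q t X) I t‖ := by
        rw [← iteratedDerivWithin_finset_sum hI _ (hs' q) i ht]
        rfl
    _ ≤ ∑ X ∈ (S q).powerset with y q ∈ X, ‖iteratedDerivWithin i (fun t => c q t X) I t‖ := by
        refine norm_sum_le_of_le _ fun X hX => ?_
        rw [Finset.mem_filter] at hX
        have hcard : (1 : ℝ) ≤ X.card := by exact_mod_cast Finset.card_pos.2 ⟨_, hX.2⟩
        rw [iteratedDerivWithin_fun_const_smul_field, norm_smul, norm_inv, Real.norm_natCast]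
        exact mul_le_of_le_one_left (norm_nonneg _) (inv_le_one_of_one_le₀ hcard)
    _ ≤ C := by
        by_cases hy : y q ∈ S q
        · exact hC q t ht _ hy
        · rw [Finset.filter_eq_empty_iff.2, Finset.sum_empty]
          · exact hC0
          · intro X hX hyX
            exact hy (Finset.mem_powerset.1 hX hyX)

lemma smoothFamily_localPiece (hI : I.OrdConnected) (hw : ∀ q, 1 ≤ w q)
    (hK : ∀ n : ℕ, Integrable fun s => K s * (1 + |s|) ^ n)
    {h c : Q → ℝ → Finset (Site d) → 𝔸} {S : Q → Finset (Site d)} {y : Q → Site d}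
    (hsa : ∀ q, ∀ t ∈ I, ∀ X ⊆ S q, IsSelfAdjoint (h q t X))
    (hs : ∀ q, ∀ X ⊆ S q, ContDiffOn ℝ ∞ (fun t => h q t X) I)
    (hb : ∀ i : ℕ, ∃ C : ℝ, 0 ≤ C ∧ ∀ q, ∀ t ∈ I, ∀ x ∈ S q, ∑ X ∈ (S q).powerset with x ∈ X,
      ‖iteratedDerivWithin i (fun t => h q t X) I t‖ ≤ C)
    (cs : ∀ q, ∀ X ⊆ S q, ContDiffOn ℝ ∞ (fun t => c q t X) I)
    (cb : ∀ i : ℕ, ∃ C : ℝ, 0 ≤ C ∧ ∀ q, ∀ t ∈ I, ∀ x ∈ S q, ∑ X ∈ (S q).powerset with x ∈ X,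
      ‖iteratedDerivWithin i (fun t => c q t X) I t‖ ≤ C)
    {C₀ : ℝ} {m : ℕ} (hcard : ∀ q, ((S q).card : ℝ) ≤ C₀ * w q ^ m) (n : ℕ) :
    SmoothFamily I w n (fun q _ t => localPiece K (h q t) (c q t) (y q) (S q)) :=
  SmoothFamily.kernelInt hI.convex hw hK
    (fun q t ht => isSelfAdjoint_sum _ fun X hX =>
      hsa q t ht X (Finset.mem_powerset.1 (Finset.mem_filter.1 hX).1))
    (smoothFamily_localHam hI hw hs hb hcard n) (smoothFamily_localObs hI hw cs cb n)

lemma HasBoundedSums.exists_sum_le {Φ : Interaction d r} (hm : HasBoundedSums I Φ)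
    {k : Q → ℕ} {S : Q → Finset (Site d)} (hS : ∀ q, S q ⊆ box d (k q)) (i : ℕ) :
    ∃ C : ℝ, 0 ≤ C ∧ ∀ q, ∀ t ∈ I, ∀ x ∈ S q, ∑ X ∈ (S q).powerset with x ∈ X,
      ‖iteratedDerivWithin i (fun t => Φ (k q) t X) I t‖ ≤ C := by
  obtain ⟨C, hC⟩ := hm i
  refine ⟨max C 0, le_max_right _ _, fun q t ht x hx => le_trans ?_ (le_max_left _ _)⟩
  refine le_trans ?_ (hC (k q) t ht x (hS q hx))
  exact Finset.sum_le_sum_of_subset_of_nonneg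
    (Finset.filter_subset_filter _ (Finset.powerset_mono.2 (hS q))) fun _ _ _ => norm_nonneg _

lemma IsSmoothInteraction.smoothFamily_localPiece (hI : I.OrdConnected) (hw : ∀ q, 1 ≤ w q)
    (hK : ∀ n : ℕ, Integrable fun s => K s * (1 + |s|) ^ n)
    {Φ Φ' : Interaction d r} (hΦ : IsSmoothInteraction I Φ) (hm : HasBoundedSums I Φ)
    (hΦ' : IsSmoothInteraction I Φ') (hm' : HasBoundedSums I Φ')
    {k : Q → ℕ} {S : Q → Finset (Site d)} (y : Q → Site d) (hS : ∀ q, S q ⊆ box d (k q))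
    {C₀ : ℝ} {m : ℕ} (hcard : ∀ q, ((S q).card : ℝ) ≤ C₀ * w q ^ m) (n : ℕ) :
    SmoothFamily I w n (fun q _ t => localPiece K (Φ (k q) t) (Φ' (k q) t) (y q) (S q)) :=
  LatticeFermions.smoothFamily_localPiece (h := fun q t => Φ (k q) t)
    (c := fun q t => Φ' (k q) t) hI hw hK
    (fun q t ht X hX => (hΦ.isLocalTerm (k q) t ht X (hX.trans (hS q))).2.2)
    (fun q X hX => hΦ.smooth (k q) X (hX.trans (hS q))) (hm.exists_sum_le hS)
    (fun q X hX => hΦ'.smooth (k q) X (hX.trans (hS q))) (hm'.exists_sum_le hS) hcard n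

end Smooth

/-! ### Exhaustions of the boxes -/

section Region

variable {d : ℕ} (D : BoxMetrics d)

open Classical in
/-- Two exhaustions of the box by balls around `y`: bulk balls with respect to the `ℓ¹`-distance
(`false`), and balls with respect to the metric of the box (`true`). -/
noncomputable def region : Bool → ℕ → Site d → ℕ → Finset (Site d)
  | false, k, y, m => (box d k).filter fun z => y ∈ box d k ∧ l1dist y z + 1 ≤ m ∧ l1dist y z ≤ k
  | true, k, y, m => (box d k).filter fun z => y ∈ box d k ∧ D.dist k y z + 1 ≤ m

variable {D} {e : Bool} {k m : ℕ} {y z : Site d}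

lemma mem_region_false : z ∈ region D false k y m ↔
    z ∈ box d k ∧ y ∈ box d k ∧ l1dist y z + 1 ≤ m ∧ l1dist y z ≤ k := by
  simp [region]

lemma mem_region_true : z ∈ region D true k y m ↔
    z ∈ box d k ∧ y ∈ box d k ∧ D.dist k y z + 1 ≤ m := by
  simp [region]

lemma region_false_subset_true : region D false k y m ⊆ region D true k y m := by
  intro z hz
  rw [mem_region_false] at hz
  rw [mem_region_true]
  exact ⟨hz.1, hz.2.1, by linarith [D.le_l1dist k y hz.2.1 z hz.1, hz.2.2.1]⟩

lemma region_subset_true : region D e k y m ⊆ region D true k y m := by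
  cases e
  · exact region_false_subset_true
  · exact subset_rfl

lemma region_subset_box : region D e k y m ⊆ box d k := fun _ hz =>
  (mem_region_true.1 (region_subset_true hz)).1

lemma dist_add_one_le_of_mem_region (hz : z ∈ region D e k y m) : D.dist k y z + 1 ≤ m :=
  (mem_region_true.1 (region_subset_true hz)).2.2

lemma center_mem_box_of_mem_region (hz : z ∈ region D e k y m) : y ∈ box d k :=
  (mem_region_true.1 (region_subset_true hz)).2.1

/-- The offset in the radius makes the zeroth ball empty, so that the telescoping sum starts at
zero. -/
lemma region_zero : region D e k y 0 = ∅ := by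
  refine Finset.eq_empty_of_forall_notMem fun z hz => ?_
  have h1 := dist_add_one_le_of_mem_region hz
  have h2 := D.dist_nonneg (center_mem_box_of_mem_region hz) (region_subset_box hz)
  simp only [CharP.cast_eq_zero] at h1
  linarith

lemma region_succ_mono : region D e k y m ⊆ region D e k y (m + 1) := by
  intro z hz
  cases e
  · rw [mem_region_false] at hz ⊢
    push_cast
    exact ⟨hz.1, hz.2.1, by linarith [hz.2.2.1], hz.2.2.2⟩
  · rw [mem_region_true] at hz ⊢
    push_cast
    exact ⟨hz.1, hz.2.1, by linarith [hz.2.2]⟩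

/-- For bulk balls the restriction to `ℓ¹`-distance at most `k` guarantees that both distances
agree, so that `ℓ¹`-shells are also far away in the metric of the box. -/
lemma lt_of_mem_region_succ (hz : z ∈ region D e k y (m + 1)) (hz' : z ∉ region D e k y m) :
    (m : ℝ) < D.dist k y z + 1 := by
  cases e
  · rw [mem_region_false] at hz hz'
    by_contra hlt
    rw [not_lt, D.eq_l1dist k y hz.2.1 z hz.1 hz.2.2.2] at hlt
    exact hz' ⟨hz.1, hz.2.1, hlt, hz.2.2.2⟩
  · rw [mem_region_true] at hz hz'
    by_contra hlt
    exact hz' ⟨hz.1, hz.2.1, not_lt.1 hlt⟩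

lemma self_mem_region_succ (hy : y ∈ box d k) : y ∈ region D e k y (m + 1) := by
  cases e
  · rw [mem_region_false, l1dist_self]
    push_cast
    exact ⟨hy, hy, by linarith [m.cast_nonneg (α := ℝ)], k.cast_nonneg⟩
  · rw [mem_region_true, D.dist_self hy]
    push_cast
    exact ⟨hy, hy, by linarith [m.cast_nonneg (α := ℝ)]⟩

lemma region_eq_empty (hy : y ∉ box d k) : region D e k y m = ∅ :=
  Finset.eq_empty_of_forall_notMem fun _ hz => hy (center_mem_box_of_mem_region hz)

/-- The `ℓ¹`-diameter of the box is at most `2dk`, which fixes the number of radii in `labels`. The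
metric balls are the ones that exhaust the box; bulk balls need not. -/
lemma region_true_eq_box (hy : y ∈ box d k) : region D true k y (2 * d * k + 1) = box d k := by
  refine region_subset_box.antisymm fun z hz => ?_
  rw [mem_region_true]
  push_cast
  have := (D.le_l1dist k y hy z hz).trans (l1dist_le_of_mem_box hy hz)
  exact ⟨hz, hy, by linarith⟩

lemma rdiam_region_le : rdiam (D.dist k) (region D e k y (m + 1)) ≤ 2 * m := by
  refine rdiam_le (by positivity) fun x hx z hz => ?_
  have h1 := dist_add_one_le_of_mem_region hx
  have h2 := dist_add_one_le_of_mem_region hz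
  have hy := center_mem_box_of_mem_region hx
  have hxb := region_subset_box hx
  have h3 := D.triangle k x hxb y hy z (region_subset_box hz)
  rw [D.symm k x hxb y hy] at h3
  push_cast at h1 h2
  linarith

-- Each point of a ball of radius `m` contributes at least `(1 + m)^(-2d)` to the uniformly bounded
-- sum over the box.
variable (D) in
lemma exists_card_region_le : ∃ C : ℝ, ∀ e k y m,
    ((region D e k y m).card : ℝ) ≤ C * (1 + m : ℝ) ^ (2 * d) := by
  obtain ⟨C, hC0, hC⟩ := exists_dist_sum_bound D
  refine ⟨C, fun e k y m => ?_⟩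
  by_cases hy : y ∈ box d k
  · have hpos : (0 : ℝ) < (1 + m : ℝ) ^ (2 * d) := by positivity
    rw [← div_le_iff₀ hpos, div_eq_mul_inv, ← nsmul_eq_mul]
    calc (region D e k y m).card • ((1 + m : ℝ) ^ (2 * d))⁻¹
        ≤ ∑ z ∈ region D e k y m, ((1 + D.dist k y z) ^ (2 * d))⁻¹ := by
          refine Finset.card_nsmul_le_sum _ _ _ fun z hz => ?_
          have h1 := dist_add_one_le_of_mem_region hz
          have h2 := D.dist_nonneg hy (region_subset_box hz)
          exact inv_anti₀ (by positivity) (pow_le_pow_left₀ (by positivity) (by linarith) _)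
      _ ≤ ∑ z ∈ box d k, ((1 + D.dist k y z) ^ (2 * d))⁻¹ := by
          refine Finset.sum_le_sum_of_subset_of_nonneg region_subset_box fun z hz _ => ?_
          have h2 := D.dist_nonneg hy hz
          positivity
      _ ≤ C := hC k y hy
  · rw [region_eq_empty hy]
    simp only [Finset.card_empty, CharP.cast_eq_zero]
    positivity

end Region

/-! ### The interaction of the inverse Liouvillian -/

section Transform

variable {d r : ℕ}

/-- The contribution of `y` gained by passing from the `m`-th to the next ball. The contributions
of the metric balls are taken relative to those of the bulk balls. -/
noncomputable def increment {𝔸 : Type*} [CStarAlgebra 𝔸] (D : BoxMetrics d) (K : ℝ → ℝ)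
    (h c : Finset (Site d) → 𝔸) (e : Bool) (k : ℕ) (y : Site d) (m : ℕ) : 𝔸 :=
  localPiece K h c y (region D e k y (m + 1)) - localPiece K h c y (region D e k y m)
    - bif e then localPiece K h c y (region D false k y (m + 1))
        - localPiece K h c y (region D false k y m) else 0

/-- The labels of the increments in the `k`-th box. -/
noncomputable def labels (d k : ℕ) : Finset (Bool × Site d × ℕ) :=
  Finset.univ ×ˢ box d k ×ˢ Finset.range (2 * d * k + 1)

/-- The interaction of the inverse Liouvillian of a Hamiltonian with interaction `ΦH` for the
commutator with interaction `ΦC`. -/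
noncomputable def transform (D : BoxMetrics d) (K : ℝ → ℝ) (ΦH ΦC : Interaction d r) :
    Interaction d r := fun k t Z =>
  if Z = ∅ then (∫ s, K s * s) • ΦC k t ∅
  else ∑ j ∈ labels d k with region D j.1 k j.2.1 (j.2.2 + 1) = Z,
    increment D K (ΦH k t) (ΦC k t) j.1 k j.2.1 j.2.2

/-- The assumptions on the interactions of the Hamiltonian and of the commutator. -/
structure QuasiLocalPair (D : BoxMetrics d) (I : Set ℝ) (K : ℝ → ℝ) (a A : ℝ)
    (ΦH ΦC : Interaction d r) : Prop where
  ordConnected : I.OrdConnected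
  integrable : ∀ n : ℕ, Integrable fun s => K s * (1 + |s|) ^ n
  pos : 0 < a
  nonneg : 0 ≤ A
  smooth_ham : IsSmoothInteraction I ΦH
  moments_ham : HasBoundedSums I ΦH
  decay_ham : ∀ k, ∀ t ∈ I, ∀ x ∈ box d k, ∀ y ∈ box d k,
    ∑ X ∈ (box d k).powerset with x ∈ X ∧ y ∈ X, ‖ΦH k t X‖ ≤ A * Real.exp (-a * D.dist k x y)
  smooth_com : IsSmoothInteraction I ΦC
  moments_com : HasMoments D I ΦC

variable {D : BoxMetrics d} {I : Set ℝ} {K : ℝ → ℝ} {a A : ℝ} {ΦH ΦC : Interaction d r}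

lemma isLocalTerm_sub {X : Finset (Site d)} {S T : Op d r} (hS : IsLocalTerm X S)
    (hT : IsLocalTerm X T) : IsLocalTerm X (S - T) := by
  rw [isLocalTerm_iff] at *
  exact ⟨sub_mem hS.1 hT.1, hS.2.sub hT.2⟩

lemma isLocalTerm_zero (X : Finset (Site d)) : IsLocalTerm X (0 : Op d r) :=
  isLocalTerm_iff.2 ⟨zero_mem _, .zero _⟩

lemma isLocalTerm_sum {X : Finset (Site d)} {ι : Type*} {s : Finset ι} {f : ι → Op d r}
    (h : ∀ j ∈ s, IsLocalTerm X (f j)) : IsLocalTerm X (∑ j ∈ s, f j) :=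
  isLocalTerm_iff.2 ⟨sum_mem fun j hj => (isLocalTerm_iff.1 (h j hj)).1,
    isSelfAdjoint_sum _ fun j hj => (h j hj).2.2⟩

lemma isLocalTerm_real_smul {X : Finset (Site d)} (b : ℝ) {S : Op d r} (hS : IsLocalTerm X S) :
    IsLocalTerm X (b • S) :=
  isLocalTerm_iff.2 ⟨(gaugeInvariant (r := r) X).toSubalgebra.smul_mem
    (isLocalTerm_iff.1 hS).1 (b : ℂ), isSelfAdjoint_real_smul b hS.2.2⟩

lemma isLocalTerm_mono {X Y : Finset (Site d)} (h : X ⊆ Y) {S : Op d r} (hS : IsLocalTerm X S) :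
    IsLocalTerm Y S := by
  rw [isLocalTerm_iff] at *
  exact ⟨gaugeInvariant_mono h hS.1, hS.2⟩

lemma localPiece_region_eq_zero {𝔸 : Type*} [CStarAlgebra 𝔸] {h c : Finset (Site d) → 𝔸} {e : Bool}
    {k m : ℕ} {y : Site d} (hy : y ∉ box d k) : localPiece K h c y (region D e k y m) = 0 := by
  rw [region_eq_empty hy]
  exact localPiece_of_notMem (Finset.notMem_empty y)

namespace QuasiLocalPair

lemma isLocalTerm_localPiece (P : QuasiLocalPair D I K a A ΦH ΦC) {k : ℕ} {t : ℝ} (ht : t ∈ I)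
    {S : Finset (Site d)} (hS : S ⊆ box d k) (y : Site d) :
    IsLocalTerm S (localPiece K (ΦH k t) (ΦC k t) y S) :=
  LatticeFermions.isLocalTerm_localPiece K
    (fun X hX => P.smooth_ham.isLocalTerm k t ht X (hX.trans hS))
    (fun X hX => P.smooth_com.isLocalTerm k t ht X (hX.trans hS)) y

lemma isLocalTerm_increment (P : QuasiLocalPair D I K a A ΦH ΦC) (e : Bool) (k : ℕ) {t : ℝ}
    (ht : t ∈ I) (y : Site d) (m : ℕ) :
    IsLocalTerm (region D e k y (m + 1)) (increment D K (ΦH k t) (ΦC k t) e k y m) := by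
  have h1 : ∀ e m, IsLocalTerm (region D e k y m)
      (localPiece K (ΦH k t) (ΦC k t) y (region D e k y m)) := fun e m =>
    P.isLocalTerm_localPiece ht region_subset_box y
  have h2 : ∀ e, IsLocalTerm (region D e k y (m + 1))
      (localPiece K (ΦH k t) (ΦC k t) y (region D e k y (m + 1))
        - localPiece K (ΦH k t) (ΦC k t) y (region D e k y m)) := fun e =>
    isLocalTerm_sub (h1 e (m + 1)) (isLocalTerm_mono region_succ_mono (h1 e m))
  cases e
  · exact isLocalTerm_sub (h2 false) (isLocalTerm_zero _)
  · exact isLocalTerm_sub (h2 true) (isLocalTerm_mono region_false_subset_true (h2 false))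

/-- The volume of a ball is polynomial in its radius, so `1 + m` can serve as the weight, uniformly
in the box and the centre. -/
lemma smoothFamily_region (P : QuasiLocalPair D I K a A ΦH ΦC) (e : Bool) (j n : ℕ) :
    SmoothFamily I (fun q : ℕ × Site d × ℕ => 1 + (q.2.2 : ℝ)) n (fun q _ t =>
      localPiece K (ΦH q.1 t) (ΦC q.1 t) q.2.1 (region D e q.1 q.2.1 (q.2.2 + j))) := by
  obtain ⟨C, hC⟩ := exists_card_region_le D
  refine P.smooth_ham.smoothFamily_localPiece P.ordConnected
    (fun q => by linarith [q.2.2.cast_nonneg (α := ℝ)]) P.integrable P.moments_ham P.smooth_com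
    P.moments_com.hasBoundedSums (k := fun q => q.1)
    (S := fun q : ℕ × Site d × ℕ => region D e q.1 q.2.1 (q.2.2 + j)) (fun q => q.2.1)
    (fun q => region_subset_box) (C₀ := max C 0 * (1 + j) ^ (2 * d)) (m := 2 * d) (fun q => ?_) n
  refine (hC e q.1 q.2.1 (q.2.2 + j)).trans ?_
  rw [mul_assoc, ← mul_pow]
  refine mul_le_mul (le_max_left _ _) (pow_le_pow_left₀ (by positivity) ?_ _) (by positivity)
    (le_max_right _ _)
  push_cast
  nlinarith [q.2.2.cast_nonneg (α := ℝ), j.cast_nonneg (α := ℝ),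
    mul_nonneg (q.2.2.cast_nonneg (α := ℝ)) (j.cast_nonneg (α := ℝ))]

lemma smoothFamily_increment (P : QuasiLocalPair D I K a A ΦH ΦC) (e : Bool) (n : ℕ) :
    SmoothFamily I (fun q : ℕ × Site d × ℕ => 1 + (q.2.2 : ℝ)) n (fun q _ t =>
      increment D K (ΦH q.1 t) (ΦC q.1 t) e q.1 q.2.1 q.2.2) := by
  have hw : ∀ q : ℕ × Site d × ℕ, 1 ≤ 1 + (q.2.2 : ℝ) := fun q => by
    linarith [q.2.2.cast_nonneg (α := ℝ)]
  have h : ∀ e, SmoothFamily I (fun q : ℕ × Site d × ℕ => 1 + (q.2.2 : ℝ)) n (fun q _ t =>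
      localPiece K (ΦH q.1 t) (ΦC q.1 t) q.2.1 (region D e q.1 q.2.1 (q.2.2 + 1))
        - localPiece K (ΦH q.1 t) (ΦC q.1 t) q.2.1 (region D e q.1 q.2.1 q.2.2)) := fun e =>
    (P.smoothFamily_region e 1 n).sub hw (P.smoothFamily_region e 0 n)
  cases e
  · exact (h false).sub hw .zero
  · exact (h true).sub hw (h false)

lemma exists_localPiece_sub_bound (P : QuasiLocalPair D I K a A ΦH ΦC) (e : Bool) (N : ℕ) :
    ∃ C : ℝ, 0 ≤ C ∧ ∀ k y m, ∀ t ∈ I,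
      ‖localPiece K (ΦH k t) (ΦC k t) y (region D e k y (m + 1))
        - localPiece K (ΦH k t) (ΦC k t) y (region D e k y m)‖ * (1 + m : ℝ) ^ N ≤ C := by
  obtain ⟨M, hM⟩ := P.moments_com 0 N
  obtain ⟨C, hC⟩ := exists_localPiece_decay (𝔸 := Op d r) D P.integrable P.pos P.nonneg M N
  refine ⟨max C 0, le_max_right _ _, fun k y m t ht => ?_⟩
  by_cases hy : y ∈ box d k
  · refine le_trans ?_ (le_max_left _ _)
    have hH := fun X hX => isLocalTerm_iff.1 (P.smooth_ham.isLocalTerm k t ht X hX)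
    have hcm := fun X hX => isLocalTerm_iff.1 (P.smooth_com.isLocalTerm k t ht X hX)
    exact hC k y hy _ _ region_succ_mono region_subset_box m (Nat.cast_nonneg m)
      (fun z hz hz' => lt_of_mem_region_succ hz hz') (ΦH k t) (ΦC k t) (fun X hX => (hH X hX).2)
      (fun X hX Y hY hXY => commute_of_mem_gaugeInvariant hXY (hH X hX).1 (hH Y hY).1)
      (fun X hX Y hY hXY => commute_of_mem_gaugeInvariant hXY (hH X hX).1 (hcm Y hY).1)
      (P.decay_ham k t ht)
      (by simpa only [timeDeriv, iteratedDerivWithin_zero] using hM k t ht y hy)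
  · rw [localPiece_region_eq_zero hy, localPiece_region_eq_zero hy, sub_zero, norm_zero, zero_mul]
    exact le_max_right _ _

/-- The estimate without derivatives comes from the Lieb-Robinson bound; `SmoothFamily.rapidDecay`
extends it to all time derivatives. -/
lemma exists_increment_bound (P : QuasiLocalPair D I K a A ΦH ΦC) (i N : ℕ) :
    ∃ C : ℝ, 0 ≤ C ∧ ∀ e k y m, ∀ t ∈ I,
      ‖iteratedDerivWithin i (fun t => increment D K (ΦH k t) (ΦC k t) e k y m) I t‖
        * (1 + m : ℝ) ^ N ≤ C := by
  have key : ∀ e, ∃ C : ℝ, ∀ q : ℕ × Site d × ℕ, ∀ t ∈ I,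
      ‖iteratedDerivWithin i (fun t => increment D K (ΦH q.1 t) (ΦC q.1 t) e q.1 q.2.1 q.2.2) I t‖
        * (1 + (q.2.2 : ℝ)) ^ N ≤ C := by
    intro e
    refine SmoothFamily.rapidDecay P.ordConnected
      (fun q => by linarith [q.2.2.cast_nonneg (α := ℝ)]) (P.smoothFamily_increment e)
      (fun N => ?_) i N
    obtain ⟨C, -, hC⟩ := P.exists_localPiece_sub_bound e N
    obtain ⟨C', h0, hC'⟩ := P.exists_localPiece_sub_bound false N
    refine ⟨C + C', fun q t ht => ?_⟩
    have h1 := hC q.1 q.2.1 q.2.2 t ht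
    have h2 := hC' q.1 q.2.1 q.2.2 t ht
    have hp : (0 : ℝ) ≤ (1 + (q.2.2 : ℝ)) ^ N := by positivity
    cases e
    · refine (mul_le_mul_of_nonneg_right (norm_sub_le _ _) hp).trans ?_
      rw [cond_false, norm_zero, add_zero]
      linarith
    · refine (mul_le_mul_of_nonneg_right (norm_sub_le _ _) hp).trans ?_
      rw [cond_true, add_mul]
      exact add_le_add h1 h2
  obtain ⟨C₁, h1⟩ := key false
  obtain ⟨C₂, h2⟩ := key true
  refine ⟨max (max C₁ C₂) 0, le_max_right _ _, fun e k y m t ht => ?_⟩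
  cases e
  · exact (h1 (k, y, m) t ht).trans ((le_max_left _ _).trans (le_max_left _ _))
  · exact (h2 (k, y, m) t ht).trans ((le_max_right _ _).trans (le_max_left _ _))

lemma contDiffOn_increment (P : QuasiLocalPair D I K a A ΦH ΦC) (e : Bool) (k : ℕ) (y : Site d)
    (m : ℕ) : ContDiffOn ℝ ∞ (fun t => increment D K (ΦH k t) (ΦC k t) e k y m) I :=
  SmoothFamily.contDiffOn P.ordConnected (P.smoothFamily_increment e) (k, y, m) 0

lemma contDiffOn_transform (P : QuasiLocalPair D I K a A ΦH ΦC) (k : ℕ) (X : Finset (Site d)) :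
    ContDiffOn ℝ ∞ (fun t => transform D K ΦH ΦC k t X) I := by
  unfold transform
  split_ifs with hX
  · exact (P.smooth_com.smooth k ∅ (Finset.empty_subset _)).const_smul _
  · exact ContDiffOn.sum fun j _ => P.contDiffOn_increment j.1 k j.2.1 j.2.2

lemma isSmoothInteraction_transform (P : QuasiLocalPair D I K a A ΦH ΦC) :
    IsSmoothInteraction I (transform D K ΦH ΦC) where
  isLocalTerm k t ht X _ := by
    unfold transform
    split_ifs with hX
    · rw [hX]
      exact isLocalTerm_real_smul _
        (P.smooth_com.isLocalTerm k t ht ∅ (Finset.empty_subset _))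
    · refine isLocalTerm_sum fun j hj => ?_
      rw [← (Finset.mem_filter.1 hj).2]
      exact P.isLocalTerm_increment j.1 k ht j.2.1 j.2.2
  eq_zero k t _ X hX := by
    have hne : X ≠ ∅ := by
      rintro rfl
      exact hX (Finset.empty_subset _)
    rw [transform, if_neg hne]
    refine Finset.sum_eq_zero fun j hj => absurd ?_ hX
    rw [← (Finset.mem_filter.1 hj).2]
    exact region_subset_box
  smooth k X _ := P.contDiffOn_transform k X

end QuasiLocalPair

lemma sum_labels {M : Type*} [AddCommMonoid M] (k : ℕ) (f : Bool → Site d → ℕ → M) :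
    ∑ j ∈ labels d k, f j.1 j.2.1 j.2.2
      = ∑ y ∈ box d k, ∑ m ∈ Finset.range (2 * d * k + 1), (f true y m + f false y m) := by
  rw [labels, Finset.sum_product, Fintype.sum_bool, Finset.sum_product, Finset.sum_product,
    ← Finset.sum_add_distrib]
  exact Finset.sum_congr rfl fun y _ => Finset.sum_add_distrib.symm

/-- The corrections subtract exactly what the bulk balls add, and the metric balls telescope to the
whole box. -/
lemma sum_increment {𝔸 : Type*} [CStarAlgebra 𝔸] (h c : Finset (Site d) → 𝔸) (k : ℕ) :
    ∑ j ∈ labels d k, increment D K h c j.1 k j.2.1 j.2.2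
      = ∑ y ∈ box d k, localPiece K h c y (box d k) := by
  rw [sum_labels k fun e y m => increment D K h c e k y m]
  refine Finset.sum_congr rfl fun y hy => ?_
  have e : ∀ m, increment D K h c true k y m + increment D K h c false k y m
      = localPiece K h c y (region D true k y (m + 1))
        - localPiece K h c y (region D true k y m) := fun m => by
    simp [increment]
  simp only [e]
  rw [Finset.sum_range_sub (fun m => localPiece K h c y (region D true k y m)),
    region_true_eq_box hy, region_zero, localPiece_of_notMem (Finset.notMem_empty y), sub_zero]

lemma sum_transform (k : ℕ) (t : ℝ) :
    ∑ X ∈ (box d k).powerset, transform D K ΦH ΦC k t X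
      = (∫ s, K s * s) • ΦC k t ∅
        + ∑ y ∈ box d k, localPiece K (ΦH k t) (ΦC k t) y (box d k) := by
  rw [← Finset.add_sum_erase _ _ (Finset.empty_mem_powerset (box d k)), ← sum_increment (D := D)]
  have h0 : transform D K ΦH ΦC k t ∅ = (∫ s, K s * s) • ΦC k t ∅ := if_pos rfl
  rw [h0, ← Finset.sum_fiberwise_of_maps_to (s := labels d k)
    (t := (box d k).powerset.erase ∅) (g := fun j => region D j.1 k j.2.1 (j.2.2 + 1))]
  · congr 1
    refine Finset.sum_congr rfl fun X hX => ?_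
    rw [transform, if_neg (Finset.ne_of_mem_erase hX)]
  · intro j hj
    simp only [labels, Finset.mem_product] at hj
    rw [Finset.mem_erase, Finset.mem_powerset]
    exact ⟨Finset.ne_empty_of_mem (self_mem_region_succ hj.2.1), region_subset_box⟩

lemma QuasiLocalPair.norm_timeDeriv_transform_le (P : QuasiLocalPair D I K a A ΦH ΦC) (i k : ℕ)
    {t : ℝ} (ht : t ∈ I) {X : Finset (Site d)} (hX : X ≠ ∅) :
    ‖timeDeriv I i (transform D K ΦH ΦC k) t X‖
      ≤ ∑ j ∈ labels d k with region D j.1 k j.2.1 (j.2.2 + 1) = X,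
        ‖iteratedDerivWithin i
          (fun t => increment D K (ΦH k t) (ΦC k t) j.1 k j.2.1 j.2.2) I t‖ := by
  have e : (fun t => transform D K ΦH ΦC k t X)
      = fun t => ∑ j ∈ labels d k with region D j.1 k j.2.1 (j.2.2 + 1) = X,
        increment D K (ΦH k t) (ΦC k t) j.1 k j.2.1 j.2.2 := funext fun t => if_neg hX
  rw [timeDeriv, e, iteratedDerivWithin_finset_sum P.ordConnected _
    (fun j _ => P.contDiffOn_increment j.1 k j.2.1 j.2.2) i ht]
  exact norm_sum_le _ _

theorem QuasiLocalPair.hasMoments_transform (P : QuasiLocalPair D I K a A ΦH ΦC) :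
    HasMoments D I (transform D K ΦH ΦC) := by
  intro i p
  -- Of the decay in the radius, `p` powers pay for the diameter, `2d` for the sum over the centres
  -- and two for the sum over the radii.
  obtain ⟨C, hC0, hC⟩ := P.exists_increment_bound i (p + 2 * d + 2)
  obtain ⟨L, hL0, hL⟩ := exists_dist_sum_bound D
  obtain ⟨L', hL'0, hL'⟩ : ∃ L' : ℝ, 0 ≤ L' ∧ ∀ n, ∑ m ∈ Finset.range n, ((1 + m : ℝ) ^ 2)⁻¹ ≤ L' := by
    have hs : Summable fun m : ℕ => ((1 + m : ℝ) ^ 2)⁻¹ := by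
      have := (summable_nat_add_iff 1).2 (Real.summable_nat_pow_inv.2 one_lt_two)
      simpa [add_comm] using this
    exact ⟨∑' m : ℕ, ((1 + m : ℝ) ^ 2)⁻¹, tsum_nonneg fun m => by positivity,
      fun n => hs.sum_le_tsum _ fun m _ => by positivity⟩
  refine ⟨2 * (2 ^ p * C * L * L'), fun k t ht x hx => ?_⟩
  set δ := fun j : Bool × Site d × ℕ => ‖iteratedDerivWithin i
    (fun t => increment D K (ΦH k t) (ΦC k t) j.1 k j.2.1 j.2.2) I t‖
  set R := fun j : Bool × Site d × ℕ => region D j.1 k j.2.1 (j.2.2 + 1)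
  calc ∑ X ∈ (box d k).powerset with x ∈ X, (1 + rdiam (D.dist k) X) ^ p
        * ‖timeDeriv I i (transform D K ΦH ΦC k) t X‖
      ≤ ∑ X ∈ (box d k).powerset with x ∈ X, ∑ j ∈ labels d k with R j = X,
          if x ∈ R j then (1 + rdiam (D.dist k) (R j)) ^ p * δ j else 0 := by
        refine Finset.sum_le_sum fun X hX => ?_
        rw [Finset.mem_filter] at hX
        have hρ := rdiam_nonneg (D.dist k) X
        refine (mul_le_mul_of_nonneg_left (P.norm_timeDeriv_transform_le i k ht
          (Finset.ne_empty_of_mem hX.2)) (by positivity)).trans (le_of_eq ?_)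
        rw [Finset.mul_sum]
        refine Finset.sum_congr rfl fun j hj => ?_
        rw [(Finset.mem_filter.1 hj).2, if_pos hX.2]
    _ ≤ ∑ X ∈ (box d k).powerset, ∑ j ∈ labels d k with R j = X,
          if x ∈ R j then (1 + rdiam (D.dist k) (R j)) ^ p * δ j else 0 := by
        refine Finset.sum_le_sum_of_subset_of_nonneg (Finset.filter_subset _ _)
          fun X _ _ => Finset.sum_nonneg fun j _ => ?_
        have hρ := rdiam_nonneg (D.dist k) (R j)
        split_ifs <;> positivity
    _ = ∑ j ∈ labels d k, if x ∈ R j then (1 + rdiam (D.dist k) (R j)) ^ p * δ j else 0 :=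
        Finset.sum_fiberwise_of_maps_to (fun j _ => Finset.mem_powerset.2 region_subset_box) _
    _ ≤ ∑ j ∈ labels d k, 2 ^ p * C * (((1 + D.dist k x j.2.1) ^ (2 * d))⁻¹
          * ((1 + j.2.2 : ℝ) ^ 2)⁻¹) := by
        refine Finset.sum_le_sum fun j hj => ?_
        simp only [labels, Finset.mem_product] at hj
        have hd := D.dist_nonneg hx hj.2.1
        split_ifs with hxR
        -- A ball containing `x` has its centre within its radius of `x`, which trades decay in the
        -- radius for decay in the distance.
        · have h1 := dist_add_one_le_of_mem_region hxR
          rw [D.symm k _ hj.2.1 x hx] at h1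
          push_cast at h1
          have h2 : rdiam (D.dist k) (R j) ≤ 2 * j.2.2 := rdiam_region_le
          have h3 := rdiam_nonneg (D.dist k) (R j)
          have h4 : δ j * (1 + j.2.2 : ℝ) ^ (p + 2 * d + 2) ≤ C := hC j.1 k j.2.1 j.2.2 t ht
          have hm : (0 : ℝ) ≤ j.2.2 := Nat.cast_nonneg _
          rw [← mul_inv, ← div_eq_mul_inv, le_div_iff₀ (by positivity)]
          calc (1 + rdiam (D.dist k) (R j)) ^ p * δ j
                * ((1 + D.dist k x j.2.1) ^ (2 * d) * (1 + j.2.2 : ℝ) ^ 2)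
              ≤ (2 * (1 + j.2.2 : ℝ)) ^ p * δ j
                * ((1 + j.2.2 : ℝ) ^ (2 * d) * (1 + j.2.2 : ℝ) ^ 2) := by
                have hδ : 0 ≤ δ j := norm_nonneg _
                gcongr <;> linarith
            _ = 2 ^ p * (δ j * (1 + j.2.2 : ℝ) ^ (p + 2 * d + 2)) := by
                rw [mul_pow, pow_add, pow_add]
                ring
            _ ≤ _ := mul_le_mul_of_nonneg_left h4 (by positivity)
        · positivity
    _ = 2 * (2 ^ p * C * ((∑ y ∈ box d k, ((1 + D.dist k x y) ^ (2 * d))⁻¹)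
          * ∑ m ∈ Finset.range (2 * d * k + 1), ((1 + m : ℝ) ^ 2)⁻¹)) := by
        rw [sum_labels k fun _ y m => 2 ^ p * C * (((1 + D.dist k x y) ^ (2 * d))⁻¹
          * ((1 + m : ℝ) ^ 2)⁻¹), Finset.sum_mul_sum, Finset.mul_sum, Finset.mul_sum]
        refine Finset.sum_congr rfl fun y _ => ?_
        rw [Finset.mul_sum, Finset.mul_sum]
        exact Finset.sum_congr rfl fun m _ => by ring
    _ ≤ 2 * (2 ^ p * C * (L * L')) := by
        gcongr
        · exact hL k x hx
        · exact hL' _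
    _ = _ := by ring

end Transform

/-! ### Uniformly null sequences -/

section UniformlyNull

variable {E : Type*} [NormedAddCommGroup E] [NormedSpace ℝ E] {I : Set ℝ}

/-- Sequences of smooth functions with bounded derivatives that converge to zero uniformly. -/
def UniformlyNull (I : Set ℝ) (f : ℕ → ℝ → E) : Prop :=
  (∀ n, SmoothFamily I (fun _ => 1) n (fun k _ t => f k t)) ∧
    ∀ ε > 0, ∀ᶠ k in atTop, ∀ t ∈ I, ‖f k t‖ ≤ ε

namespace UniformlyNull

lemma zero : UniformlyNull I (fun _ _ => (0 : E)) :=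
  ⟨fun _ => SmoothFamily.zero, fun ε hε => Eventually.of_forall fun k t _ => by simpa using hε.le⟩

lemma add {f g : ℕ → ℝ → E} (hf : UniformlyNull I f) (hg : UniformlyNull I g) :
    UniformlyNull I (fun k t => f k t + g k t) := by
  refine ⟨fun n => (hf.1 n).add (fun _ => le_rfl) (hg.1 n), fun ε hε => ?_⟩
  filter_upwards [hf.2 (ε / 2) (half_pos hε), hg.2 (ε / 2) (half_pos hε)] with k h1 h2 t ht
  exact (norm_add_le _ _).trans (by linarith [h1 t ht, h2 t ht])

lemma neg {f : ℕ → ℝ → E} (hf : UniformlyNull I f) : UniformlyNull I (fun k t => -f k t) :=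
  ⟨fun n => (hf.1 n).neg, fun ε hε => by simpa only [norm_neg] using hf.2 ε hε⟩

lemma sub {f g : ℕ → ℝ → E} (hf : UniformlyNull I f) (hg : UniformlyNull I g) :
    UniformlyNull I (fun k t => f k t - g k t) := by
  simpa only [sub_eq_add_neg] using hf.add hg.neg

lemma sum {ι : Type*} (s : Finset ι) {f : ι → ℕ → ℝ → E} (hf : ∀ j ∈ s, UniformlyNull I (f j)) :
    UniformlyNull I (fun k t => ∑ j ∈ s, f j k t) := by
  classical
  induction s using Finset.induction_on with
  | empty => simpa using zero
  | insert j s hj ih =>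
    simp only [Finset.sum_insert hj]
    exact (hf j (Finset.mem_insert_self j s)).add
      (ih fun i hi => hf i (Finset.mem_insert_of_mem hi))

lemma congr {f g : ℕ → ℝ → E} (hf : UniformlyNull I f) (h : ∀ k t, f k t = g k t) :
    UniformlyNull I g := by
  have : f = g := funext fun k => funext (h k)
  rwa [← this]

end UniformlyNull

end UniformlyNull

/-! ### Thermodynamic limit of the localized inverse Liouvillians -/

section Limit

variable {d r : ℕ}

/-- The set `S` stays fixed in the limit, so counting all its subsets and bounding the change of the
dynamics linearly in time is good enough. -/
lemma norm_localPiece_sub_le {𝔸 : Type*} [CStarAlgebra 𝔸] {K : ℝ → ℝ}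
    (hK : ∀ n : ℕ, Integrable fun s => K s * (1 + |s|) ^ n) {h h' c c' : Finset (Site d) → 𝔸}
    {S : Finset (Site d)} (hh : ∀ X ⊆ S, IsSelfAdjoint (h X)) (hh' : ∀ X ⊆ S, IsSelfAdjoint (h' X))
    (y : Site d) {ε : ℝ} (hε0 : 0 ≤ ε) (hε : ∀ X ⊆ S, X.Nonempty → ‖h X - h' X‖ ≤ ε)
    (hε' : ∀ X ⊆ S, X.Nonempty → ‖c X - c' X‖ ≤ ε) :
    ‖localPiece K h c y S - localPiece K h' c' y S‖
      ≤ (2 * kernelMoment K 2 * (∑ X ∈ S.powerset with y ∈ X, ‖c X‖) + kernelMoment K 1)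
        * (S.powerset.card * ε) := by
  have sa : ∀ {h : Finset (Site d) → 𝔸}, (∀ X ⊆ S, IsSelfAdjoint (h X)) →
      IsSelfAdjoint (localHam h S) := fun hh => isSelfAdjoint_sum _ fun X hX =>
    hh X (Finset.mem_powerset.1 (Finset.mem_filter.1 hX).1)
  have hinv : ∀ X : Finset (Site d), ‖((X.card : ℝ)⁻¹)‖ ≤ 1 := fun X => by
    rw [norm_inv, Real.norm_natCast]
    exact Nat.cast_inv_le_one _
  have k1 := kernelMoment_nonneg K 1
  have k2 := kernelMoment_nonneg K 2
  have hcard : ∀ P : Finset (Finset (Site d)), P ⊆ S.powerset →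
      ∑ X ∈ P, ε ≤ S.powerset.card * ε := fun P hP => by
    rw [Finset.sum_const, nsmul_eq_mul]
    exact mul_le_mul_of_nonneg_right (by exact_mod_cast Finset.card_le_card hP) hε0
  have hham : ‖localHam h S - localHam h' S‖ ≤ S.powerset.card * ε := by
    rw [localHam, localHam, ← Finset.sum_sub_distrib]
    refine (norm_sum_le_of_le _ fun X hX => ?_).trans (hcard _ (Finset.filter_subset _ _))
    rw [Finset.mem_filter, Finset.mem_powerset] at hX
    exact hε X hX.1 hX.2
  have hobs : ‖localObs c y S - localObs c' y S‖ ≤ S.powerset.card * ε := by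
    rw [localObs, localObs, ← Finset.sum_sub_distrib]
    refine (norm_sum_le_of_le _ fun X hX => ?_).trans (hcard _ (Finset.filter_subset _ _))
    rw [Finset.mem_filter, Finset.mem_powerset] at hX
    rw [← smul_sub, norm_smul]
    exact (mul_le_of_le_one_left (norm_nonneg _) (hinv X)).trans (hε' X hX.1 ⟨y, hX.2⟩)
  have hc : ‖localObs c y S‖ ≤ ∑ X ∈ S.powerset with y ∈ X, ‖c X‖ := by
    refine norm_sum_le_of_le _ fun X _ => ?_
    rw [norm_smul]
    exact mul_le_of_le_one_left (norm_nonneg _) (hinv X)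
  have h1 := norm_kernelInt_sub_le hK (sa hh) (sa hh') (C := localObs c y S)
    (b := 2 * ‖localHam h S - localHam h' S‖ * ‖localObs c y S‖) (by positivity) (p := 1)
    (fun u => by
      refine (evolve_sub_evolve_le (sa hh) (sa hh') _ u).trans ?_
      rw [pow_one]
      have : 0 ≤ ‖localHam h S - localHam h' S‖ * ‖localObs c y S‖ := by positivity
      nlinarith [abs_nonneg u])
  have h2 := norm_kernelInt_le hK (sa hh') (localObs c y S - localObs c' y S)
  have e : localPiece K h c y S - localPiece K h' c' y S
      = (kernelInt K (localHam h S) (localObs c y S) - kernelInt K (localHam h' S) (localObs c y S))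
        + kernelInt K (localHam h' S) (localObs c y S - localObs c' y S) := by
    have h3 := kernelInt_add hK (sa hh') (localObs c y S - localObs c' y S) (localObs c' y S)
    rw [sub_add_cancel] at h3
    rw [localPiece, localPiece, h3]
    abel
  rw [e]
  calc _ ≤ _ := norm_add_le _ _
    _ ≤ kernelMoment K 2 * (2 * ‖localHam h S - localHam h' S‖ * ‖localObs c y S‖)
        + kernelMoment K 1 * ‖localObs c y S - localObs c' y S‖ := add_le_add h1 h2
    _ ≤ kernelMoment K 2 * (2 * (S.powerset.card * ε) * ∑ X ∈ S.powerset with y ∈ X, ‖c X‖)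
        + kernelMoment K 1 * (S.powerset.card * ε) := by gcongr
    _ = _ := by ring

lemma restrictToBoxes_of_subset {Ψ : ℝ → Finset (Site d) → Op d r} {k : ℕ} {X : Finset (Site d)}
    (hX : X ⊆ box d k) (t : ℝ) : restrictToBoxes Ψ k t X = Ψ t X := if_pos hX

/-- Infinite volume interactions and the interactions converging to them. -/
structure LimitPair (I : Set ℝ) (Φ : Interaction d r) (Ψ : ℝ → Finset (Site d) → Op d r) :
    Prop where
  smooth : IsSmoothInteraction I (restrictToBoxes Ψ)
  moments : HasBoundedSums I (restrictToBoxes Ψ)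
  converges : BulkConverges I Φ Ψ

variable {D : BoxMetrics d} {I : Set ℝ} {K : ℝ → ℝ} {a A : ℝ} {ΦH ΦC : Interaction d r}
  {ΨH ΨC : ℝ → Finset (Site d) → Op d r}

lemma LimitPair.isLocalTerm {Φ : Interaction d r} {Ψ : ℝ → Finset (Site d) → Op d r}
    (L : LimitPair I Φ Ψ) {t : ℝ} (ht : t ∈ I) (X : Finset (Site d)) : IsLocalTerm X (Ψ t X) := by
  obtain ⟨M, hM⟩ := exists_mem_box X
  rw [← restrictToBoxes_of_subset (Ψ := Ψ) (hM M le_rfl) t]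
  exact L.smooth.isLocalTerm M t ht X (hM M le_rfl)

lemma smoothFamily_localPiece_limit {Q : Type*} (P : QuasiLocalPair D I K a A ΦH ΦC)
    (LH : LimitPair I ΦH ΨH) (LC : LimitPair I ΦC ΨC) (S : Finset (Site d)) (y : Site d) (n : ℕ) :
    SmoothFamily I (fun _ : Q => 1) n (fun _ _ t => localPiece K (ΨH t) (ΨC t) y S) := by
  obtain ⟨M, hM⟩ := exists_mem_box S
  have hS := hM M le_rfl
  refine (LH.smooth.smoothFamily_localPiece (w := fun _ : Q => 1) P.ordConnected (fun _ => le_rfl)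
    P.integrable LH.moments LC.smooth LC.moments (k := fun _ => M) (S := fun _ => S)
    (fun _ => y) (fun _ => hS) (C₀ := S.card) (m := 0) (fun _ => by simp) n).congr
    fun _ _ t _ => ?_
  exact localPiece_congr (fun X hX => restrictToBoxes_of_subset (hX.trans hS) t)
    (fun X hX => restrictToBoxes_of_subset (hX.trans hS) t) y

/-- The shift of the index by `M` places `S` inside every box of the sequence, so that the
smoothness bounds hold for all `k` without exception. -/
lemma uniformlyNull_localPiece (P : QuasiLocalPair D I K a A ΦH ΦC) (LH : LimitPair I ΦH ΨH)
    (LC : LimitPair I ΦC ΨC) {S : Finset (Site d)} {M : ℕ} (hS : S ⊆ box d M) (y : Site d) :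
    UniformlyNull I (fun k t => localPiece K (ΨH t) (ΨC t) y S
      - localPiece K (ΦH (k + M) t) (ΦC (k + M) t) y S) := by
  have hSk : ∀ k, S ⊆ box d (k + M) := fun k => hS.trans (box_mono (Nat.le_add_left M k))
  refine ⟨fun n => (smoothFamily_localPiece_limit P LH LC S y n).sub (fun _ => le_rfl)
    (P.smooth_ham.smoothFamily_localPiece P.ordConnected (fun _ => le_rfl) P.integrable
      P.moments_ham P.smooth_com P.moments_com.hasBoundedSums (k := fun k => k + M) (S := fun _ => S) (fun _ => y)
      hSk (C₀ := S.card) (m := 0) (fun _ => by simp) n), fun ε hε => ?_⟩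
  obtain ⟨C, hC0, hC⟩ := LC.moments.exists_sum_le (Q := Unit) (k := fun _ => M) (S := fun _ => S)
    (fun _ => hS) 0
  have hCy : ∀ t ∈ I, ∑ X ∈ S.powerset with y ∈ X, ‖ΨC t X‖ ≤ C := by
    intro t ht
    by_cases hy : y ∈ S
    · refine le_trans (Finset.sum_le_sum fun X hX => ?_) (hC () t ht y hy)
      rw [Finset.mem_filter, Finset.mem_powerset] at hX
      rw [iteratedDerivWithin_zero, restrictToBoxes_of_subset (hX.1.trans hS)]
    · rw [Finset.filter_eq_empty_iff.2, Finset.sum_empty]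
      · exact hC0
      · intro X hX hyX
        exact hy (Finset.mem_powerset.1 hX hyX)
  have k1 := kernelMoment_nonneg K 1
  have k2 := kernelMoment_nonneg K 2
  set B := (2 * kernelMoment K 2 * C + kernelMoment K 1) * S.powerset.card
  have hB : 0 ≤ B := by positivity
  have hη : 0 < ε / (B + 1) := by positivity
  have hev : ∀ {Φ : Interaction d r} {Ψ : ℝ → Finset (Site d) → Op d r}, BulkConverges I Φ Ψ →
      ∀ᶠ k in atTop, ∀ X ∈ S.powerset, X.Nonempty → ∀ t ∈ I,
        ‖Ψ t X - Φ (k + M) t X‖ ≤ ε / (B + 1) := by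
    intro Φ Ψ h
    rw [eventually_all_finset]
    intro X _
    by_cases hX : X.Nonempty
    · exact ((tendsto_add_atTop_nat M).eventually (h X hX _ hη)).mono fun k hk _ => hk
    · exact Eventually.of_forall fun k hne => absurd hne hX
  filter_upwards [hev LH.converges, hev LC.converges] with k h1 h2 t ht
  refine (norm_localPiece_sub_le P.integrable (fun X _ => (LH.isLocalTerm ht X).2.2)
    (fun X hX => (P.smooth_ham.isLocalTerm (k + M) t ht X (hX.trans (hSk k))).2.2) y hη.le
    (fun X hX hne => h1 X (Finset.mem_powerset.2 hX) hne t ht)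
    (fun X hX hne => h2 X (Finset.mem_powerset.2 hX) hne t ht)).trans ?_
  calc (2 * kernelMoment K 2 * (∑ X ∈ S.powerset with y ∈ X, ‖ΨC t X‖) + kernelMoment K 1)
        * (S.powerset.card * (ε / (B + 1)))
      ≤ (2 * kernelMoment K 2 * C + kernelMoment K 1) * (S.powerset.card * (ε / (B + 1))) := by
        have := hCy t ht
        gcongr
    _ = B * (ε / (B + 1)) := by ring
    _ ≤ ε := by
        rw [mul_div_assoc', div_le_iff₀ (by positivity)]
        nlinarith

open Classical in
/-- The local term at `Z ⊆ box d M` of the interaction of the inverse Liouvillian in the bulk. -/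
noncomputable def bulkTransform {𝔸 : Type*} [CStarAlgebra 𝔸] (K : ℝ → ℝ)
    (h c : Finset (Site d) → 𝔸) (M : ℕ) (Z : Finset (Site d)) : 𝔸 :=
  ∑ q ∈ Z ×ˢ Finset.range (2 * d * M + 1) with ∀ z, z ∈ Z ↔ l1dist q.1 z ≤ q.2,
    (localPiece K h c q.1 Z - localPiece K h c q.1 (Z.filter fun z => l1dist q.1 z + 1 ≤ q.2))

lemma abs_sub_le_l1dist (x y : Site d) (j : Fin d) : |(x j : ℝ) - y j| ≤ l1dist x y :=
  Finset.single_le_sum (f := fun j => |(x j : ℝ) - y j|) (fun _ _ => abs_nonneg _)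
    (Finset.mem_univ j)

lemma mem_box_of_l1dist_le {M n : ℕ} {y z : Site d} (hy : y ∈ box d M) (h : l1dist y z ≤ n) :
    z ∈ box d (M + n) := by
  rw [mem_box] at hy ⊢
  intro j
  have h1 := (abs_sub_le_l1dist y z j).trans h
  have h2 : |y j - z j| ≤ n := by exact_mod_cast h1
  rw [abs_le] at h2
  have := hy j
  push_cast
  constructor <;> linarith

/-- A bulk ball inside a small box has a small radius. -/
lemma radius_le_of_region_subset {k M m : ℕ} {y : Site d} (hk : 3 * M + 1 ≤ k) (hy : y ∈ box d M)
    (hsub : region D false k y (m + 1) ⊆ box d M) (hm : m < 2 * d * k + 1) : m ≤ 2 * d * M := by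
  rcases Nat.eq_zero_or_pos d with rfl | hd
  · omega
  · have hm2 : m ≤ 2 * M := by
      by_contra hlt
      rw [not_le] at hlt
      set j : Fin d := ⟨0, hd⟩
      -- A point `2M + 1` steps from `y` along one axis lies outside the small box, but would belong
      -- to a ball of larger radius.
      set z : Site d := Function.update y j (y j + (2 * M + 1 : ℕ))
      have hz : l1dist y z = (2 * M + 1 : ℕ) := by
        rw [l1dist, Finset.sum_eq_single j]
        · simp only [z, Function.update_self]
          push_cast
          rw [abs_sub_comm, add_sub_cancel_left, abs_of_nonneg (by positivity)]
        · intro b _ hb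
          simp [z, Function.update_of_ne hb]
        · intro h
          exact absurd (Finset.mem_univ j) h
      have hzk : z ∈ box d k := box_mono (by omega) (mem_box_of_l1dist_le hy hz.le)
      have hzM : z ∈ box d M := hsub (mem_region_false.2 ⟨hzk, box_mono (by omega) hy, by
        rw [hz]
        exact_mod_cast (by omega : 2 * M + 1 + 1 ≤ m + 1), by
        rw [hz]
        exact_mod_cast (by omega : 2 * M + 1 ≤ k)⟩)
      have h1 := (mem_box.1 hzM j).2
      have h2 := (mem_box.1 hy j).1
      simp only [z, Function.update_self] at h1
      push_cast at h1
      linarith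
    nlinarith

/-- Far from the boundary, the local terms do not depend on the box. -/
theorem transform_eq_bulkTransform {Z : Finset (Site d)} (hZ : Z.Nonempty) {M k : ℕ}
    (hZM : Z ⊆ box d M) (hk : (2 * d + 3) * M + 1 ≤ k) (t : ℝ) :
    transform D K ΦH ΦC k t Z = bulkTransform K (ΦH k t) (ΦC k t) M Z := by
  classical
  -- The first bound limits the radii, the second makes both distances agree on the small box, and
  -- the third keeps the relevant balls away from the boundary of the large one.
  have hk1 : 3 * M + 1 ≤ k := by nlinarith
  have hk2 : 2 * d * M ≤ k := by nlinarith
  have hk3 : M + 2 * d * M ≤ k := by nlinarith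
  have hMk : M ≤ k := by omega
  have hl1 : ∀ y ∈ box d M, ∀ z ∈ box d M, l1dist y z ≤ k := fun y hy z hz =>
    (l1dist_le_of_mem_box hy hz).trans (by exact_mod_cast hk2)
  -- A metric ball contained in the small box coincides with the bulk ball, and so do the smaller
  -- balls about the same centre; hence the correction is zero.
  have htrue : ∀ y ∈ box d k, ∀ m, region D true k y (m + 1) = Z →
      increment D K (ΦH k t) (ΦC k t) true k y m = 0 := by
    intro y hy m he
    have hyM : y ∈ box d M := hZM (he ▸ self_mem_region_succ hy)
    have hreg : ∀ m', region D true k y m' ⊆ region D true k y (m + 1) →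
        region D true k y m' = region D false k y m' := by
      intro m' hm'
      refine Finset.Subset.antisymm (fun z hz => ?_) region_false_subset_true
      have hzM : z ∈ box d M := hZM (he ▸ hm' hz)
      rw [mem_region_true] at hz
      have h1 := hl1 y hyM z hzM
      rw [D.eq_l1dist k y hy z hz.1 h1] at hz
      exact mem_region_false.2 ⟨hz.1, hz.2.1, hz.2.2, h1⟩
    rw [increment, hreg _ subset_rfl, hreg _ region_succ_mono, cond_true, sub_self]
  -- Both conditions say that `Z` is the full `ℓ¹`-ball in the lattice with centre `y` and radius
  -- `m`, which involves neither the box nor its metric.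
  have hfalse : ∀ y m, (y ∈ box d k ∧ m < 2 * d * k + 1) ∧ region D false k y (m + 1) = Z ↔
      (y ∈ Z ∧ m < 2 * d * M + 1) ∧ ∀ z, z ∈ Z ↔ l1dist y z ≤ m := by
    intro y m
    constructor
    · rintro ⟨⟨hy, hm⟩, he⟩
      have hyZ : y ∈ Z := he ▸ self_mem_region_succ hy
      have hyM := hZM hyZ
      have hm' := radius_le_of_region_subset (D := D) hk1 hyM (he ▸ hZM) hm
      refine ⟨⟨hyZ, by omega⟩, fun z => ?_⟩
      rw [← he, mem_region_false]
      push_cast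
      constructor
      · rintro ⟨-, -, h1, -⟩
        linarith
      · intro h1
        refine ⟨box_mono (by omega) (mem_box_of_l1dist_le hyM h1), hy, by linarith, h1.trans ?_⟩
        exact_mod_cast hm'.trans hk2
    · rintro ⟨⟨hyZ, hm⟩, hz⟩
      have hyM := hZM hyZ
      have hy := box_mono hMk hyM
      refine ⟨⟨hy, hm.trans_le ?_⟩, ?_⟩
      · have := Nat.mul_le_mul_left (2 * d) hMk
        omega
      · ext z
        rw [mem_region_false, hz]
        push_cast
        constructor
        · rintro ⟨-, -, h1, -⟩
          linarith
        · intro h1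
          have hzM := hZM ((hz z).2 h1)
          exact ⟨box_mono hMk hzM, hy, by linarith, hl1 y hyM z hzM⟩
  rw [transform, if_neg hZ.ne_empty, Finset.sum_filter]
  refine (sum_labels k fun e y m => if region D e k y (m + 1) = Z then
    increment D K (ΦH k t) (ΦC k t) e k y m else 0).trans ?_
  have e : ∀ y ∈ box d k, ∀ m ∈ Finset.range (2 * d * k + 1),
      ((if region D true k y (m + 1) = Z then increment D K (ΦH k t) (ΦC k t) true k y m else 0)
        + if region D false k y (m + 1) = Z then increment D K (ΦH k t) (ΦC k t) false k y m else 0)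
      = if region D false k y (m + 1) = Z then increment D K (ΦH k t) (ΦC k t) false k y m
        else 0 := by
    intro y hy m _
    split_ifs with h1 h2 <;> simp [htrue y hy m, h1]
  rw [Finset.sum_congr rfl fun y hy => Finset.sum_congr rfl (e y hy), ← Finset.sum_product',
    ← Finset.sum_filter, bulkTransform]
  have hset : ((box d k ×ˢ Finset.range (2 * d * k + 1)).filter
      fun q => region D false k q.1 (q.2 + 1) = Z)
      = (Z ×ˢ Finset.range (2 * d * M + 1)).filter fun q => ∀ z, z ∈ Z ↔ l1dist q.1 z ≤ q.2 := by
    ext q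
    simp only [Finset.mem_filter, Finset.mem_product, Finset.mem_range]
    exact hfalse q.1 q.2
  rw [hset]
  refine Finset.sum_congr rfl fun q hq => ?_
  rw [← hset, Finset.mem_filter, Finset.mem_product] at hq
  have he := hq.2
  have hq1 : q.1 ∈ box d M := hZM (he ▸ self_mem_region_succ hq.1.1)
  have hsmall : region D false k q.1 q.2 = Z.filter fun z => l1dist q.1 z + 1 ≤ q.2 := by
    ext z
    rw [Finset.mem_filter]
    constructor
    · intro hz
      exact ⟨he ▸ region_succ_mono hz, (mem_region_false.1 hz).2.2.1⟩
    · rintro ⟨hz, h1⟩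
      exact mem_region_false.2 ⟨box_mono hMk (hZM hz), hq.1.1, h1, hl1 _ hq1 z (hZM hz)⟩
  rw [increment, he, hsmall, cond_false, sub_zero]

end Limit

/-! ### The infinite volume interaction of the inverse Liouvillian -/

section InfiniteVolume

variable {d r : ℕ}

/-- The infinite volume interaction of the inverse Liouvillian. -/
noncomputable def limitTransform (K : ℝ → ℝ) (ΨH ΨC : ℝ → Finset (Site d) → Op d r) (t : ℝ)
    (Z : Finset (Site d)) : Op d r :=
  bulkTransform K (ΨH t) (ΨC t) (exists_mem_box Z).choose Z

variable {D : BoxMetrics d} {I : Set ℝ} {K : ℝ → ℝ} {a A : ℝ} {ΦH ΦC : Interaction d r}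
  {ΨH ΨC : ℝ → Finset (Site d) → Op d r}

lemma contDiffOn_limitTransform (P : QuasiLocalPair D I K a A ΦH ΦC) (LH : LimitPair I ΦH ΨH)
    (LC : LimitPair I ΦC ΨC) (Z : Finset (Site d)) :
    ContDiffOn ℝ ∞ (fun t => limitTransform K ΨH ΨC t Z) I := by
  have h : ∀ S y, ContDiffOn ℝ ∞ (fun t => localPiece K (ΨH t) (ΨC t) y S) I := fun S y =>
    SmoothFamily.contDiffOn P.ordConnected (smoothFamily_localPiece_limit P LH LC S y) () 0
  exact ContDiffOn.sum fun q _ => (h _ _).sub (h _ _)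

lemma isSmoothInteraction_limitTransform (P : QuasiLocalPair D I K a A ΦH ΦC)
    (LH : LimitPair I ΦH ΨH) (LC : LimitPair I ΦC ΨC) :
    IsSmoothInteraction I (restrictToBoxes (limitTransform K ΨH ΨC)) where
  isLocalTerm k t ht X hX := by
    have h : ∀ S y, IsLocalTerm S (localPiece K (ΨH t) (ΨC t) y S) := fun S y =>
      isLocalTerm_localPiece K (fun X _ => LH.isLocalTerm ht X) (fun X _ => LC.isLocalTerm ht X) y
    rw [restrictToBoxes_of_subset hX]
    exact isLocalTerm_sum fun q _ => isLocalTerm_sub (h _ _)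
      (isLocalTerm_mono (Finset.filter_subset _ _) (h _ _))
  eq_zero _ _ _ _ hX := if_neg hX
  smooth k X hX := by
    simp only [restrictToBoxes_of_subset hX]
    exact contDiffOn_limitTransform P LH LC X

/-- From `k₀` on both local terms are the same finite sum of local pieces on subsets of `Z`, so only
the convergence of these pieces is needed. -/
lemma exists_uniformlyNull_transform (P : QuasiLocalPair D I K a A ΦH ΦC)
    (LH : LimitPair I ΦH ΨH) (LC : LimitPair I ΦC ΨC) {Z : Finset (Site d)} (hZ : Z.Nonempty) :
    ∃ k₀, UniformlyNull I (fun k t =>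
      limitTransform K ΨH ΨC t Z - transform D K ΦH ΦC (k + k₀) t Z) := by
  classical
  set M := (exists_mem_box Z).choose
  have hZM : Z ⊆ box d M := (exists_mem_box Z).choose_spec M le_rfl
  set k₀ := (2 * d + 3) * M + 1
  have hMk : M ≤ k₀ := by
    simp only [k₀]
    nlinarith
  have hZk : Z ⊆ box d k₀ := hZM.trans (box_mono hMk)
  refine ⟨k₀, (UniformlyNull.sum ((Z ×ˢ Finset.range (2 * d * M + 1)).filter
    fun q => ∀ z, z ∈ Z ↔ l1dist q.1 z ≤ q.2) fun q _ =>
      (uniformlyNull_localPiece P LH LC hZk q.1).sub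
        (uniformlyNull_localPiece P LH LC (S := Z.filter fun z => l1dist q.1 z + 1 ≤ q.2)
          ((Finset.filter_subset _ _).trans hZk) q.1)).congr fun k t => ?_⟩
  rw [transform_eq_bulkTransform hZ hZM (Nat.le_add_left k₀ k), limitTransform, bulkTransform,
    bulkTransform, ← Finset.sum_sub_distrib]
  refine Finset.sum_congr ?_ fun q _ => ?_
  · congr
  · abel

lemma eventually_timeDeriv_limitTransform (P : QuasiLocalPair D I K a A ΦH ΦC)
    (LH : LimitPair I ΦH ΨH) (LC : LimitPair I ΦC ΨC) (i : ℕ) {Z : Finset (Site d)}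
    (hZ : Z.Nonempty) {ε : ℝ} (hε : 0 < ε) : ∀ᶠ k in atTop, ∀ t ∈ I,
      ‖timeDeriv I i (fun s X => limitTransform K ΨH ΨC s X - transform D K ΦH ΦC k s X) t Z‖
        ≤ ε := by
  obtain ⟨k₀, h1, h2⟩ := exists_uniformlyNull_transform P LH LC hZ
  rw [← map_add_atTop_eq_nat k₀, eventually_map]
  exact SmoothFamily.tendsto_zero P.ordConnected h1 h2 i ε hε

/-- For a fixed box only finitely many sets are involved, and for large `k` the metric agrees with
the `ℓ¹`-distance on it. The uniform bounds of the finite systems therefore hold in the limit up to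
an arbitrary `ε`. -/
lemma hasMoments_limitTransform (P : QuasiLocalPair D I K a A ΦH ΦC)
    (LH : LimitPair I ΦH ΨH) (LC : LimitPair I ΦC ΨC) :
    HasMoments (openMetrics d) I (restrictToBoxes (limitTransform K ΨH ΨC)) := by
  intro i p
  obtain ⟨C, hC⟩ := P.hasMoments_transform i p
  refine ⟨C, fun M t ht x hx => ?_⟩
  set Ps := (box d M).powerset.filter fun X => x ∈ X
  set B := ∑ X ∈ Ps, (1 + rdiam l1dist X) ^ p
  have hρ : ∀ X : Finset (Site d), 0 ≤ rdiam l1dist X := fun X => rdiam_nonneg _ X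
  have hB : 0 ≤ B := Finset.sum_nonneg fun X _ => by
    have := hρ X
    positivity
  refine le_of_forall_pos_le_add fun ε hε => ?_
  have hη : 0 < ε / (B + 1) := by positivity
  have hev : ∀ᶠ k in atTop, ∀ X ∈ Ps, ∀ t ∈ I, ‖timeDeriv I i
      (fun s X => limitTransform K ΨH ΨC s X - transform D K ΦH ΦC k s X) t X‖ ≤ ε / (B + 1) := by
    rw [eventually_all_finset]
    exact fun X hX => eventually_timeDeriv_limitTransform P LH LC i
      ⟨x, (Finset.mem_filter.1 hX).2⟩ hη
  -- Beyond `2dM` the two distances, and hence the diameters, agree on subsets of the box.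
  obtain ⟨k, hk, hkM⟩ := (hev.and (eventually_ge_atTop (2 * d * M + M))).exists
  have hMk : M ≤ k := by omega
  have hdM : 2 * d * M ≤ k := by omega
  have hbox := box_mono (d := d) hMk
  calc ∑ X ∈ Ps, (1 + rdiam l1dist X) ^ p
        * ‖timeDeriv I i (restrictToBoxes (limitTransform K ΨH ΨC) M) t X‖
      ≤ ∑ X ∈ Ps, ((1 + rdiam (D.dist k) X) ^ p * ‖timeDeriv I i (transform D K ΦH ΦC k) t X‖
          + (1 + rdiam l1dist X) ^ p * (ε / (B + 1))) := by
        refine Finset.sum_le_sum fun X hX => ?_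
        have hXM : X ⊆ box d M := Finset.mem_powerset.1 (Finset.mem_filter.1 hX).1
        have e1 : rdiam (D.dist k) X = rdiam l1dist X := rdiam_congr fun z hz z' hz' =>
          D.eq_l1dist k z (hbox (hXM hz)) z' (hbox (hXM hz'))
            ((l1dist_le_of_mem_box (hXM hz) (hXM hz')).trans (by exact_mod_cast hdM))
        have e2 : timeDeriv I i (restrictToBoxes (limitTransform K ΨH ΨC) M) t X
            = timeDeriv I i (limitTransform K ΨH ΨC) t X := by
          simp only [timeDeriv, restrictToBoxes_of_subset hXM]
        have e3 := hk X hX t ht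
        rw [timeDeriv, iteratedDerivWithin_fun_sub' P.ordConnected
          (contDiffOn_limitTransform P LH LC X) (P.contDiffOn_transform k X) i ht] at e3
        rw [e1, e2, ← mul_add]
        refine mul_le_mul_of_nonneg_left ?_ (pow_nonneg (by linarith [hρ X]) p)
        have := norm_sub_norm_le (timeDeriv I i (limitTransform K ΨH ΨC) t X)
          (timeDeriv I i (transform D K ΦH ΦC k) t X)
        simp only [timeDeriv] at this ⊢
        linarith
    _ ≤ C + ε := by
        rw [Finset.sum_add_distrib, ← Finset.sum_mul]
        refine add_le_add (le_trans ?_ (hC k t ht x (hbox hx))) ?_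
        · refine Finset.sum_le_sum_of_subset_of_nonneg
            (Finset.filter_subset_filter _ (Finset.powerset_mono.2 hbox)) fun X _ _ => ?_
          have := rdiam_nonneg (D.dist k) X
          positivity
        · rw [mul_div_assoc', div_le_iff₀ (by positivity)]
          nlinarith

theorem hasLimitLS_of_quasiLocalPair (P : QuasiLocalPair D I K a A ΦH ΦC)
    (LH : LimitPair I ΦH ΨH) (LC : LimitPair I ΦC ΨC) {O : OpFamily d r}
    (hO : ∀ k, ∀ t ∈ I, O k t = (∫ s, K s * s) • ΦC k t ∅
      + ∑ y ∈ box d k, localPiece K (ΦH k t) (ΦC k t) y (box d k)) : HasLimitLS D I O :=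
  hasLimitLS_of_moments (fun k t ht => (hO k t ht).trans (sum_transform k t).symm)
    P.isSmoothInteraction_transform P.hasMoments_transform
    (isSmoothInteraction_limitTransform P LH LC) (hasMoments_limitTransform P LH LC)
    fun i _ hX _ hε => eventually_timeDeriv_limitTransform P LH LC i hX hε

/-- The lowest order suffices: it contains the sums per site and the termwise convergence. -/
lemma HasLimitB.exists_limitPair {ζ : ℝ → ℝ} {Φ : Interaction d r} (h : HasLimitB D I ζ 0 Φ) :
    ∃ Ψ, LimitPair I Φ Ψ := by
  obtain ⟨-, ζs, h1, Ψ, ⟨h2, ζs', h3⟩, h4⟩ := h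
  exact ⟨Ψ, h2, hasBoundedSums_of_admissible h3,
    bulkConverges_of_tendsto (h1.classS 0).pos fun M => h4 0 M⟩

end InfiniteVolume

end LatticeFermions

/-! ### Conclusion -/

theorem lemmaD4 {d r : ℕ} (D : LatticeFermions.BoxMetrics d) (I : Set ℝ) (hI : I.OrdConnected)
    (g g' : ℝ) (hg' : 0 ≤ g') (hg : g' < g) (W : ℝ → ℝ) (hW : LatticeFermions.IsKernel g g' W)
    (a : ℝ) (ha : 0 < a) (H B : LatticeFermions.OpFamily d r)
    (hH : LatticeFermions.HasLimitLζ D I (fun s => Real.exp (-a * s)) H)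
    (hB : LatticeFermions.MemLS D I B ∨
      ∃ v : ℕ → ℝ → LatticeFermions.Site d → ℝ,
        LatticeFermions.MemV D I v ∧ B = LatticeFermions.potentialOp v)
    (hHB : LatticeFermions.HasLimitLS D I (LatticeFermions.iCommutator H B)) :
    LatticeFermions.MemLS D I (LatticeFermions.invLiouvillian W H B) ∧
      LatticeFermions.HasLimitLS D I (LatticeFermions.invLiouvillian W H B) := by
  open LatticeFermions in
  obtain ⟨ΦH, rH, lH⟩ := hH
  obtain ⟨ΦC, rC, lC⟩ := hHB
  obtain ⟨sH, ζH, aH, -⟩ := lH 0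
  obtain ⟨_, _, lC0⟩ := lC 0
  obtain ⟨A, hA, hpair⟩ := exists_pair_bound aH
  obtain ⟨ΨH, LH⟩ := (lH 0).exists_limitPair
  obtain ⟨ΨC, LC⟩ := lC0.exists_limitPair
  -- For the commutator the decay function may change with the order `n`; the moments do not depend
  -- on that choice.
  have mC : HasMoments D I ΦC := hasMoments_of_admissible fun n => by
    obtain ⟨ζ, -, -, ζs, h, -⟩ := lC n
    exact ⟨ζ, ζs, h⟩
  have P : QuasiLocalPair D I W a A ΦH ΦC :=
    ⟨hI, hW.integrable_mul_pow, ha, hA, sH, hasBoundedSums_of_admissible aH, hpair, lC0.1, mC⟩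
  have h : HasLimitLS D I (invLiouvillian W H B) :=
    hasLimitLS_of_quasiLocalPair P LH LC fun k t ht =>
      invLiouvillian_eq hW (sH.isLocalTerm k t ht) (lC0.1.isLocalTerm k t ht) (rH k t ht)
        (rC k t ht)
  exact ⟨h.memLS, h⟩
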